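/- Let $\mathbb K$ be a field of characteristic $0$, let $A$ be a commutative $\mathbb K$-algebra, put $A^e=A\otimes_{\mathbb K}A$, and let $\mathcal B$ be a left $A$-bialgebroid with unit map $\eta:A^e\to\mathcal B$, source $s=\eta(-\otimes 1)$, target $t=\eta(1\otimes -)$, comultiplication $\Delta:\mathcal B\to\mathcal B\otimes_A\mathcal B$ and counit $\varepsilon:\mathcal B\to A$; $\mathcal B$ is a left $A^e$-module via $\eta$. Let $\mathrm{Prim}(\mathcal B)=\{X\in\mathcal B\mid \Delta(X)=X\otimes_A1+1\otimes_AX\}$, a Lie algebra under the commutator, with anchor (Lie algebra morphism) $\omega:\mathrm{Prim}(\mathcal B)\to\mathrm{Der}_{\mathbb K}(A)$, $\omega(X)(a)=\varepsilon(Xs(a))=\varepsilon(Xt(a))$. Let $\langle s-t\rangle=\{s(a)-t(a)\mid a\in A\}$, a Lie ideal of $\mathrm{Prim}(\mathcal B)$ on which $\omega$ vanishes, and let $\overline{P}=\mathrm{Prim}(\mathcal B)/\langle s-t\rangle$, with the induced anchor $\overline\omega$. For a Lie algebra $L$ with anchor $L\to\mathrm{Der}_{\mathbb K}(A)$, let $A\odot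 U_{\mathbb K}(L)\odot A$ be the Connes-Moscovici bialgebroid: the vector space $A\otimes U_{\mathbb K}(L)\otimes A$ with product $(a\otimes u\otimes b)(a'\otimes v\otimes b')=\sum a(u_{(1)}\cdot a')\otimes u_{(2)}v\otimes(u_{(3)}\cdot b')b$, unit map $a\otimes b\mapsto a\otimes1\otimes b$, comultiplication $\Delta(a\otimes u\otimes b)=\sum(a\otimes u_{(1)}\otimes1)\otimes_A(1\otimes u_{(2)}\otimes b)$ and counit $a\otimes u\otimes b\mapsto a\,\varepsilon(u)\,b$, where $U_{\mathbb K}(L)$ acts on $A$ through the anchor. The primitive filtration of $\mathcal B$ is $F_n(\mathcal B)=\eta(A^e)+\sum_{k=1}^n\big(\eta(A^e)\,\mathrm{Prim}(\mathcal B)\,\eta(A^e)\big)^k$ for $n\ge0$, with $F_{-1}(\mathcal B)=0$. $\mathcal B$ is primitively generated if $\mathcal B=\bigcup_nF_n(\mathcal B)$, and graded projective if every $F_n(\mathcal B)/F_{n-1}(\mathcal B)$ is a projective left $A^e$-module. Theorem. There is an isomorphism of $A$-bialgebroids $\mathcal B\cong A\odot U_{\mathbb K}(\overline P)\odot A$ if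 and only if there is a linear section $\iota:\overline P\to\mathrm{Prim}(\mathcal B)$ of the canonical projection such that 1. $(X,Y)\mapsto\iota(X)+Y$ is an isomorphism of Lie algebras with anchors $\overline P\ltimes_\delta\langle s-t\rangle\cong\mathrm{Prim}(\mathcal B)$, for a semi-direct product given by a Lie algebra morphism $\delta:\overline P\to\mathrm{Der}_{\mathbb K}(\langle s-t\rangle)$ with $[\overline\omega(X),\omega(Y)]=\omega(\delta(X)(Y))$ for all $X\in\overline P$, $Y\in\langle s-t\rangle$, the anchor of the semi-direct product being $(X,Y)\mapsto\overline\omega(X)+\omega(Y)$; 2. $\mathcal B$ is graded projective and primitively generated; 3. the left $A^e$-submodule $A^e\cdot\iota(\overline P)$ of $\mathcal B$ either is $0$ and $\eta$ is injective, or is nonzero and free over $A^e$ with basis $(\iota(X_i))_i$ for some $\mathbb K$-basis $(X_i)_i$ of $\overline P$; 4. $A^e\cdot\langle s-t\rangle\cap A^e\cdot\iota(\overline P)=0$. -/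

import Mathlib

open scoped TensorProduct

universe u v w

attribute [local instance 100] LieRing.ofAssociativeRing

noncomputable section

namespace Bialgebroid

/-! ### Tensor products over the base algebra -/

section BalTensor

variable {K : Type*} {A : Type*} {B : Type*} {C : Type*} [Field K] [CommRing A] [Algebra K A]
  [Ring B] [Algebra K B] [Ring C] [Algebra K C]

/-- The source map `a ↦ η (a ⊗ 1)` of an algebra map `η : A ⊗ A → B`. -/
def src (η : A ⊗[K] A →ₐ[K] B) : A →ₐ[K] B := η.comp Algebra.TensorProduct.includeLeft

/-- The target map `a ↦ η (1 ⊗ a)` of an algebra map `η : A ⊗ A → B`; as `A` is commutative it is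
an algebra map on `A = Aᵒᵖ`. -/
def tgt (η : A ⊗[K] A →ₐ[K] B) : A →ₐ[K] B := η.comp Algebra.TensorProduct.includeRight

lemma src_mul_tgt (η : A ⊗[K] A →ₐ[K] B) (a b : A) : src η a * tgt η b = η (a ⊗ₜ b) := by
  simp [src, tgt, ← map_mul]

lemma tgt_mul_src (η : A ⊗[K] A →ₐ[K] B) (a b : A) : tgt η b * src η a = η (a ⊗ₜ b) := by
  simp [src, tgt, ← map_mul]

lemma src_tgt_comm (η : A ⊗[K] A →ₐ[K] B) (a b : A) :
    src η a * tgt η b = tgt η b * src η a := by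
  rw [src_mul_tgt, tgt_mul_src]

lemma src_comm (η : A ⊗[K] A →ₐ[K] B) (a b : A) : src η a * src η b = src η b * src η a := by
  rw [← map_mul, mul_comm, map_mul]

lemma tgt_comm (η : A ⊗[K] A →ₐ[K] B) (a b : A) : tgt η a * tgt η b = tgt η b * tgt η a := by
  rw [← map_mul, mul_comm, map_mul]

/-- The subspace of `B ⊗ B` spanned by all `t(a) m ⊗ n - m ⊗ s(a) n`. -/
def balRel (η : A ⊗[K] A →ₐ[K] B) : Submodule K (B ⊗[K] B) :=
  Submodule.span K
    {z | ∃ (a : A) (m n : B), z = (tgt η a * m) ⊗ₜ[K] n - m ⊗ₜ[K] (src η a * n)}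

/-- The tensor product `B ⊗_A B` of the `A`-bimodule `B` (with actions `a · m · b = s(a) t(b) m`)
with itself. -/
abbrev BalTensor (η : A ⊗[K] A →ₐ[K] B) : Type _ := (B ⊗[K] B) ⧸ balRel η

/-- The subspace of `B ⊗ (B ⊗ B)` spanned by the relations of `B ⊗_A B ⊗_A B`. -/
def balRel₃ (η : A ⊗[K] A →ₐ[K] B) : Submodule K (B ⊗[K] (B ⊗[K] B)) :=
  Submodule.span K
    ({z | ∃ (a : A) (l m n : B),
        z = (tgt η a * l) ⊗ₜ[K] (m ⊗ₜ[K] n) - l ⊗ₜ[K] ((src η a * m) ⊗ₜ[K] n)} ∪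
      {z | ∃ (a : A) (l m n : B),
        z = l ⊗ₜ[K] ((tgt η a * m) ⊗ₜ[K] n) - l ⊗ₜ[K] (m ⊗ₜ[K] (src η a * n))})

/-- The tensor product `B ⊗_A B ⊗_A B`. -/
abbrev BalTensor₃ (η : A ⊗[K] A →ₐ[K] B) : Type _ := (B ⊗[K] (B ⊗[K] B)) ⧸ balRel₃ η

lemma balRel_le {η : A ⊗[K] A →ₐ[K] B} {M : Type*} [AddCommGroup M] [Module K M]
    (f : B ⊗[K] B →ₗ[K] M)
    (h : ∀ (a : A) (m n : B), f ((tgt η a * m) ⊗ₜ n) = f (m ⊗ₜ (src η a * n))) :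
    balRel η ≤ LinearMap.ker f := by
  rw [balRel, Submodule.span_le]
  rintro _ ⟨a, m, n, rfl⟩
  simp [h]

lemma mk_balanced (η : A ⊗[K] A →ₐ[K] B) (a : A) (m n : B) :
    (balRel η).mkQ ((tgt η a * m) ⊗ₜ n) = (balRel η).mkQ (m ⊗ₜ (src η a * n)) := by
  rw [← sub_eq_zero, ← map_sub]
  exact (Submodule.Quotient.mk_eq_zero _).2 (Submodule.subset_span ⟨a, m, n, rfl⟩)

lemma mk₃_balanced_left (η : A ⊗[K] A →ₐ[K] B) (a : A) (l m n : B) :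
    (balRel₃ η).mkQ ((tgt η a * l) ⊗ₜ (m ⊗ₜ n)) =
      (balRel₃ η).mkQ (l ⊗ₜ ((src η a * m) ⊗ₜ n)) := by
  rw [← sub_eq_zero, ← map_sub]
  exact (Submodule.Quotient.mk_eq_zero _).2 (Submodule.subset_span (Or.inl ⟨a, l, m, n, rfl⟩))

lemma mk₃_balanced_right (η : A ⊗[K] A →ₐ[K] B) (a : A) (l m n : B) :
    (balRel₃ η).mkQ (l ⊗ₜ ((tgt η a * m) ⊗ₜ n)) =
      (balRel₃ η).mkQ (l ⊗ₜ (m ⊗ₜ (src η a * n))) := by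
  rw [← sub_eq_zero, ← map_sub]
  exact (Submodule.Quotient.mk_eq_zero _).2 (Submodule.subset_span (Or.inr ⟨a, l, m, n, rfl⟩))

/-- The map `f ⊗_A g : B ⊗_A B → C ⊗_A C`, `m ⊗ n ↦ f m ⊗ g n`, for `f` right `A`-linear and `g`
left `A`-linear. -/
def balMap {η : A ⊗[K] A →ₐ[K] B} {θ : A ⊗[K] A →ₐ[K] C} (f g : B →ₗ[K] C)
    (hf : ∀ a m, f (tgt η a * m) = tgt θ a * f m)
    (hg : ∀ a n, g (src η a * n) = src θ a * g n) :
    BalTensor η →ₗ[K] BalTensor θ :=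
  (balRel η).liftQ ((balRel θ).mkQ ∘ₗ TensorProduct.map f g) <| balRel_le _ fun a m n ↦ by
    simp only [LinearMap.comp_apply, TensorProduct.map_tmul, hf, hg, mk_balanced]

/-- The `A`-bimodule structure of `B ⊗_A B`: `m ⊗ n ↦ s(a) m ⊗ t(b) n`. -/
def biact (η : A ⊗[K] A →ₐ[K] B) (a b : A) : BalTensor η →ₗ[K] BalTensor η :=
  balMap (LinearMap.mulLeft K (src η a)) (LinearMap.mulLeft K (tgt η b))
    (fun c m ↦ by simp [← mul_assoc, src_tgt_comm]) (fun c n ↦ by simp [← mul_assoc, src_tgt_comm])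

/-- The map `m ⊗ n ↦ m t(a) ⊗ n` of `B ⊗_A B`. -/
def rightTgt (η : A ⊗[K] A →ₐ[K] B) (a : A) : BalTensor η →ₗ[K] BalTensor η :=
  balMap (LinearMap.mulRight K (tgt η a)) LinearMap.id
    (fun c m ↦ by simp [mul_assoc]) (fun c n ↦ rfl)

/-- The map `m ⊗ n ↦ m ⊗ n s(a)` of `B ⊗_A B`. -/
def rightSrc (η : A ⊗[K] A →ₐ[K] B) (a : A) : BalTensor η →ₗ[K] BalTensor η :=
  balMap LinearMap.id (LinearMap.mulRight K (src η a))
    (fun c m ↦ rfl) (fun c n ↦ by simp [mul_assoc])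

/-- The Takeuchi-Sweedler product `B ×_A B` inside `B ⊗_A B`: the elements `∑ mᵢ ⊗ nᵢ` with
`∑ mᵢ t(a) ⊗ nᵢ = ∑ mᵢ ⊗ nᵢ s(a)` for all `a`. -/
def takeuchi (η : A ⊗[K] A →ₐ[K] B) : Submodule K (BalTensor η) :=
  ⨅ a : A, LinearMap.ker (rightTgt η a - rightSrc η a)

/-- The canonical map `(B ⊗_A B) ⊗ B → B ⊗_A B ⊗_A B`. -/
def joinLeft (η : A ⊗[K] A →ₐ[K] B) : BalTensor η ⊗[K] B →ₗ[K] BalTensor₃ η :=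
  TensorProduct.lift <| (balRel η).liftQ
    ((TensorProduct.mk K (B ⊗[K] B) B).compr₂
      ((balRel₃ η).mkQ ∘ₗ (TensorProduct.assoc K B B B).toLinearMap)) <|
    balRel_le _ fun a m n ↦ by
      ext p
      simp only [LinearMap.compr₂_apply, TensorProduct.mk_apply, LinearMap.comp_apply,
        LinearEquiv.coe_coe, TensorProduct.assoc_tmul, mk₃_balanced_left]

/-- The canonical map `B ⊗ (B ⊗_A B) → B ⊗_A B ⊗_A B`. -/
def joinRight (η : A ⊗[K] A →ₐ[K] B) : B ⊗[K] BalTensor η →ₗ[K] BalTensor₃ η :=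
  TensorProduct.lift <| LinearMap.flip <| (balRel η).liftQ
    ((TensorProduct.mk K B (B ⊗[K] B)).compr₂ (balRel₃ η).mkQ).flip <|
    balRel_le _ fun a m n ↦ by
      ext p
      simp only [LinearMap.flip_apply, LinearMap.compr₂_apply, TensorProduct.mk_apply,
        mk₃_balanced_right]

lemma joinLeft_biact (η : A ⊗[K] A →ₐ[K] B) (a : A) (z : BalTensor η) (n : B) :
    joinLeft η (biact η 1 a z ⊗ₜ n) = joinLeft η (z ⊗ₜ (src η a * n)) := by
  suffices h : (joinLeft η ∘ₗ (TensorProduct.mk K (BalTensor η) B).flip n) ∘ₗ biact η 1 a =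
      joinLeft η ∘ₗ (TensorProduct.mk K (BalTensor η) B).flip (src η a * n) from
    LinearMap.congr_fun h z
  refine Submodule.linearMap_qext _ (TensorProduct.ext' fun x y ↦ ?_)
  simpa [joinLeft, biact, balMap] using mk₃_balanced_right η a x y n

lemma joinRight_biact (η : A ⊗[K] A →ₐ[K] B) (a : A) (m : B) (z : BalTensor η) :
    joinRight η ((tgt η a * m) ⊗ₜ z) = joinRight η (m ⊗ₜ biact η a 1 z) := by
  suffices h : joinRight η ∘ₗ TensorProduct.mk K B (BalTensor η) (tgt η a * m) =
      (joinRight η ∘ₗ TensorProduct.mk K B (BalTensor η) m) ∘ₗ biact η a 1 from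
    LinearMap.congr_fun h z
  refine Submodule.linearMap_qext _ (TensorProduct.ext' fun x y ↦ ?_)
  simpa [joinRight, biact, balMap] using mk₃_balanced_left η a m x y

end BalTensor

end Bialgebroid

open Bialgebroid in
/-- The underlying data of a left bialgebroid `B` over the commutative `K`-algebra `A`: an algebra
map `η : A ⊗ A → B`, and `A`-bilinear maps `Δ : B → B ⊗_A B` and `ε : B → A`. -/
class PreLeftBialgebroid (K : Type*) (A : Type*) (B : Type*) [Field K] [CommRing A]
    [Algebra K A] [Ring B] [Algebra K B] where
  eta : A ⊗[K] A →ₐ[K] B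
  comul : B →ₗ[K] BalTensor eta
  counit : B →ₗ[K] A
  comul_eta_mul (a b : A) (ξ : B) : comul (eta (a ⊗ₜ b) * ξ) = biact eta a b (comul ξ)
  counit_eta_mul (a b : A) (ξ : B) : counit (eta (a ⊗ₜ b) * ξ) = a * counit ξ * b

namespace Bialgebroid

section Data

variable (K : Type*) (A : Type*) (B : Type*) [Field K] [CommRing A]
    [Algebra K A] [Ring B] [Algebra K B] [PreLeftBialgebroid K A B]

/-- The unit map `η : A ⊗ A → B`. -/
abbrev eta : A ⊗[K] A →ₐ[K] B := PreLeftBialgebroid.eta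

/-- The source map `s : A → B`. -/
abbrev source : A →ₐ[K] B := src (eta K A B)

/-- The target map `t : A → B`. -/
abbrev target : A →ₐ[K] B := tgt (eta K A B)

/-- The comultiplication `Δ : B → B ⊗_A B`. -/
abbrev comul : B →ₗ[K] BalTensor (eta K A B) := PreLeftBialgebroid.comul

/-- The counit `ε : B → A`. -/
abbrev counit : B →ₗ[K] A := PreLeftBialgebroid.counit

variable {B} in
lemma comul_target_mul (a : A) (ξ : B) :
    comul K A B (target K A B a * ξ) = biact (eta K A B) 1 a (comul K A B ξ) := by
  rw [← PreLeftBialgebroid.comul_eta_mul, ← src_mul_tgt]; simp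

variable {B} in
lemma comul_source_mul (a : A) (ξ : B) :
    comul K A B (source K A B a * ξ) = biact (eta K A B) a 1 (comul K A B ξ) := by
  rw [← PreLeftBialgebroid.comul_eta_mul, ← src_mul_tgt]; simp

variable {B} in
lemma counit_source_mul (a : A) (ξ : B) :
    counit K A B (source K A B a * ξ) = a * counit K A B ξ := by
  rw [show source K A B a = eta K A B (a ⊗ₜ 1) from rfl, PreLeftBialgebroid.counit_eta_mul,
    mul_one]

variable {B} in
lemma counit_target_mul (a : A) (ξ : B) :
    counit K A B (target K A B a * ξ) = a * counit K A B ξ := by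
  rw [show target K A B a = eta K A B (1 ⊗ₜ a) from rfl, PreLeftBialgebroid.counit_eta_mul,
    one_mul, mul_comm]

/-- The map `Δ ⊗_A B : B ⊗_A B → B ⊗_A B ⊗_A B`. -/
def comulTensor : BalTensor (eta K A B) →ₗ[K] BalTensor₃ (eta K A B) :=
  (balRel (eta K A B)).liftQ (joinLeft (eta K A B) ∘ₗ (comul K A B).rTensor B) <|
    balRel_le _ fun a m n ↦ by
      rw [LinearMap.comp_apply, LinearMap.comp_apply, LinearMap.rTensor_tmul,
        LinearMap.rTensor_tmul, comul_target_mul, joinLeft_biact]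

/-- The map `B ⊗_A Δ : B ⊗_A B → B ⊗_A B ⊗_A B`. -/
def tensorComul : BalTensor (eta K A B) →ₗ[K] BalTensor₃ (eta K A B) :=
  (balRel (eta K A B)).liftQ (joinRight (eta K A B) ∘ₗ (comul K A B).lTensor B) <|
    balRel_le _ fun a m n ↦ by
      rw [LinearMap.comp_apply, LinearMap.comp_apply, LinearMap.lTensor_tmul,
        LinearMap.lTensor_tmul, comul_source_mul, joinRight_biact]

/-- The map `ε ⊗_A B : B ⊗_A B → A ⊗_A B = B`, `m ⊗ n ↦ s(ε(m)) n`. -/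
def counitTensor : BalTensor (eta K A B) →ₗ[K] B :=
  (balRel (eta K A B)).liftQ
    (TensorProduct.lift
      ((LinearMap.mul K B) ∘ₗ (source K A B).toLinearMap ∘ₗ counit K A B)) <|
    balRel_le _ fun a m n ↦ by
      simp only [TensorProduct.lift.tmul, LinearMap.comp_apply, AlgHom.toLinearMap_apply,
        LinearMap.mul_apply', counit_target_mul, map_mul, mul_comm a]
      rw [mul_assoc]

/-- The map `B ⊗_A ε : B ⊗_A B → B ⊗_A A = B`, `m ⊗ n ↦ t(ε(n)) m`. -/
def tensorCounit : BalTensor (eta K A B) →ₗ[K] B :=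
  (balRel (eta K A B)).liftQ
    (TensorProduct.lift
      ((LinearMap.mul K B) ∘ₗ (target K A B).toLinearMap ∘ₗ counit K A B).flip) <|
    balRel_le _ fun a m n ↦ by
      simp only [TensorProduct.lift.tmul, LinearMap.flip_apply, LinearMap.comp_apply,
        AlgHom.toLinearMap_apply, LinearMap.mul_apply', counit_source_mul, map_mul, mul_comm a]
      rw [mul_assoc]

end Data

end Bialgebroid

open Bialgebroid in
/-- A left bialgebroid `B` over the commutative `K`-algebra `A`. The componentwise product of
two elements of the Takeuchi product `B ×_A B ⊆ B ⊗_A B` does not depend on the representatives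
in `B ⊗ B`; it is expressed through representatives in `comul_mul`. -/
class LeftBialgebroid (K : Type*) (A : Type*) (B : Type*) [Field K] [CommRing A]
    [Algebra K A] [Ring B] [Algebra K B] extends PreLeftBialgebroid K A B where
  coassoc : comulTensor K A B ∘ₗ comul = tensorComul K A B ∘ₗ comul
  counit_tensor_comul (ξ : B) : counitTensor K A B (comul ξ) = ξ
  tensor_counit_comul (ξ : B) : tensorCounit K A B (comul ξ) = ξ
  comul_mem_takeuchi (ξ : B) : comul ξ ∈ takeuchi eta
  comul_one : comul 1 = (balRel eta).mkQ (1 ⊗ₜ 1)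
  comul_mul (ξ ξ' : B) (x x' : B ⊗[K] B) (hx : (balRel eta).mkQ x = comul ξ)
    (hx' : (balRel eta).mkQ x' = comul ξ') : comul (ξ * ξ') = (balRel eta).mkQ (x * x')
  counit_mul_source (ξ ξ' : B) : counit (ξ * src eta (counit ξ')) = counit (ξ * ξ')
  counit_mul_target (ξ ξ' : B) : counit (ξ * tgt eta (counit ξ')) = counit (ξ * ξ')
  counit_one : counit 1 = 1

open Bialgebroid in
/-- An isomorphism of left `A`-bialgebroids. -/
structure LeftBialgebroid.Iso (K : Type*) (A : Type*) (B : Type*) (C : Type*) [Field K]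
    [CommRing A] [Algebra K A] [Ring B] [Algebra K B] [Ring C] [Algebra K C]
    [LeftBialgebroid K A B] [LeftBialgebroid K A C] extends B ≃ₐ[K] C where
  map_source (a : A) : toFun (source K A B a) = source K A C a
  map_target (a : A) : toFun (target K A B a) = target K A C a
  map_counit (ξ : B) : counit K A C (toFun ξ) = counit K A B ξ
  map_comul (ξ : B) :
    balMap toAlgEquiv.toLinearMap toAlgEquiv.toLinearMap
      (fun a m ↦ (map_mul' _ _).trans (congrArg (· * toFun m) (map_target a)))
      (fun a m ↦ (map_mul' _ _).trans (congrArg (· * toFun m) (map_source a)))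
      (comul K A B ξ) = comul K A C (toFun ξ)

namespace Bialgebroid

/-! ### Primitive elements -/

section Primitive

variable (K : Type*) (A : Type*) (B : Type*) [Field K] [CommRing A]
    [Algebra K A] [Ring B] [Algebra K B] [LeftBialgebroid K A B]

variable {B} in
lemma primitive_bracket {X Y : B}
    (hX : comul K A B X = (balRel (eta K A B)).mkQ (X ⊗ₜ 1 + 1 ⊗ₜ X))
    (hY : comul K A B Y = (balRel (eta K A B)).mkQ (Y ⊗ₜ 1 + 1 ⊗ₜ Y)) :
    comul K A B ⁅X, Y⁆ = (balRel (eta K A B)).mkQ (⁅X, Y⁆ ⊗ₜ 1 + 1 ⊗ₜ ⁅X, Y⁆) := by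
  rw [Ring.lie_def, map_sub, LeftBialgebroid.comul_mul X Y _ _ hX.symm hY.symm,
    LeftBialgebroid.comul_mul Y X _ _ hY.symm hX.symm, ← map_sub]
  congr 1
  simp only [mul_add, add_mul, Algebra.TensorProduct.tmul_mul_tmul, one_mul, mul_one,
    TensorProduct.sub_tmul, TensorProduct.tmul_sub]
  abel

/-- The Lie algebra `Prim(B)` of the primitive elements of `B`, with the commutator bracket. -/
def Prim : LieSubalgebra K B where
  carrier := {X | comul K A B X = (balRel (eta K A B)).mkQ (X ⊗ₜ 1 + 1 ⊗ₜ X)}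
  add_mem' {X Y} hX hY := by
    simp only [Set.mem_ofPred_eq] at hX hY ⊢
    rw [map_add, hX, hY, ← map_add, TensorProduct.add_tmul, TensorProduct.tmul_add]
    congr 1
    abel
  zero_mem' := by simp
  smul_mem' c X hX := by
    simp only [Set.mem_ofPred_eq] at hX ⊢
    rw [map_smul, hX, ← map_smul, smul_add, TensorProduct.smul_tmul', TensorProduct.tmul_smul]
  lie_mem' hX hY := primitive_bracket K A hX hY

variable {B}

lemma comul_prim (X : Prim K A B) :
    comul K A B (X : B) = (balRel (eta K A B)).mkQ ((X : B) ⊗ₜ 1 + 1 ⊗ₜ (X : B)) := X.2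

lemma counit_source (a : A) : counit K A B (source K A B a) = a := by
  rw [← mul_one (source K A B a), counit_source_mul,
    show counit K A B 1 = 1 from LeftBialgebroid.counit_one, mul_one]

lemma counit_target (a : A) : counit K A B (target K A B a) = a := by
  rw [← mul_one (target K A B a), counit_target_mul,
    show counit K A B 1 = 1 from LeftBialgebroid.counit_one, mul_one]

lemma counitTensor_mk (m n : B) : counitTensor K A B ((balRel (eta K A B)).mkQ (m ⊗ₜ n)) =
    source K A B (counit K A B m) * n := rfl

lemma tensorCounit_mk (m n : B) : tensorCounit K A B ((balRel (eta K A B)).mkQ (m ⊗ₜ n)) =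
    target K A B (counit K A B n) * m := rfl

lemma counit_prim (X : Prim K A B) : counit K A B (X : B) = 0 := by
  have h := LeftBialgebroid.counit_tensor_comul (K := K) (A := A) (X : B)
  rw [show PreLeftBialgebroid.comul (X : B) = comul K A B (X : B) from rfl, comul_prim, map_add,
    map_add, counitTensor_mk, counitTensor_mk,
    show counit K A B 1 = 1 from LeftBialgebroid.counit_one, map_one, one_mul, mul_one,
    add_eq_right] at h
  rw [← counit_source K A (B := B) (counit K A B (X : B)), h, map_zero]

lemma counit_mul_target_eq (ξ : B) (a : A) :
    counit K A B (ξ * target K A B a) = counit K A B (ξ * source K A B a) := by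
  have h := LeftBialgebroid.counit_mul_target (K := K) (A := A) ξ (source K A B a)
  rwa [show PreLeftBialgebroid.counit (source K A B a) = counit K A B (source K A B a) from rfl,
    counit_source] at h

lemma prim_takeuchi (X : Prim K A B) (a : A) :
    (balRel (eta K A B)).mkQ (((X : B) * target K A B a) ⊗ₜ 1 + target K A B a ⊗ₜ (X : B)) =
      (balRel (eta K A B)).mkQ ((X : B) ⊗ₜ source K A B a + 1 ⊗ₜ ((X : B) * source K A B a)) := by
  have h := LeftBialgebroid.comul_mem_takeuchi (K := K) (A := A) (X : B)
  rw [show PreLeftBialgebroid.comul (X : B) = comul K A B (X : B) from rfl, comul_prim, takeuchi,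
    Submodule.mem_iInf] at h
  have h' := h a
  rw [LinearMap.mem_ker, LinearMap.sub_apply, sub_eq_zero] at h'
  simpa [rightTgt, rightSrc, balMap] using h'

lemma prim_mul_target (X : Prim K A B) (a : A) :
    (X : B) * target K A B a =
      target K A B a * X + target K A B (counit K A B ((X : B) * source K A B a)) := by
  have h := congrArg (tensorCounit K A B) (prim_takeuchi K A X a)
  rw [map_add, map_add, map_add, map_add, tensorCounit_mk, tensorCounit_mk, tensorCounit_mk,
    tensorCounit_mk, counit_prim, counit_source,
    show counit K A B 1 = 1 from LeftBialgebroid.counit_one] at h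
  simpa using h

lemma prim_mul_source (X : Prim K A B) (a : A) :
    (X : B) * source K A B a =
      source K A B a * X + source K A B (counit K A B ((X : B) * source K A B a)) := by
  have h := congrArg (counitTensor K A B) (prim_takeuchi K A X a)
  rw [add_comm (source K A B a * (X : B)), ← counit_mul_target_eq]
  rw [map_add, map_add, map_add, map_add, counitTensor_mk, counitTensor_mk, counitTensor_mk,
    counitTensor_mk, counit_prim, counit_target,
    show counit K A B 1 = 1 from LeftBialgebroid.counit_one] at h
  simpa using h.symm

/-- The anchor `ω : Prim(B) → Der_K(A)`, `ω(X)(a) = ε(X s(a)) = ε(X t(a))`. -/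
def anchor : Prim K A B →ₗ⁅K⁆ Derivation K A A where
  toFun X := Derivation.mk'
    (counit K A B ∘ₗ LinearMap.mulLeft K (X : B) ∘ₗ (source K A B).toLinearMap) fun a b ↦ by
      simp only [LinearMap.comp_apply, AlgHom.toLinearMap_apply, LinearMap.mulLeft_apply, map_mul,
        smul_eq_mul]
      rw [← mul_assoc]
      nth_rw 1 [prim_mul_source]
      rw [add_mul, map_add, mul_assoc, counit_source_mul, counit_source_mul, counit_source,
        mul_comm b]
  map_add' X Y := by ext a; simp [add_mul]
  map_smul' c X := by ext a; simp
  map_lie' {X Y} := by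
    have key (Z W : Prim K A B) (a : A) :
        counit K A B ((Z : B) * (W : B) * source K A B a) =
          counit K A B ((Z : B) * source K A B (counit K A B ((W : B) * source K A B a))) := by
      rw [mul_assoc]
      exact (LeftBialgebroid.counit_mul_source _ _).symm
    ext a
    simp [Derivation.commutator_apply, Ring.lie_def, sub_mul, key]

lemma anchor_apply (X : Prim K A B) (a : A) :
    anchor K A X a = counit K A B ((X : B) * source K A B a) := rfl

lemma source_sub_target_mem (a : A) : source K A B a - target K A B a ∈ Prim K A B := by
  have hs := comul_source_mul K A a (1 : B)
  have ht := comul_target_mul K A a (1 : B)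
  rw [show comul K A B 1 = _ from LeftBialgebroid.comul_one] at hs ht
  change comul K A B _ = _
  rw [← mul_one (source K A B a), ← mul_one (target K A B a), map_sub, hs, ht]
  have hb := mk_balanced (eta K A B) a 1 1
  simp only [mul_one] at hb
  simp only [mul_one, TensorProduct.sub_tmul, TensorProduct.tmul_sub, map_add, map_sub]
  rw [hb]
  simp [biact, balMap]

variable (B)

/-- The Lie ideal `⟨s - t⟩ = {s(a) - t(a) | a ∈ A}` of `Prim(B)`. -/
def sSubT : LieIdeal K (Prim K A B) where
  carrier := {X | ∃ a : A, (X : B) = source K A B a - target K A B a}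
  add_mem' := by
    rintro X Y ⟨a, ha⟩ ⟨b, hb⟩
    exact ⟨a + b, by rw [AddMemClass.coe_add, ha, hb, map_add, map_add]; abel⟩
  zero_mem' := ⟨0, by simp⟩
  smul_mem' := by
    rintro c X ⟨a, ha⟩
    exact ⟨c • a, by rw [SetLike.val_smul, ha, map_smul, map_smul, smul_sub]⟩
  lie_mem := by
    rintro X Y ⟨a, ha⟩
    refine ⟨anchor K A X a, ?_⟩
    rw [LieSubalgebra.coe_bracket, Ring.lie_def, ha, mul_sub, sub_mul, prim_mul_source,
      prim_mul_target, anchor_apply]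
    abel

lemma anchor_sSubT (X : Prim K A B) (hX : X ∈ sSubT K A B) : anchor K A X = 0 := by
  obtain ⟨a, ha⟩ := hX
  ext b
  rw [anchor_apply, ha, sub_mul, map_sub, counit_source_mul, counit_target_mul, counit_source]
  simp

/-- The quotient Lie algebra `Prim(B) / ⟨s - t⟩`. -/
abbrev PrimBar : Type _ := Prim K A B ⧸ sSubT K A B

/-- The anchor of `Prim(B) / ⟨s - t⟩` induced by the anchor of `Prim(B)`. -/
def anchorBar : PrimBar K A B →ₗ⁅K⁆ Derivation K A A where
  toLinearMap := (sSubT K A B).toSubmodule.liftQ (anchor K A (B := B)).toLinearMap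
    fun X hX ↦ anchor_sSubT K A B X hX
  map_lie' {X Y} := by
    obtain ⟨X, rfl⟩ := LieSubmodule.Quotient.surjective_mk' _ X
    obtain ⟨Y, rfl⟩ := LieSubmodule.Quotient.surjective_mk' _ Y
    exact (anchor K A (B := B)).map_lie X Y

end Primitive

end Bialgebroid
end

noncomputable section

namespace Bialgebroid

/-! ### The universal enveloping bialgebra -/

section Enveloping

variable (K : Type*) (L : Type*) [Field K] [LieRing L] [LieAlgebra K L]

local notation "U" => UniversalEnvelopingAlgebra K L

/-- The algebra map `U(L) → U(L) ⊗ U(L)` with `x ↦ x ⊗ 1 + 1 ⊗ x` for `x ∈ L`. -/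
def envComul : U →ₐ[K] U ⊗[K] U :=
  UniversalEnvelopingAlgebra.lift K
    { toFun := fun X ↦ UniversalEnvelopingAlgebra.ι K X ⊗ₜ 1 + 1 ⊗ₜ UniversalEnvelopingAlgebra.ι K X
      map_add' := fun X Y ↦ by
        rw [map_add, TensorProduct.add_tmul, TensorProduct.tmul_add]; abel
      map_smul' := fun c X ↦ by
        rw [map_smul, ← TensorProduct.smul_tmul', TensorProduct.tmul_smul, ← smul_add]; rfl
      map_lie' := fun {X Y} ↦ by
        rw [LieHom.map_lie, Ring.lie_def, Ring.lie_def]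
        simp only [mul_add, add_mul, Algebra.TensorProduct.tmul_mul_tmul, one_mul, mul_one,
          TensorProduct.sub_tmul, TensorProduct.tmul_sub]
        abel }

/-- The algebra map `U(L) → K` with `x ↦ 0` for `x ∈ L`. -/
def envCounit : U →ₐ[K] K := UniversalEnvelopingAlgebra.lift K (0 : L →ₗ⁅K⁆ K)

variable {K L} in
lemma envComul_ι (X : L) : envComul K L (UniversalEnvelopingAlgebra.ι K X) =
    UniversalEnvelopingAlgebra.ι K X ⊗ₜ 1 + 1 ⊗ₜ UniversalEnvelopingAlgebra.ι K X :=
  UniversalEnvelopingAlgebra.lift_ι_apply K _ X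

variable {K L} in
lemma envCounit_ι (X : L) : envCounit K L (UniversalEnvelopingAlgebra.ι K X) = 0 :=
  UniversalEnvelopingAlgebra.lift_ι_apply K _ X

variable {K L} in
lemma env_hom_ext {C : Type*} [Ring C] [Algebra K C] {f g : U →ₐ[K] C}
    (h : ∀ X, f (UniversalEnvelopingAlgebra.ι K X) = g (UniversalEnvelopingAlgebra.ι K X)) :
    f = g := by
  refine UniversalEnvelopingAlgebra.hom_ext K (LieHom.ext fun X ↦ ?_)
  simpa using h X

/-- The bialgebra structure of the universal enveloping algebra, in which the elements of `L`
are primitive. -/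
instance : Bialgebra K U :=
  Bialgebra.ofAlgHom (envComul K L) (envCounit K L)
    (env_hom_ext fun X ↦ by
      simp only [AlgHom.comp_apply, envComul_ι, map_add, Algebra.TensorProduct.map_tmul,
        TensorProduct.add_tmul, TensorProduct.tmul_add, map_one, AlgHom.id_apply,
        Algebra.TensorProduct.one_def, AlgEquiv.toAlgHom_apply,
        Algebra.TensorProduct.assoc_tmul, add_assoc])
    (env_hom_ext fun X ↦ by
      simp only [AlgHom.comp_apply, envComul_ι, map_add, Algebra.TensorProduct.map_tmul,
        envCounit_ι, map_one, AlgHom.id_apply, TensorProduct.zero_tmul, zero_add]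
      rfl)
    (env_hom_ext fun X ↦ by
      simp only [AlgHom.comp_apply, envComul_ι, map_add, Algebra.TensorProduct.map_tmul,
        envCounit_ι, map_one, AlgHom.id_apply, TensorProduct.tmul_zero, add_zero]
      rfl)

variable {K L}

lemma comul_ι (X : L) : Coalgebra.comul (R := K) (UniversalEnvelopingAlgebra.ι K X) =
    UniversalEnvelopingAlgebra.ι K X ⊗ₜ 1 + 1 ⊗ₜ UniversalEnvelopingAlgebra.ι K X :=
  envComul_ι X

lemma counit_ι (X : L) : Coalgebra.counit (R := K) (UniversalEnvelopingAlgebra.ι K X) = 0 :=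
  envCounit_ι X

/-- Induction on `U(L)`: it is generated by `L` as an algebra. -/
lemma env_induction (S : Subalgebra K U) (hS : ∀ X, UniversalEnvelopingAlgebra.ι K X ∈ S) (u : U) :
    u ∈ S := by
  let f : L →ₗ⁅K⁆ S :=
    { toFun := fun X ↦ ⟨UniversalEnvelopingAlgebra.ι K X, hS X⟩
      map_add' := fun X Y ↦ Subtype.ext (map_add _ _ _)
      map_smul' := fun c X ↦ Subtype.ext (map_smul _ _ _)
      map_lie' := fun {X Y} ↦ Subtype.ext (LieHom.map_lie _ _ _) }
  have h : S.val.comp (UniversalEnvelopingAlgebra.lift K f) = AlgHom.id K U := env_hom_ext fun X ↦ by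
    rw [AlgHom.comp_apply, UniversalEnvelopingAlgebra.lift_ι_apply]
    rfl
  rw [← AlgHom.id_apply (R := K) u, ← h]
  exact (UniversalEnvelopingAlgebra.lift K f u).2

end Enveloping

end Bialgebroid
end

noncomputable section

namespace Bialgebroid

/-! ### The Connes-Moscovici bialgebroid -/

section ConnesMoscovici

variable {K : Type*} {A : Type*} {L : Type*} [Field K] [CommRing A] [Algebra K A]
  [LieRing L] [LieAlgebra K L]

local notation "U" => UniversalEnvelopingAlgebra K L
local notation "E" => A ⊗[K] (UniversalEnvelopingAlgebra K L ⊗[K] A)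
local notation "j" => UniversalEnvelopingAlgebra.ι K

/-- The action of `U(L)` on `A` extending the anchor `ω : L → Der_K(A)`. -/
def envAct (ω : L →ₗ⁅K⁆ Derivation K A A) : U →ₐ[K] Module.End K A :=
  UniversalEnvelopingAlgebra.lift K
    { toFun := fun X ↦ ((ω X : Derivation K A A) : A →ₗ[K] A)
      map_add' := fun X Y ↦ by ext; simp
      map_smul' := fun c X ↦ by ext; simp
      map_lie' := fun {X Y} ↦ by ext; simp [Ring.lie_def] }

lemma envAct_ι (ω : L →ₗ⁅K⁆ Derivation K A A) (X : L) (a : A) : envAct ω (j X) a = ω X a :=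
  LinearMap.congr_fun (UniversalEnvelopingAlgebra.lift_ι_apply K _ X) a

/-- The twofold comultiplication `u ↦ ∑ u₁ ⊗ (u₂ ⊗ u₃)` of `U(L)`. -/
def envComul₂ : U →ₐ[K] U ⊗[K] (U ⊗[K] U) :=
  (Algebra.TensorProduct.map (AlgHom.id K U) (Bialgebra.comulAlgHom K U)).comp
    (Bialgebra.comulAlgHom K U)

/-- The map `v₁ ⊗ (v₂ ⊗ v₃) ↦ (a ⊗ v ⊗ b ↦ (v₁ · a) ⊗ v₂ v ⊗ (v₃ · b))`. -/
def cmAct₃ (ω : L →ₗ⁅K⁆ Derivation K A A) : U ⊗[K] (U ⊗[K] U) →ₐ[K] Module.End K E :=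
  Module.endTensorEndAlgHom.comp (Algebra.TensorProduct.map (envAct ω)
    (Module.endTensorEndAlgHom.comp (Algebra.TensorProduct.map (Algebra.lmul K U) (envAct ω))))

/-- The map `u ↦ (a ⊗ v ⊗ b ↦ ∑ (u₁ · a) ⊗ u₂ v ⊗ (u₃ · b))`. -/
def cmAct (ω : L →ₗ⁅K⁆ Derivation K A A) : U →ₐ[K] Module.End K E :=
  (cmAct₃ ω).comp envComul₂

variable (K A L) in
/-- `c ↦ (a ⊗ v ⊗ b ↦ c a ⊗ v ⊗ b)`. -/
def cmLeft : A →ₐ[K] Module.End K E :=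
  Module.endTensorEndAlgHom.comp (Algebra.TensorProduct.includeLeft.comp (Algebra.lmul K A))

variable (K A L) in
/-- `c ↦ (a ⊗ v ⊗ b ↦ a ⊗ v ⊗ c b)`. -/
def cmRight : A →ₐ[K] Module.End K E :=
  Module.endTensorEndAlgHom.comp (Algebra.TensorProduct.includeRight.comp
    (Module.endTensorEndAlgHom.comp (Algebra.TensorProduct.includeRight.comp (Algebra.lmul K A))))

/-- The multiplication of the Connes-Moscovici bialgebroid:
`(a ⊗ u ⊗ b) (a' ⊗ v ⊗ b') = ∑ a (u₁ · a') ⊗ u₂ v ⊗ (u₃ · b') b`. -/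
def cmMul (ω : L →ₗ⁅K⁆ Derivation K A A) : E →ₗ[K] Module.End K E :=
  LinearMap.mul' K (Module.End K E) ∘ₗ TensorProduct.map (cmLeft K A L).toLinearMap
    (LinearMap.mul' K (Module.End K E) ∘ₗ
      TensorProduct.map (cmRight K A L).toLinearMap (cmAct ω).toLinearMap ∘ₗ
      (TensorProduct.comm K U A).toLinearMap)

lemma cmLeft_tmul (c a b : A) (v : U) :
    cmLeft K A L c (a ⊗ₜ (v ⊗ₜ b)) = (c * a) ⊗ₜ (v ⊗ₜ b) := rfl

lemma cmRight_tmul (c a b : A) (v : U) :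
    cmRight K A L c (a ⊗ₜ (v ⊗ₜ b)) = a ⊗ₜ (v ⊗ₜ (c * b)) := rfl

lemma cmAct₃_tmul (ω : L →ₗ⁅K⁆ Derivation K A A) (u₁ u₂ u₃ v : U) (a b : A) :
    cmAct₃ ω (u₁ ⊗ₜ (u₂ ⊗ₜ u₃)) (a ⊗ₜ (v ⊗ₜ b)) =
      envAct ω u₁ a ⊗ₜ ((u₂ * v) ⊗ₜ envAct ω u₃ b) := rfl

lemma cmMul_tmul (ω : L →ₗ⁅K⁆ Derivation K A A) (a b : A) (u : U) :
    cmMul ω (a ⊗ₜ (u ⊗ₜ b)) = cmLeft K A L a * (cmRight K A L b * cmAct ω u) := rfl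

/-- The product formula, in terms of any expression of `∑ u₁ ⊗ u₂ ⊗ u₃`. -/
lemma cmMul_tmul_tmul (ω : L →ₗ⁅K⁆ Derivation K A A) (a b a' b' : A) (u v : U) {κ : Type*}
    (s : Finset κ) (x y z : κ → U) (h : envComul₂ u = ∑ i ∈ s, x i ⊗ₜ[K] (y i ⊗ₜ[K] z i)) :
    cmMul ω (a ⊗ₜ (u ⊗ₜ b)) (a' ⊗ₜ (v ⊗ₜ b')) =
      ∑ i ∈ s, (a * envAct ω (x i) a') ⊗ₜ ((y i * v) ⊗ₜ (envAct ω (z i) b' * b)) := by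
  rw [cmMul_tmul, cmAct, AlgHom.comp_apply, h]
  simp only [map_sum, Module.End.mul_apply, LinearMap.sum_apply, cmAct₃_tmul, cmRight_tmul,
    cmLeft_tmul, mul_comm b]

lemma cmAct_ι (ω : L →ₗ⁅K⁆ Derivation K A A) (X : L) (a b : A) (v : U) :
    cmAct ω (j X) (a ⊗ₜ (v ⊗ₜ b)) = (ω X a) ⊗ₜ (v ⊗ₜ b) + a ⊗ₜ ((j X * v) ⊗ₜ b) +
      a ⊗ₜ (v ⊗ₜ (ω X b)) := by
  have h : envComul₂ (j X) = j X ⊗ₜ (1 ⊗ₜ 1) + 1 ⊗ₜ (j X ⊗ₜ 1 + 1 ⊗ₜ j X) := by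
    simp only [envComul₂, AlgHom.comp_apply, Bialgebra.comulAlgHom_apply, comul_ι, map_add,
      Algebra.TensorProduct.map_tmul, AlgHom.id_apply, Bialgebra.comul_one,
      Algebra.TensorProduct.one_def]
  rw [cmAct, AlgHom.comp_apply, h]
  simp only [map_add, TensorProduct.tmul_add, LinearMap.add_apply, cmAct₃_tmul, map_one,
    Module.End.one_apply, one_mul, envAct_ι, add_assoc]

lemma cm_ext {M : Type*} [AddCommGroup M] [Module K M] {f g : E →ₗ[K] M}
    (h : ∀ a v b, f (a ⊗ₜ (v ⊗ₜ b)) = g (a ⊗ₜ (v ⊗ₜ b))) : f = g :=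
  TensorProduct.ext_threefold' h

lemma cm_hom_ext {M : Type*} [AddCommGroup M] [Module K M] {f g : E →ₗ[K] M}
    (h : ∀ a v b, f (a ⊗ₜ (v ⊗ₜ b)) = g (a ⊗ₜ (v ⊗ₜ b))) (z : E) : f z = g z :=
  LinearMap.congr_fun (TensorProduct.ext_threefold' h) z

lemma cmAct_ι_mul (ω : L →ₗ⁅K⁆ Derivation K A A) (X : L) (a b : A) :
    cmAct ω (j X) * (cmLeft K A L a * cmRight K A L b) =
      cmLeft K A L (ω X a) * cmRight K A L b + cmLeft K A L a * cmRight K A L (ω X b) +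
        cmLeft K A L a * cmRight K A L b * cmAct ω (j X) := by
  refine TensorProduct.ext_threefold' fun c v d ↦ ?_
  simp only [Module.End.mul_apply, LinearMap.add_apply, cmRight_tmul, cmLeft_tmul, cmAct_ι,
    map_add, Derivation.leibniz, smul_eq_mul, TensorProduct.add_tmul, TensorProduct.tmul_add]
  rw [mul_comm c, mul_comm d]
  abel

lemma cmMul_cmLeft (ω : L →ₗ⁅K⁆ Derivation K A A) (a : A) (z : E) :
    cmMul ω (cmLeft K A L a z) = cmLeft K A L a * cmMul ω z := by
  refine cm_hom_ext (f := cmMul ω ∘ₗ cmLeft K A L a)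
    (g := LinearMap.mulLeft K (cmLeft K A L a) ∘ₗ cmMul ω) (fun c v d ↦ ?_) z
  simp only [LinearMap.comp_apply, cmLeft_tmul, cmMul_tmul, map_mul, LinearMap.mulLeft_apply,
    mul_assoc]

lemma cmLeft_cmRight (a b : A) :
    cmLeft K A L a * cmRight K A L b = cmRight K A L b * cmLeft K A L a :=
  TensorProduct.ext_threefold' fun _ _ _ ↦ rfl

lemma cmMul_cmRight (ω : L →ₗ⁅K⁆ Derivation K A A) (b : A) (z : E) :
    cmMul ω (cmRight K A L b z) = cmRight K A L b * cmMul ω z := by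
  refine cm_hom_ext (f := cmMul ω ∘ₗ cmRight K A L b)
    (g := LinearMap.mulLeft K (cmRight K A L b) ∘ₗ cmMul ω) (fun c v d ↦ ?_) z
  simp only [LinearMap.comp_apply, cmRight_tmul, cmMul_tmul, map_mul, LinearMap.mulLeft_apply]
  rw [← mul_assoc (cmRight K A L b), ← cmLeft_cmRight]
  simp only [mul_assoc]

lemma cmMul_cmAct (ω : L →ₗ⁅K⁆ Derivation K A A) (u : U) (z : E) :
    cmMul ω (cmAct ω u z) = cmAct ω u * cmMul ω z := by
  let S : Subalgebra K U :=
    { carrier := {u | ∀ z, cmMul ω (cmAct ω u z) = cmAct ω u * cmMul ω z}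
      mul_mem' := fun {u v} hu hv z ↦ by
        rw [map_mul, Module.End.mul_apply, hu, hv, mul_assoc]
      add_mem' := fun {u v} hu hv z ↦ by
        rw [map_add, LinearMap.add_apply, map_add, hu, hv, add_mul]
      algebraMap_mem' := fun c z ↦ by
        rw [AlgHom.commutes, Module.algebraMap_end_apply, map_smul, Algebra.algebraMap_eq_smul_one,
          smul_mul_assoc, one_mul] }
  refine env_induction S (fun X z ↦ ?_) u z
  refine cm_hom_ext (f := cmMul ω ∘ₗ cmAct ω (j X))
    (g := LinearMap.mulLeft K (cmAct ω (j X)) ∘ₗ cmMul ω) (fun a v b ↦ ?_) z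
  simp only [LinearMap.comp_apply, cmAct_ι, map_add, cmMul_tmul, LinearMap.mulLeft_apply]
  have h := congrArg (· * cmAct ω v) (cmAct_ι_mul ω X a b)
  simp only [add_mul, mul_assoc] at h
  rw [h, map_mul]
  abel

lemma cmMul_assoc (ω : L →ₗ⁅K⁆ Derivation K A A) (y z : E) :
    cmMul ω (cmMul ω y z) = cmMul ω y * cmMul ω z := by
  refine cm_hom_ext (f := cmMul ω ∘ₗ (cmMul ω).flip z)
    (g := LinearMap.mulRight K (cmMul ω z) ∘ₗ cmMul ω) (fun a v b ↦ ?_) y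
  simp only [LinearMap.comp_apply, LinearMap.flip_apply, cmMul_tmul, Module.End.mul_apply,
    cmMul_cmLeft, cmMul_cmRight, cmMul_cmAct, LinearMap.mulRight_apply, mul_assoc]

lemma cmMul_one_left (ω : L →ₗ⁅K⁆ Derivation K A A) : cmMul ω (1 ⊗ₜ (1 ⊗ₜ 1)) = 1 := by
  rw [cmMul_tmul, map_one, map_one, map_one, one_mul, one_mul]

lemma cmAct_one (ω : L →ₗ⁅K⁆ Derivation K A A) (u v : U) :
    cmAct ω u (1 ⊗ₜ (v ⊗ₜ 1)) = 1 ⊗ₜ ((u * v) ⊗ₜ 1) := by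
  let S : Subalgebra K U :=
    { carrier := {u | ∀ v, cmAct ω u (1 ⊗ₜ (v ⊗ₜ 1)) = 1 ⊗ₜ ((u * v) ⊗ₜ 1)}
      mul_mem' := fun {u v} hu hv z ↦ by
        rw [map_mul, Module.End.mul_apply, hv, hu, mul_assoc]
      add_mem' := fun {u v} hu hv z ↦ by
        rw [map_add, LinearMap.add_apply, hu, hv, add_mul, TensorProduct.add_tmul,
          TensorProduct.tmul_add]
      algebraMap_mem' := fun c z ↦ by
        rw [AlgHom.commutes, Module.algebraMap_end_apply, Algebra.algebraMap_eq_smul_one,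
          smul_mul_assoc, one_mul, ← TensorProduct.smul_tmul', TensorProduct.tmul_smul] }
  refine env_induction S (fun X z ↦ ?_) u v
  simp [cmAct_ι, -UniversalEnvelopingAlgebra.ι_apply]

lemma cmMul_one_right (ω : L →ₗ⁅K⁆ Derivation K A A) (z : E) :
    cmMul ω z (1 ⊗ₜ (1 ⊗ₜ 1)) = z := by
  refine cm_hom_ext (f := (cmMul ω).flip (1 ⊗ₜ (1 ⊗ₜ 1))) (g := LinearMap.id)
    (fun a v b ↦ ?_) z
  simp only [LinearMap.flip_apply, cmMul_tmul, Module.End.mul_apply, cmAct_one, cmLeft_tmul,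
    cmRight_tmul, mul_one, LinearMap.id_apply]

end ConnesMoscovici

end Bialgebroid

open Bialgebroid

/-- The underlying space `A ⊗ U(L) ⊗ A` of the Connes-Moscovici bialgebroid `A ⊙ U(L) ⊙ A` of the
`A`-anchored Lie algebra `(L, ω)`. -/
def ConnesMoscovici {K : Type*} {A : Type*} {L : Type*} [Field K] [CommRing A] [Algebra K A]
    [LieRing L] [LieAlgebra K L] (_ω : L →ₗ⁅K⁆ Derivation K A A) : Type _ :=
  A ⊗[K] (UniversalEnvelopingAlgebra K L ⊗[K] A)

namespace ConnesMoscovici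

variable {K : Type*} {A : Type*} {L : Type*} [Field K] [CommRing A] [Algebra K A]
    [LieRing L] [LieAlgebra K L] (ω : L →ₗ⁅K⁆ Derivation K A A)

local notation "U" => UniversalEnvelopingAlgebra K L
local notation "j" => UniversalEnvelopingAlgebra.ι K

instance : AddCommGroup (ConnesMoscovici ω) :=
  inferInstanceAs (AddCommGroup (A ⊗[K] (UniversalEnvelopingAlgebra K L ⊗[K] A)))

instance : Module K (ConnesMoscovici ω) :=
  inferInstanceAs (Module K (A ⊗[K] (UniversalEnvelopingAlgebra K L ⊗[K] A)))

/-- The identification of `A ⊙ U(L) ⊙ A` with `A ⊗ U(L) ⊗ A` as a vector space. -/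
def equiv : ConnesMoscovici ω ≃ₗ[K] A ⊗[K] (UniversalEnvelopingAlgebra K L ⊗[K] A) :=
  LinearEquiv.refl K _

/-- The element `a ⊗ u ⊗ b`. -/
def tmul (a : A) (u : U) (b : A) : ConnesMoscovici ω := (equiv ω).symm (a ⊗ₜ (u ⊗ₜ b))

instance : Mul (ConnesMoscovici ω) where
  mul y z := (equiv ω).symm (cmMul ω (equiv ω y) (equiv ω z))

instance : One (ConnesMoscovici ω) where
  one := tmul ω 1 1 1

instance : Ring (ConnesMoscovici ω) :=
  { (inferInstance : AddCommGroup (ConnesMoscovici ω)),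
    (inferInstance : Mul (ConnesMoscovici ω)),
    (inferInstance : One (ConnesMoscovici ω)) with
    mul_assoc := fun x y z ↦ LinearMap.congr_fun (cmMul_assoc ω (equiv ω x) (equiv ω y)) (equiv ω z)
    one_mul := fun x ↦ LinearMap.congr_fun (cmMul_one_left ω) (equiv ω x)
    mul_one := fun x ↦ cmMul_one_right ω (equiv ω x)
    left_distrib := fun x y z ↦ map_add (cmMul ω (equiv ω x)) (equiv ω y) (equiv ω z)
    right_distrib := fun x y z ↦
      LinearMap.congr_fun (map_add (cmMul ω) (equiv ω x) (equiv ω y)) (equiv ω z)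
    zero_mul := fun x ↦ LinearMap.congr_fun (map_zero (cmMul ω)) (equiv ω x)
    mul_zero := fun x ↦ map_zero (cmMul ω (equiv ω x)) }

instance : Algebra K (ConnesMoscovici ω) :=
  Algebra.ofModule
    (fun c x y ↦ LinearMap.congr_fun (map_smul (cmMul ω) c (equiv ω x)) (equiv ω y))
    (fun c x y ↦ map_smul (cmMul ω (equiv ω x)) c (equiv ω y))

end ConnesMoscovici
end

noncomputable section
open Bialgebroid
namespace Bialgebroid

section Normalizer

variable {K : Type*} {A : Type*} {B : Type*} [Field K] [CommRing A] [Algebra K A]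
  [Ring B] [Algebra K B] (η : A ⊗[K] A →ₐ[K] B)

lemma balRel_mul {r : B ⊗[K] B} (hr : r ∈ balRel η) (z : B ⊗[K] B) : r * z ∈ balRel η := by
  induction z using TensorProduct.induction_on with
  | zero => simp
  | add x y hx hy => rw [mul_add]; exact add_mem hx hy
  | tmul p q =>
    induction hr using Submodule.span_induction with
    | zero => simp
    | add x y _ _ hx hy => rw [add_mul]; exact add_mem hx hy
    | smul c x _ hx => rw [smul_mul_assoc]; exact Submodule.smul_mem _ c hx
    | mem x hx =>
      obtain ⟨a, m, n, rfl⟩ := hx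
      refine Submodule.subset_span ⟨a, m * p, n * q, ?_⟩
      simp only [sub_mul, Algebra.TensorProduct.tmul_mul_tmul, mul_assoc]

lemma balGen_mem (a : A) : (tgt η a) ⊗ₜ[K] 1 - 1 ⊗ₜ[K] (src η a) ∈ balRel η :=
  Submodule.subset_span ⟨a, 1, 1, by simp⟩

/-- The elements of `B ⊗ B` that represent an element of the Takeuchi product. -/
def normalizer : Subalgebra K (B ⊗[K] B) where
  carrier := {z | ∀ r ∈ balRel η, z * r ∈ balRel η}
  mul_mem' hx hy r hr := by rw [mul_assoc]; exact hx _ (hy r hr)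
  add_mem' hx hy r hr := by rw [add_mul]; exact add_mem (hx r hr) (hy r hr)
  algebraMap_mem' c r hr := by
    rw [Algebra.algebraMap_eq_smul_one, smul_mul_assoc, one_mul]
    exact Submodule.smul_mem _ c hr

lemma mem_normalizer {z : B ⊗[K] B}
    (h : ∀ a, z * ((tgt η a) ⊗ₜ[K] 1 - 1 ⊗ₜ[K] (src η a)) ∈ balRel η) : z ∈ normalizer η := by
  intro r hr
  induction hr using Submodule.span_induction with
  | zero => simp
  | add x y _ _ hx hy => rw [mul_add]; exact add_mem hx hy
  | smul c x _ hx => rw [mul_smul_comm]; exact Submodule.smul_mem _ c hx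
  | mem x hx =>
    obtain ⟨a, m, n, rfl⟩ := hx
    have := balRel_mul η (h a) (m ⊗ₜ n)
    rwa [mul_assoc, sub_mul, Algebra.TensorProduct.tmul_mul_tmul,
      Algebra.TensorProduct.tmul_mul_tmul, one_mul, one_mul] at this

lemma mkQ_mem_takeuchi {z : B ⊗[K] B} (h : z ∈ normalizer η) :
    (balRel η).mkQ z ∈ takeuchi η := by
  have hT (a : A) (z : B ⊗[K] B) : rightTgt η a ((balRel η).mkQ z) =
      (balRel η).mkQ (z * (tgt η a ⊗ₜ 1)) := by
    induction z using TensorProduct.induction_on with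
    | zero => simp
    | add x y hx hy => rw [map_add, map_add, hx, hy, add_mul, map_add]
    | tmul p q => rw [Algebra.TensorProduct.tmul_mul_tmul, mul_one]; rfl
  have hS (a : A) (z : B ⊗[K] B) : rightSrc η a ((balRel η).mkQ z) =
      (balRel η).mkQ (z * (1 ⊗ₜ src η a)) := by
    induction z using TensorProduct.induction_on with
    | zero => simp
    | add x y hx hy => rw [map_add, map_add, hx, hy, add_mul, map_add]
    | tmul p q => rw [Algebra.TensorProduct.tmul_mul_tmul, mul_one]; rfl
  rw [takeuchi, Submodule.mem_iInf]
  intro a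
  rw [LinearMap.mem_ker, LinearMap.sub_apply, hT, hS, ← map_sub, ← mul_sub]
  exact (Submodule.Quotient.mk_eq_zero _).2 (h _ (balGen_mem η a))

end Normalizer

end Bialgebroid

namespace ConnesMoscovici

variable {K : Type*} {A : Type*} {L : Type*} [Field K] [CommRing A] [Algebra K A]
    [LieRing L] [LieAlgebra K L] (ω : L →ₗ⁅K⁆ Derivation K A A)

local notation "U" => UniversalEnvelopingAlgebra K L
local notation "j" => UniversalEnvelopingAlgebra.ι K
local notation "H" => ConnesMoscovici ω

lemma hom_ext {M : Type*} [AddCommGroup M] [Module K M] {f g : H →ₗ[K] M}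
    (h : ∀ a v b, f (tmul ω a v b) = g (tmul ω a v b)) (z : H) : f z = g z :=
  cm_hom_ext (f := f ∘ₗ (equiv ω).symm.toLinearMap) (g := g ∘ₗ (equiv ω).symm.toLinearMap)
    h (equiv ω z)

lemma tmul_mul (a b : A) (u : U) (z : H) : tmul ω a u b * z =
    (equiv ω).symm (cmLeft K A L a (cmRight K A L b (cmAct ω u (equiv ω z)))) := rfl

/-- The product formula `(a ⊗ u ⊗ b) (a' ⊗ v ⊗ b') = ∑ a (u₁ · a') ⊗ u₂ v ⊗ (u₃ · b') b`. -/
lemma tmul_mul_tmul (a b a' b' : A) (u v : U) {κ : Type*} (s : Finset κ) (x y z : κ → U)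
    (h : envComul₂ u = ∑ i ∈ s, x i ⊗ₜ[K] (y i ⊗ₜ[K] z i)) :
    tmul ω a u b * tmul ω a' v b' =
      ∑ i ∈ s, tmul ω (a * envAct ω (x i) a') (y i * v) (envAct ω (z i) b' * b) :=
  (congrArg (equiv ω).symm (cmMul_tmul_tmul ω a b a' b' u v s x y z h)).trans (map_sum _ _ _)

lemma one_eq : (1 : H) = tmul ω 1 1 1 := rfl

lemma left_mul (a b : A) (z : H) : tmul ω a 1 b * z =
    (equiv ω).symm (cmLeft K A L a (cmRight K A L b (equiv ω z))) := by
  rw [tmul_mul, map_one, Module.End.one_apply]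

lemma left_mul_tmul (a b c d : A) (v : U) :
    tmul ω a 1 b * tmul ω c v d = tmul ω (a * c) v (b * d) :=
  left_mul ω a b _

lemma ι_mul_tmul (X : L) (a b : A) (v : U) : tmul ω 1 (j X) 1 * tmul ω a v b =
    tmul ω (ω X a) v b + tmul ω a (j X * v) b + tmul ω a v (ω X b) := by
  rw [tmul_mul, map_one, map_one, Module.End.one_apply, Module.End.one_apply]
  exact congrArg (equiv ω).symm (cmAct_ι ω X a b v)

/-- The algebra map `η : A ⊗ A → A ⊙ U(L) ⊙ A`, `a ⊗ b ↦ a ⊗ 1 ⊗ b`. -/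
def etaMap : A ⊗[K] A →ₐ[K] H :=
  AlgHom.ofLinearMap
    ((equiv ω).symm.toLinearMap ∘ₗ LinearMap.lTensor A (TensorProduct.mk K U A 1)) rfl
    (fun x y ↦ by
      induction x using TensorProduct.induction_on with
      | zero => simp
      | add x x' hx hx' => rw [add_mul, map_add, hx, hx', map_add, add_mul]
      | tmul a b =>
        induction y using TensorProduct.induction_on with
        | zero => simp
        | add y y' hy hy' => rw [mul_add, map_add, hy, hy', map_add, mul_add]
        | tmul c d =>
          rw [Algebra.TensorProduct.tmul_mul_tmul]
          exact (left_mul_tmul ω a b c d 1).symm)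

lemma etaMap_tmul (a b : A) : etaMap ω (a ⊗ₜ b) = tmul ω a 1 b := rfl

/-- The algebra map `U(L) → A ⊙ U(L) ⊙ A`, `u ↦ 1 ⊗ u ⊗ 1`. -/
def incl : U →ₐ[K] H :=
  AlgHom.ofLinearMap
    ((equiv ω).symm.toLinearMap ∘ₗ TensorProduct.mk K A (U ⊗[K] A) 1 ∘ₗ
      (TensorProduct.mk K U A).flip 1) rfl
    (fun u v ↦ by
      change tmul ω 1 (u * v) 1 = tmul ω 1 u 1 * tmul ω 1 v 1
      rw [tmul_mul, map_one, map_one, Module.End.one_apply, Module.End.one_apply]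
      exact congrArg (equiv ω).symm (cmAct_one ω u v).symm)

lemma incl_apply (u : U) : incl ω u = tmul ω 1 u 1 := rfl

lemma tmul_eq (a b : A) (u : U) : tmul ω a u b = etaMap ω (a ⊗ₜ b) * incl ω u := by
  rw [etaMap_tmul, incl_apply, left_mul_tmul, mul_one, mul_one]

/-- The linear map `a ⊗ u ⊗ b ↦ ∑ (a ⊗ u₁ ⊗ 1) ⊗ (1 ⊗ u₂ ⊗ b)`. -/
def comulRep : H →ₗ[K] H ⊗[K] H :=
  TensorProduct.map
      ((equiv ω).symm.toLinearMap ∘ₗ LinearMap.lTensor A ((TensorProduct.mk K U A).flip 1))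
      ((equiv ω).symm.toLinearMap ∘ₗ TensorProduct.mk K A (U ⊗[K] A) 1) ∘ₗ
    (TensorProduct.assoc K A U (U ⊗[K] A)).symm.toLinearMap ∘ₗ
    LinearMap.lTensor A ((TensorProduct.assoc K U U A).toLinearMap ∘ₗ
      LinearMap.rTensor A Coalgebra.comul) ∘ₗ
    (equiv ω).toLinearMap

/-- The linear map `a ⊗ u ⊗ b ↦ a ε(u) b`. -/
def counitMap : H →ₗ[K] A :=
  LinearMap.mul' K A ∘ₗ
    LinearMap.lTensor A ((TensorProduct.lid K A).toLinearMap ∘ₗ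
      LinearMap.rTensor A Coalgebra.counit) ∘ₗ
    (equiv ω).toLinearMap

/-- `comulRep (a ⊗ u ⊗ b)` in terms of any expression of `∑ u₁ ⊗ u₂`. -/
lemma comulRep_tmul (a b : A) (u : U) {κ : Type*} (s : Finset κ) (x y : κ → U)
    (h : Coalgebra.comul (R := K) u = ∑ i ∈ s, x i ⊗ₜ[K] y i) :
    comulRep ω (tmul ω a u b) = ∑ i ∈ s, tmul ω a (x i) 1 ⊗ₜ tmul ω 1 (y i) b := by
  have h1 : comulRep ω (tmul ω a u b) = TensorProduct.map
      ((equiv ω).symm.toLinearMap ∘ₗ LinearMap.lTensor A ((TensorProduct.mk K U A).flip 1))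
      ((equiv ω).symm.toLinearMap ∘ₗ TensorProduct.mk K A (U ⊗[K] A) 1)
      ((TensorProduct.assoc K A U (U ⊗[K] A)).symm
        (a ⊗ₜ TensorProduct.assoc K U U A (Coalgebra.comul (R := K) u ⊗ₜ b))) := rfl
  rw [h1, h]
  simp only [TensorProduct.sum_tmul, TensorProduct.tmul_sum, map_sum]
  rfl

lemma counitMap_tmul (a b : A) (u : U) :
    counitMap ω (tmul ω a u b) = a * (Coalgebra.counit (R := K) u • b) := rfl

/-- The algebra map `u ↦ ∑ (1 ⊗ u₁ ⊗ 1) ⊗ (1 ⊗ u₂ ⊗ 1)`. -/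
def inclComul : U →ₐ[K] H ⊗[K] H :=
  (Algebra.TensorProduct.map (incl ω) (incl ω)).comp (Bialgebra.comulAlgHom K U)

local notation "s" => src (etaMap ω)
local notation "t" => tgt (etaMap ω)

lemma src_apply (a : A) : s a = tmul ω a 1 1 := rfl

lemma tgt_apply (a : A) : t a = tmul ω 1 1 a := rfl

lemma comulRep_tmul' (a b : A) (u : U) :
    comulRep ω (tmul ω a u b) = (s a ⊗ₜ t b) * inclComul ω u := by
  obtain ⟨S, hS⟩ := TensorProduct.exists_finset (Coalgebra.comul (R := K) u)
  rw [comulRep_tmul ω a b u S Prod.fst Prod.snd hS, inclComul, AlgHom.comp_apply,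
    Bialgebra.comulAlgHom_apply, hS, map_sum, Finset.mul_sum]
  refine Finset.sum_congr rfl fun i _ ↦ ?_
  rw [Algebra.TensorProduct.map_tmul, Algebra.TensorProduct.tmul_mul_tmul, incl_apply, incl_apply,
    src_apply, tgt_apply, left_mul_tmul, left_mul_tmul]
  simp

lemma inclComul_ι (X : L) :
    inclComul ω (j X) = incl ω (j X) ⊗ₜ 1 + 1 ⊗ₜ incl ω (j X) := by
  rw [inclComul, AlgHom.comp_apply, Bialgebra.comulAlgHom_apply, comul_ι, map_add,
    Algebra.TensorProduct.map_tmul, Algebra.TensorProduct.map_tmul, map_one]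

lemma incl_mul_src (X : L) (a : A) :
    incl ω (j X) * s a = s a * incl ω (j X) + s (ω X a) := by
  rw [incl_apply, src_apply, src_apply, ι_mul_tmul, left_mul_tmul]
  have : tmul ω a 1 (ω X (1 : A)) = 0 := by simp [tmul]
  rw [this]
  simp only [mul_one, add_zero]
  rw [add_comm]

lemma incl_mul_tgt (X : L) (a : A) :
    incl ω (j X) * t a = t a * incl ω (j X) + t (ω X a) := by
  rw [incl_apply, tgt_apply, tgt_apply, ι_mul_tmul, left_mul_tmul]
  have : tmul ω (ω X (1 : A)) 1 a = 0 := by simp [tmul]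
  rw [this]
  simp only [mul_one, zero_add]

/-- Induction: `A ⊙ U(L) ⊙ A` is generated by the source, the target and `L`. -/
lemma induction (S : Subalgebra K H) (hs : ∀ a, s a ∈ S) (ht : ∀ a, t a ∈ S)
    (hX : ∀ X, incl ω (j X) ∈ S) (z : H) : z ∈ S := by
  have hU (u : U) : incl ω u ∈ S := env_induction (S.comap (incl ω)) hX u
  have key := hom_ext ω (f := (Submodule.mkQ (Subalgebra.toSubmodule S))) (g := 0)
    (fun a v b ↦ by
      refine (Submodule.Quotient.mk_eq_zero _).2 ?_
      rw [tmul_eq, ← src_mul_tgt]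
      exact S.mul_mem (S.mul_mem (hs a) (ht b)) (hU v)) z
  exact (Submodule.Quotient.mk_eq_zero _).1 key

lemma src_mem_normalizer (a b : A) : s a ⊗ₜ[K] t b ∈ normalizer (etaMap ω) := by
  refine mem_normalizer _ fun c ↦ ?_
  have : (s a ⊗ₜ[K] t b) * (t c ⊗ₜ[K] 1 - 1 ⊗ₜ[K] s c) =
      (t c ⊗ₜ[K] 1 - 1 ⊗ₜ[K] s c) * (s a ⊗ₜ[K] t b) := by
    simp only [mul_sub, sub_mul, Algebra.TensorProduct.tmul_mul_tmul, mul_one, one_mul,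
      src_tgt_comm]
  rw [this]
  exact balRel_mul _ (balGen_mem _ c) _

lemma inclComul_mem_normalizer (u : U) : inclComul ω u ∈ normalizer (etaMap ω) := by
  refine env_induction ((normalizer (etaMap ω)).comap (inclComul ω)) (fun X ↦ ?_) u
  refine mem_normalizer _ fun c ↦ ?_
  have : inclComul ω (j X) * (t c ⊗ₜ[K] 1 - 1 ⊗ₜ[K] s c) =
      (t c ⊗ₜ[K] 1 - 1 ⊗ₜ[K] s c) * inclComul ω (j X) +
        (t (ω X c) ⊗ₜ[K] 1 - 1 ⊗ₜ[K] s (ω X c)) := by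
    rw [inclComul_ι]
    simp only [mul_sub, sub_mul, mul_add, add_mul, Algebra.TensorProduct.tmul_mul_tmul, mul_one,
      one_mul, incl_mul_src, incl_mul_tgt, TensorProduct.add_tmul, TensorProduct.tmul_add]
    abel
  rw [RingHom.coe_coe, this]
  exact add_mem (balRel_mul _ (balGen_mem _ c) _) (balGen_mem _ _)

lemma comulRep_mem_normalizer (z : H) : comulRep ω z ∈ normalizer (etaMap ω) := by
  have key := hom_ext ω
    (f := (Submodule.mkQ (Subalgebra.toSubmodule (normalizer (etaMap ω)))) ∘ₗ comulRep ω) (g := 0)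
    (fun a v b ↦ by
      refine (Submodule.Quotient.mk_eq_zero _).2 ?_
      rw [comulRep_tmul']
      exact (normalizer (etaMap ω)).mul_mem (src_mem_normalizer ω a b) (inclComul_mem_normalizer ω v)) z
  exact (Submodule.Quotient.mk_eq_zero _).1 key

lemma comulRep_eta_mul (a b : A) (z : H) :
    comulRep ω (etaMap ω (a ⊗ₜ b) * z) = (s a ⊗ₜ t b) * comulRep ω z := by
  refine hom_ext ω (f := comulRep ω ∘ₗ LinearMap.mulLeft K (etaMap ω (a ⊗ₜ b)))
    (g := LinearMap.mulLeft K (s a ⊗ₜ t b) ∘ₗ comulRep ω) (fun c v d ↦ ?_) z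
  rw [LinearMap.comp_apply, LinearMap.comp_apply, LinearMap.mulLeft_apply, LinearMap.mulLeft_apply,
    etaMap_tmul, left_mul_tmul, comulRep_tmul', comulRep_tmul', ← mul_assoc,
    Algebra.TensorProduct.tmul_mul_tmul, ← map_mul, ← map_mul]

lemma comulRep_ι_mul (X : L) (z : H) :
    comulRep ω (incl ω (j X) * z) = inclComul ω (j X) * comulRep ω z := by
  refine hom_ext ω (f := comulRep ω ∘ₗ LinearMap.mulLeft K (incl ω (j X)))
    (g := LinearMap.mulLeft K (inclComul ω (j X)) ∘ₗ comulRep ω) (fun a v b ↦ ?_) z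
  rw [LinearMap.comp_apply, LinearMap.comp_apply, LinearMap.mulLeft_apply, LinearMap.mulLeft_apply,
    incl_apply, ι_mul_tmul, map_add, map_add, comulRep_tmul', comulRep_tmul', comulRep_tmul',
    comulRep_tmul', map_mul, ← mul_assoc, ← mul_assoc, ← add_mul, ← add_mul]
  congr 1
  rw [inclComul_ι]
  simp only [mul_add, add_mul, Algebra.TensorProduct.tmul_mul_tmul, mul_one, one_mul,
    incl_mul_src, incl_mul_tgt, TensorProduct.add_tmul, TensorProduct.tmul_add]
  abel

lemma comulRep_one : comulRep ω 1 = 1 := by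
  rw [one_eq, comulRep_tmul', map_one, map_one, map_one, mul_one]
  rfl

lemma comulRep_mul (y z : H) :
    comulRep ω (y * z) - comulRep ω y * comulRep ω z ∈ balRel (etaMap ω) := by
  let S : Subalgebra K H :=
    { carrier := {y | ∀ z, comulRep ω (y * z) - comulRep ω y * comulRep ω z ∈ balRel (etaMap ω)}
      mul_mem' := fun {x y} hx hy z ↦ by
        have h1 := hx (y * z)
        have h2 := comulRep_mem_normalizer ω x _ (hy z)
        have h3 := balRel_mul _ (hx y) (comulRep ω z)
        rw [← mul_assoc] at h1
        have := sub_mem (add_mem h1 h2) h3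
        convert this using 1
        simp only [mul_sub, sub_mul, mul_assoc]
        abel
      add_mem' := fun {x y} hx hy z ↦ by
        have := add_mem (hx z) (hy z)
        convert this using 1
        simp only [add_mul, map_add]
        abel
      algebraMap_mem' := fun c z ↦ by
        rw [Algebra.algebraMap_eq_smul_one, smul_mul_assoc, one_mul, map_smul, map_smul,
          comulRep_one, smul_mul_assoc, one_mul, sub_self]
        exact zero_mem _ }
  have hη (a b : A) : etaMap ω (a ⊗ₜ b) ∈ S := fun z ↦ by
    rw [comulRep_eta_mul, ← mul_one (etaMap ω (a ⊗ₜ b)), comulRep_eta_mul, comulRep_one, mul_one,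
      sub_self]
    exact zero_mem _
  refine induction ω S (fun a ↦ hη a 1) (fun a ↦ hη 1 a) (fun X z ↦ ?_) y z
  rw [comulRep_ι_mul, ← mul_one (incl ω (j X)), comulRep_ι_mul, comulRep_one, mul_one, sub_self]
  exact zero_mem _

lemma counitMap_eta_mul (a b : A) (z : H) :
    counitMap ω (etaMap ω (a ⊗ₜ b) * z) = a * counitMap ω z * b := by
  refine hom_ext ω (f := counitMap ω ∘ₗ LinearMap.mulLeft K (etaMap ω (a ⊗ₜ b)))
    (g := LinearMap.mulRight K b ∘ₗ LinearMap.mulLeft K a ∘ₗ counitMap ω) (fun c v d ↦ ?_) z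
  simp only [LinearMap.comp_apply, LinearMap.mulLeft_apply, LinearMap.mulRight_apply, etaMap_tmul,
    left_mul_tmul, counitMap_tmul, mul_smul_comm, smul_mul_assoc]
  congr 1
  ring

lemma counitMap_ι_mul (X : L) (z : H) :
    counitMap ω (incl ω (j X) * z) = ω X (counitMap ω z) := by
  refine hom_ext ω (f := counitMap ω ∘ₗ LinearMap.mulLeft K (incl ω (j X)))
    (g := (ω X : A →ₗ[K] A) ∘ₗ counitMap ω) (fun c v d ↦ ?_) z
  simp only [LinearMap.comp_apply, LinearMap.mulLeft_apply, incl_apply, ι_mul_tmul, map_add,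
    counitMap_tmul, Bialgebra.counit_mul, counit_ι, zero_mul, zero_smul, mul_zero, add_zero,
    Derivation.coeFn_coe, Derivation.leibniz, smul_eq_mul, Derivation.map_smul]
  rw [mul_comm _ (ω X c), add_comm]

lemma counitMap_one : counitMap ω 1 = 1 := by
  rw [one_eq, counitMap_tmul, Bialgebra.counit_one, one_smul, mul_one]

lemma counitMap_src (a : A) : counitMap ω (s a) = a := by
  rw [src_apply, counitMap_tmul, Bialgebra.counit_one, one_smul, mul_one]

lemma counitMap_tgt (a : A) : counitMap ω (t a) = a := by
  rw [tgt_apply, counitMap_tmul, Bialgebra.counit_one, one_smul, one_mul]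

lemma counitMap_mul_char (f : A → H) (hf : ∀ a, counitMap ω (f a) = a) (y z : H) :
    counitMap ω (y * f (counitMap ω z)) = counitMap ω (y * z) := by
  suffices h : ∀ z z' : H, counitMap ω z = counitMap ω z' →
      counitMap ω (y * z) = counitMap ω (y * z') from h _ _ (hf _)
  let S : Subalgebra K H :=
    { carrier := {y | ∀ z z' : H, counitMap ω z = counitMap ω z' →
        counitMap ω (y * z) = counitMap ω (y * z')}
      mul_mem' := fun {x y} hx hy z z' h ↦ by
        rw [mul_assoc, mul_assoc]
        exact hx _ _ (hy _ _ h)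
      add_mem' := fun {x y} hx hy z z' h ↦ by
        rw [add_mul, add_mul, map_add, map_add, hx _ _ h, hy _ _ h]
      algebraMap_mem' := fun c z z' h ↦ by
        rw [Algebra.algebraMap_eq_smul_one, smul_mul_assoc, smul_mul_assoc, one_mul, one_mul,
          map_smul, map_smul, h] }
  have hη (a b : A) : etaMap ω (a ⊗ₜ b) ∈ S := fun z z' h ↦ by
    rw [counitMap_eta_mul, counitMap_eta_mul, h]
  refine induction ω S (fun a ↦ hη a 1) (fun a ↦ hη 1 a) (fun X z z' h ↦ ?_) y
  rw [counitMap_ι_mul, counitMap_ι_mul, h]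

instance : PreLeftBialgebroid K A (ConnesMoscovici ω) where
  eta := etaMap ω
  comul := (balRel (etaMap ω)).mkQ ∘ₗ comulRep ω
  counit := counitMap ω
  comul_eta_mul a b ξ := by
    rw [LinearMap.comp_apply, comulRep_eta_mul, LinearMap.comp_apply]
    generalize comulRep ω ξ = z
    induction z using TensorProduct.induction_on with
    | zero => simp
    | add x y hx hy => rw [mul_add, map_add, hx, hy, map_add, map_add]
    | tmul p q => rw [Algebra.TensorProduct.tmul_mul_tmul]; rfl
  counit_eta_mul := counitMap_eta_mul ω

lemma comul_def (z : H) :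
    Bialgebroid.comul K A H z = (balRel (etaMap ω)).mkQ (comulRep ω z) := rfl

/-- `u ↦ a ⊗ u ⊗ 1`. -/
def inclLeft (a : A) : U →ₗ[K] H := LinearMap.mulLeft K (s a) ∘ₗ (incl ω).toLinearMap

/-- `u ↦ 1 ⊗ u ⊗ b`. -/
def inclRight (b : A) : U →ₗ[K] H := LinearMap.mulLeft K (t b) ∘ₗ (incl ω).toLinearMap

lemma inclLeft_apply (a : A) (u : U) : inclLeft ω a u = tmul ω a u 1 := by
  rw [tmul_eq]; rfl

lemma inclRight_apply (b : A) (u : U) : inclRight ω b u = tmul ω 1 u b := by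
  rw [tmul_eq]; rfl

lemma comulRep_tmul_map (a b : A) (u : U) : comulRep ω (tmul ω a u b) =
    TensorProduct.map (inclLeft ω a) (inclRight ω b) (Coalgebra.comul (R := K) u) := by
  obtain ⟨S, hS⟩ := TensorProduct.exists_finset (Coalgebra.comul (R := K) u)
  rw [comulRep_tmul ω a b u S Prod.fst Prod.snd hS, hS, map_sum]
  simp only [TensorProduct.map_tmul, inclLeft_apply, inclRight_apply]

lemma assoc_map (f g h : U →ₗ[K] H) (w : U ⊗[K] U) (v : U) :
    TensorProduct.assoc K H H H (TensorProduct.map f g w ⊗ₜ h v) =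
      TensorProduct.map f (TensorProduct.map g h) (TensorProduct.assoc K U U U (w ⊗ₜ v)) := by
  induction w using TensorProduct.induction_on with
  | zero => simp
  | add x y hx hy => simp only [map_add, TensorProduct.add_tmul, hx, hy]
  | tmul p q => rfl

lemma inclRight_one : inclRight ω 1 = (incl ω).toLinearMap := by
  ext u; rw [inclRight_apply, AlgHom.toLinearMap_apply, incl_apply]

lemma inclLeft_one : inclLeft ω 1 = (incl ω).toLinearMap := by
  ext u; rw [inclLeft_apply, AlgHom.toLinearMap_apply, incl_apply]

lemma comulTensor_map (a b : A) (w : U ⊗[K] U) :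
    comulTensor K A H ((balRel (etaMap ω)).mkQ
        (TensorProduct.map (inclLeft ω a) (inclRight ω b) w)) =
      (balRel₃ (etaMap ω)).mkQ
        (TensorProduct.map (inclLeft ω a) (TensorProduct.map (incl ω).toLinearMap (inclRight ω b))
          (TensorProduct.assoc K U U U (LinearMap.rTensor U Coalgebra.comul w))) := by
  induction w using TensorProduct.induction_on with
  | zero => simp only [map_zero]
  | add x y hx hy => simp only [map_add, hx, hy]
  | tmul p q =>
    rw [LinearMap.rTensor_tmul, ← assoc_map, ← inclRight_one, ← comulRep_tmul_map,
      ← inclLeft_apply]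
    rfl

lemma tensorComul_map (a b : A) (w : U ⊗[K] U) :
    tensorComul K A H ((balRel (etaMap ω)).mkQ
        (TensorProduct.map (inclLeft ω a) (inclRight ω b) w)) =
      (balRel₃ (etaMap ω)).mkQ
        (TensorProduct.map (inclLeft ω a) (TensorProduct.map (incl ω).toLinearMap (inclRight ω b))
          (LinearMap.lTensor U Coalgebra.comul w)) := by
  induction w using TensorProduct.induction_on with
  | zero => simp only [map_zero]
  | add x y hx hy => simp only [map_add, hx, hy]
  | tmul p q =>
    rw [LinearMap.lTensor_tmul, TensorProduct.map_tmul, TensorProduct.map_tmul, ← inclLeft_one,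
      ← comulRep_tmul_map, ← inclRight_apply]
    rfl

lemma counitTensor_map (a b : A) (w : U ⊗[K] U) :
    counitTensor K A H ((balRel (etaMap ω)).mkQ
        (TensorProduct.map (inclLeft ω a) (inclRight ω b) w)) =
      tmul ω a (TensorProduct.lid K U (LinearMap.rTensor U Coalgebra.counit w)) b := by
  have hl : tmul ω a (0 : U) b = 0 := by simp [tmul]
  have hadd (p q : U) : tmul ω a (p + q) b = tmul ω a p b + tmul ω a q b := by
    simp [tmul, TensorProduct.add_tmul, TensorProduct.tmul_add]
  induction w using TensorProduct.induction_on with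
  | zero => simp only [map_zero, hl]
  | add x y hx hy => simp only [map_add, hx, hy, hadd]
  | tmul p q =>
    rw [TensorProduct.map_tmul, LinearMap.rTensor_tmul, TensorProduct.lid_tmul]
    change s (counitMap ω (inclLeft ω a p)) * inclRight ω b q = _
    rw [inclLeft_apply, inclRight_apply, counitMap_tmul, mul_smul_comm, mul_one, map_smul,
      smul_mul_assoc, src_apply, left_mul_tmul, mul_one, one_mul]
    simp only [tmul, ← TensorProduct.smul_tmul', TensorProduct.tmul_smul, map_smul]

lemma tensorCounit_map (a b : A) (w : U ⊗[K] U) :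
    tensorCounit K A H ((balRel (etaMap ω)).mkQ
        (TensorProduct.map (inclLeft ω a) (inclRight ω b) w)) =
      tmul ω a (TensorProduct.rid K U (LinearMap.lTensor U Coalgebra.counit w)) b := by
  have hl : tmul ω a (0 : U) b = 0 := by simp [tmul]
  have hadd (p q : U) : tmul ω a (p + q) b = tmul ω a p b + tmul ω a q b := by
    simp [tmul, TensorProduct.add_tmul, TensorProduct.tmul_add]
  induction w using TensorProduct.induction_on with
  | zero => simp only [map_zero, hl]
  | add x y hx hy => simp only [map_add, hx, hy, hadd]
  | tmul p q =>
    rw [TensorProduct.map_tmul, LinearMap.lTensor_tmul, TensorProduct.rid_tmul]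
    change t (counitMap ω (inclRight ω b q)) * inclLeft ω a p = _
    rw [inclLeft_apply, inclRight_apply, counitMap_tmul, one_mul, map_smul,
      smul_mul_assoc, tgt_apply, left_mul_tmul, mul_one, one_mul]
    simp only [tmul, ← TensorProduct.smul_tmul', TensorProduct.tmul_smul, map_smul]

/-- The Connes-Moscovici bialgebroid `A ⊙ U(L) ⊙ A`. -/
instance : LeftBialgebroid K A (ConnesMoscovici ω) where
  coassoc := by
    refine LinearMap.ext (hom_ext ω fun a u b ↦ ?_)
    change comulTensor K A H ((balRel (etaMap ω)).mkQ (comulRep ω (tmul ω a u b))) =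
      tensorComul K A H ((balRel (etaMap ω)).mkQ (comulRep ω (tmul ω a u b)))
    rw [comulRep_tmul_map, comulTensor_map, tensorComul_map, Coalgebra.coassoc_apply]
  counit_tensor_comul ξ := by
    refine hom_ext ω (f := counitTensor K A H ∘ₗ (balRel (etaMap ω)).mkQ ∘ₗ comulRep ω)
      (g := LinearMap.id) (fun a u b ↦ ?_) ξ
    rw [LinearMap.comp_apply, LinearMap.comp_apply, comulRep_tmul_map, counitTensor_map,
      Coalgebra.rTensor_counit_comul, TensorProduct.lid_tmul, one_smul, LinearMap.id_apply]
  tensor_counit_comul ξ := by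
    refine hom_ext ω (f := tensorCounit K A H ∘ₗ (balRel (etaMap ω)).mkQ ∘ₗ comulRep ω)
      (g := LinearMap.id) (fun a u b ↦ ?_) ξ
    rw [LinearMap.comp_apply, LinearMap.comp_apply, comulRep_tmul_map, tensorCounit_map,
      Coalgebra.lTensor_counit_comul, TensorProduct.rid_tmul, one_smul, LinearMap.id_apply]
  comul_mem_takeuchi ξ := mkQ_mem_takeuchi _ (comulRep_mem_normalizer ω ξ)
  comul_one := congrArg (balRel (etaMap ω)).mkQ (comulRep_one ω)
  comul_mul ξ ξ' x x' hx hx' := by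
    replace hx : x - comulRep ω ξ ∈ balRel (etaMap ω) := (Submodule.Quotient.eq _).1 hx
    replace hx' : x' - comulRep ω ξ' ∈ balRel (etaMap ω) := (Submodule.Quotient.eq _).1 hx'
    refine (Submodule.Quotient.eq _).2 ?_
    have h := sub_mem (sub_mem (comulRep_mul ω ξ ξ') (balRel_mul _ hx x'))
      (comulRep_mem_normalizer ω ξ _ hx')
    convert h using 1
    simp only [mul_sub, sub_mul]
    abel
  counit_mul_source := counitMap_mul_char ω _ (counitMap_src ω)
  counit_mul_target := counitMap_mul_char ω _ (counitMap_tgt ω)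
  counit_one := counitMap_one ω

end ConnesMoscovici
end

noncomputable section

namespace Bialgebroid

/-! ### The primitive filtration, graded projectivity and semi-direct decompositions -/

section Filtration

variable (K : Type*) (A : Type*) (B : Type*) [Field K] [CommRing A]
    [Algebra K A] [Ring B] [Algebra K B] [LeftBialgebroid K A B]

/-- The left `Aᵉ`-module structure `c • ξ = η(c) ξ` of a bialgebroid, where `Aᵉ = A ⊗ A`. -/
instance etaModule : Module (A ⊗[K] A) B := Module.compHom B (eta K A B).toRingHom

variable {B} in
lemma eta_smul (c : A ⊗[K] A) (ξ : B) : c • ξ = eta K A B c * ξ := rfl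

/-- The image `η(Aᵉ) Prim(B) η(Aᵉ)` of `Aᵉ ⊗ Prim(B) ⊗ Aᵉ → B`, that is, the linear span of the
products `η(c) X η(c')`. -/
def primSpan : Submodule K B :=
  LinearMap.range (eta K A B).toLinearMap * (Prim K A B).toSubmodule *
    LinearMap.range (eta K A B).toLinearMap

/-- The `n`-th term `η(Aᵉ) + ∑_{1 ≤ k ≤ n} (η(Aᵉ) Prim(B) η(Aᵉ))ᵏ` of the primitive filtration: the
image of the components of degree at most `n` of the tensor `Aᵉ`-ring of `Aᵉ ⊗ Prim(B) ⊗ Aᵉ`. -/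
def primFiltration (n : ℕ) : Submodule (A ⊗[K] A) B where
  carrier := (LinearMap.range (eta K A B).toLinearMap ⊔
    ⨆ k ∈ Set.Icc 1 n, primSpan K A B ^ k : Submodule K B)
  add_mem' := add_mem
  zero_mem' := zero_mem _
  smul_mem' c ξ hξ := by
    have hR : LinearMap.range (eta K A B).toLinearMap * LinearMap.range (eta K A B).toLinearMap ≤
        LinearMap.range (eta K A B).toLinearMap := by
      rw [Submodule.mul_le]
      rintro _ ⟨a, rfl⟩ _ ⟨b, rfl⟩
      exact ⟨a * b, map_mul (eta K A B) a b⟩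
    have hM : LinearMap.range (eta K A B).toLinearMap * primSpan K A B ≤ primSpan K A B := by
      rw [primSpan, ← mul_assoc, ← mul_assoc]
      gcongr
    have h := Submodule.mul_mem_mul (LinearMap.mem_range_self (eta K A B).toLinearMap c) hξ
    rw [Submodule.mul_sup, Submodule.mul_iSup] at h
    refine sup_le_sup hR (iSup_mono fun k ↦ ?_) h
    rw [Submodule.mul_iSup]
    refine iSup_mono fun hk ↦ ?_
    obtain ⟨m, rfl⟩ := Nat.exists_eq_add_of_le' hk.1
    rw [pow_succ', ← mul_assoc]
    gcongr

/-- `B` is primitively generated: the primitive filtration is exhaustive. -/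
def IsPrimitivelyGenerated : Prop := ∀ ξ : B, ∃ n, ξ ∈ primFiltration K A B n

/-- The term of degree `n - 1` of the primitive filtration, where the one of degree `-1` is `0`. -/
def primFiltrationPred : ℕ → Submodule (A ⊗[K] A) B
  | 0 => ⊥
  | n + 1 => primFiltration K A B n

/-- The `n`-th associated graded component of the primitive filtration. -/
abbrev primGr (n : ℕ) : Type _ :=
  primFiltration K A B n ⧸ (primFiltrationPred K A B n).submoduleOf (primFiltration K A B n)

/-- `B` is graded projective: all the graded components are projective left `Aᵉ`-modules. -/
def IsGradedProjective : Prop := ∀ n, Module.Projective (A ⊗[K] A) (primGr K A B n)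

/-- An isomorphism of `A`-anchored Lie algebras `P̄ ⋉_δ ⟨s - t⟩ ≅ Prim(B)`, with
`P̄ = Prim(B) / ⟨s - t⟩`, of the form `(X, Y) ↦ ι(X) + Y` for a linear section
`ι : P̄ → Prim(B)` of the projection. The bracket of the semi-direct product is
`[(X, Y), (X', Y')] = ([X, X'], δ(X)(Y') - δ(X')(Y) + [Y, Y'])`. -/
structure SemidirectDecomposition where
  /-- The action of `P̄` on `⟨s - t⟩` by derivations. -/
  δ : PrimBar K A B →ₗ⁅K⁆ LieDerivation K (sSubT K A B) (sSubT K A B)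
  /-- Compatibility of `δ` with the anchors. -/
  anchor_δ (X : PrimBar K A B) (Y : sSubT K A B) :
    ⁅anchorBar K A B X, anchor K A (Y : Prim K A B)⁆ = anchor K A (δ X Y : Prim K A B)
  /-- The isomorphism of Lie algebras. -/
  equiv : (sSubT K A B ⋊⁅δ⁆ PrimBar K A B) ≃ₗ⁅K⁆ Prim K A B
  /-- Compatibility with the anchors. -/
  anchor_equiv (z : sSubT K A B ⋊⁅δ⁆ PrimBar K A B) :
    anchor K A (equiv z) = anchorBar K A B z.right + anchor K A (z.left : Prim K A B)
  /-- On `⟨s - t⟩` the isomorphism is the inclusion. -/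
  equiv_inl (Y : sSubT K A B) : equiv (LieAlgebra.SemiDirectSum.inl δ Y) = Y
  /-- On `P̄` the isomorphism is a section of the projection. -/
  mk_equiv_inr (X : PrimBar K A B) :
    LieSubmodule.Quotient.mk (equiv (LieAlgebra.SemiDirectSum.inr δ X)) = X

variable {K A B} in
/-- The resulting embedding `ι : P̄ → Prim(B) ⊆ B`. -/
def SemidirectDecomposition.ι (σ : SemidirectDecomposition K A B) (X : PrimBar K A B) : B :=
  (σ.equiv (LieAlgebra.SemiDirectSum.inr σ.δ X) : Prim K A B)

end Filtration

end Bialgebroid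

end

open Bialgebroid

/-! Write `H` for the bialgebroid A ⊙ U(L) ⊙ A. As a left A^e-module it is A^e ⊗ U(L), filtered by
the A ⊗ Fₙ U(L) ⊗ A (`fil`). Everything rests on one computation in U(L): multiplication after
comultiplication acts on the n-th graded piece of the standard filtration as 2^n
(`mul'_comul_sub_mem`). Its reduced version, with u - ε(u) in both factors, therefore acts as 2^n -
2, which is invertible in characteristic 0 once n ≥ 2. This takes the place of the PBW theorem. To
apply it to tensor products over A, `contract` evaluates the product of the two inner A-factors by a
functional f with f(1) = 1. A first consequence is that the primitive elements of `H` are L + ⟨s -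
t⟩ (`exists_eq_of_mem_prim`).

From a decomposition to an isomorphism: primitive elements commute with s and t up to the anchor, so
ι extends to an algebra map ψ : H → B (`liftHom`), which respects comultiplication and counit. The
primitive filtration of B is the image of `fil` (`primFiltration_eq_map`), so ψ is surjective if B
is primitively generated. Injectivity (`hom_injective`) goes by degree. In degree at most 1 it
combines injectivity of η, freeness of A^e ι(P̄) and its trivial intersection with A^e ⟨s - t⟩
(`eq_zero_of_mem_fil_one`). For the step, graded projectivity makes Fₙ(B) a direct summand, so ψ on
Fₙ has an A^e-linear left inverse r defined on all of B. If ψ(z) = 0 with z in Fₙ₊₁, apply r ⊗ r to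
Δ(ψ(z)) = 0: the reduced coproduct of z involves only Fₙ, where r ψ is the identity, so it contracts
to 0 and (2^(n+1) - 2) z lies in Fₙ (`mem_fil_of_hom_eq_zero`).

From an isomorphism e to a decomposition: projections of U(L) onto its filtration steps give
A^e-linear projections, hence graded projectivity; K-independent families of U(L) become
A^e-independent; and 1 ⊗ (id - ε) ⊗ 1 separates A^e ⟨s - t⟩ from A^e L. The section needs care:
sending X to the class of e⁻¹(1 ⊗ X ⊗ 1) is an endomorphism of P̄ that need not be the identity, so
it has to be shown bijective and inverted. Its injectivity uses that of P̄ → U(P̄). For this, e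
embeds P̄ as a Lie algebra into U(P̄) (`primBarToEnv`), and a Lie algebra that embeds into some
associative algebra embeds into its enveloping algebra. -/

noncomputable section

namespace Bialgebroid

/-! ### The standard filtration of the enveloping algebra -/

section EnvelopingFiltration

variable (K : Type*) (L : Type*) [Field K] [LieRing L] [LieAlgebra K L]

local notation "U" => UniversalEnvelopingAlgebra K L
local notation "j" => UniversalEnvelopingAlgebra.ι K

/-- The subspace `K + L` of `U(L)`. -/
def envGen : Submodule K U := 1 ⊔ LinearMap.range (j : L →ₗ⁅K⁆ U).toLinearMap

/-- The standard filtration of `U(L)`. -/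
def envFil (n : ℕ) : Submodule K U := envGen K L ^ n

/-- The term of degree `n - 1` of the standard filtration, where the one of degree `-1` is `0`. -/
def envFilPred : ℕ → Submodule K U
  | 0 => ⊥
  | n + 1 => envFil K L n

variable {K L}

lemma one_le_envGen : (1 : Submodule K U) ≤ envGen K L := le_sup_left

lemma ι_mem_envGen (X : L) : j X ∈ envGen K L :=
  Submodule.mem_sup_right ⟨X, rfl⟩

lemma mem_envGen {u : U} : u ∈ envGen K L ↔ ∃ (c : K) (X : L), u = c • 1 + j X := by
  rw [envGen, Submodule.mem_sup]
  constructor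
  · rintro ⟨y, hy, _, ⟨X, rfl⟩, rfl⟩
    obtain ⟨c, rfl⟩ := Submodule.mem_one.1 hy
    exact ⟨c, X, by rw [Algebra.algebraMap_eq_smul_one]; rfl⟩
  · rintro ⟨c, X, rfl⟩
    exact ⟨c • 1, Submodule.smul_mem _ c (Submodule.one_le.1 le_rfl), _, ⟨X, rfl⟩, rfl⟩

lemma envFil_zero : envFil K L 0 = 1 := pow_zero _

lemma envFil_succ (n : ℕ) : envFil K L (n + 1) = envGen K L * envFil K L n := pow_succ' _ _

lemma envFil_one : envFil K L 1 = envGen K L := pow_one _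

lemma envFil_mono : Monotone (envFil K L) := fun _ _ h ↦ pow_le_pow_right' one_le_envGen h

lemma one_mem_envFil (n : ℕ) : (1 : U) ∈ envFil K L n :=
  envFil_mono (Nat.zero_le n) (by rw [envFil_zero]; exact Submodule.one_le.1 le_rfl)

lemma envFil_mul_mem {m n : ℕ} {u v : U} (hu : u ∈ envFil K L m) (hv : v ∈ envFil K L n) :
    u * v ∈ envFil K L (m + n) := by
  rw [envFil, pow_add]
  exact Submodule.mul_mem_mul hu hv

lemma ι_mul_mem_envFil (X : L) {n : ℕ} {u : U} (hu : u ∈ envFil K L n) :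
    j X * u ∈ envFil K L (n + 1) := by
  rw [envFil_succ]
  exact Submodule.mul_mem_mul (ι_mem_envGen X) hu

/-- Induction along the standard filtration. -/
lemma envFil_induction {P : ℕ → U → Prop} (one : P 0 1)
    (add : ∀ n u v, P n u → P n v → P n (u + v)) (smul : ∀ n (c : K) u, P n u → P n (c • u))
    (succ : ∀ n u, u ∈ envFil K L n → P n u → P (n + 1) u)
    (ι_mul : ∀ n X u, u ∈ envFil K L n → P n u → P (n + 1) (j X * u))
    {n : ℕ} {u : U} (hu : u ∈ envFil K L n) : P n u := by
  induction n generalizing u with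
  | zero =>
    rw [envFil_zero] at hu
    obtain ⟨c, rfl⟩ := Submodule.mem_one.1 hu
    rw [Algebra.algebraMap_eq_smul_one]
    exact smul 0 c 1 one
  | succ n ih =>
    rw [envFil_succ] at hu
    induction hu using Submodule.mul_induction_on' with
    | mem_mul_mem v hv w hw =>
      obtain ⟨c, X, rfl⟩ := mem_envGen.1 hv
      rw [add_mul, smul_mul_assoc, one_mul]
      exact add _ _ _ (smul _ _ _ (succ n w hw (ih hw))) (ι_mul n X w hw (ih hw))
    | add x _ y _ hx hy => exact add _ _ _ hx hy

lemma exists_mem_envFil (u : U) : ∃ n, u ∈ envFil K L n := by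
  let S : Subalgebra K U :=
    { carrier := {u | ∃ n, u ∈ envFil K L n}
      mul_mem' := fun ⟨m, hm⟩ ⟨n, hn⟩ ↦ ⟨m + n, envFil_mul_mem hm hn⟩
      add_mem' := fun ⟨m, hm⟩ ⟨n, hn⟩ ↦ ⟨max m n, add_mem (envFil_mono (le_max_left m n) hm)
        (envFil_mono (le_max_right m n) hn)⟩
      algebraMap_mem' := fun c ↦ ⟨0, by
        rw [Algebra.algebraMap_eq_smul_one]; exact Submodule.smul_mem _ c (one_mem_envFil 0)⟩ }
  exact env_induction S (fun X ↦ ⟨1, by rw [envFil_one]; exact ι_mem_envGen X⟩) u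

lemma envFilPred_le (n : ℕ) : envFilPred K L n ≤ envFil K L n := by
  cases n with
  | zero => exact bot_le
  | succ n => exact envFil_mono n.le_succ

lemma ι_mul_mem_envFilPred (X : L) {n : ℕ} {u : U} (hu : u ∈ envFilPred K L n) :
    j X * u ∈ envFilPred K L (n + 1) := by
  cases n with
  | zero => rw [(Submodule.mem_bot K).1 hu, mul_zero]; exact zero_mem _
  | succ n => exact ι_mul_mem_envFil X hu

/-- The commutator with X is a derivation of U(L) that maps L to L, so it does not raise the degree.
-/
lemma lie_mem_envFil (X : L) {n : ℕ} {u : U} (hu : u ∈ envFil K L n) :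
    j X * u - u * j X ∈ envFil K L n := by
  refine envFil_induction (P := fun n u ↦ j X * u - u * j X ∈ envFil K L n) ?_ ?_ ?_ ?_ ?_ hu
  · rw [mul_one, one_mul, sub_self]; exact zero_mem _
  · intro n u v hu hv
    have := add_mem hu hv
    convert this using 1
    rw [mul_add, add_mul]; abel
  · intro n c u hu
    rw [mul_smul_comm, smul_mul_assoc, ← smul_sub]
    exact Submodule.smul_mem _ c hu
  · exact fun n u _ hu ↦ envFil_mono n.le_succ hu
  · intro n Y u hu h
    have hXY : j X * j Y - j Y * j X = j ⁅X, Y⁆ := by rw [LieHom.map_lie, Ring.lie_def]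
    have := add_mem (ι_mul_mem_envFil ⁅X, Y⁆ hu) (ι_mul_mem_envFil Y h)
    convert this using 1
    rw [← hXY, sub_mul, mul_sub]
    simp only [mul_assoc]
    abel

/-! ### Comultiplication and multiplication on the standard filtration -/

variable (K L) in
/-- The filtration of `U(L) ⊗ U(L)` induced by the standard filtration. -/
def envFilTensor (n : ℕ) : Submodule K (U ⊗[K] U) :=
  Submodule.span K {w | ∃ (i k : ℕ) (u v : U), i + k ≤ n ∧ u ∈ envFil K L i ∧ v ∈ envFil K L k ∧
    w = u ⊗ₜ v}

lemma envFilTensor_mono : Monotone (envFilTensor K L) := fun _ _ h ↦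
  Submodule.span_mono fun _ ⟨i, k, u, v, hik, H⟩ ↦ ⟨i, k, u, v, hik.trans h, H⟩

/-- Multiplication by Δ(X) = X ⊗ 1 + 1 ⊗ X raises the total degree by at most one. -/
lemma comul_mem_envFilTensor {n : ℕ} {u : U} (hu : u ∈ envFil K L n) :
    Coalgebra.comul (R := K) u ∈ envFilTensor K L n := by
  refine envFil_induction (P := fun n u ↦ Coalgebra.comul (R := K) u ∈ envFilTensor K L n)
    ?_ ?_ ?_ ?_ ?_ hu
  · rw [Bialgebra.comul_one, Algebra.TensorProduct.one_def]
    exact Submodule.subset_span ⟨0, 0, 1, 1, le_rfl, one_mem_envFil 0, one_mem_envFil 0, rfl⟩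
  · intro n u v hu hv
    rw [map_add]; exact add_mem hu hv
  · intro n c u hu
    rw [map_smul]; exact Submodule.smul_mem _ c hu
  · exact fun n u _ hu ↦ envFilTensor_mono n.le_succ hu
  · intro n X u _ h
    rw [Bialgebra.comul_mul, comul_ι]
    generalize Coalgebra.comul (R := K) u = w at h
    induction h using Submodule.span_induction with
    | zero => rw [mul_zero]; exact zero_mem _
    | add x y _ _ hx hy => rw [mul_add]; exact add_mem hx hy
    | smul c x _ hx => rw [mul_smul_comm]; exact Submodule.smul_mem _ c hx
    | mem x hx =>
      obtain ⟨i, k, v, w, hik, hv, hw, rfl⟩ := hx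
      rw [add_mul, Algebra.TensorProduct.tmul_mul_tmul, Algebra.TensorProduct.tmul_mul_tmul,
        one_mul, one_mul]
      exact add_mem
        (Submodule.subset_span ⟨i + 1, k, _, _, by omega, ι_mul_mem_envFil X hv, hw, rfl⟩)
        (Submodule.subset_span ⟨i, k + 1, _, _, by omega, hv, ι_mul_mem_envFil X hw, rfl⟩)

/-- A factor X of u enters Δ(u) as X ⊗ 1 + 1 ⊗ X. After multiplication both summands put X in front,
up to commutators of lower degree, so every factor contributes a 2. In degree 0 the claim is an
equality, since `envFilPred` is zero there. -/
lemma mul'_comul_sub_mem {n : ℕ} {u : U} (hu : u ∈ envFil K L n) :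
    LinearMap.mul' K U (Coalgebra.comul u) - (2 : K) ^ n • u ∈ envFilPred K L n := by
  refine envFil_induction
    (P := fun n u ↦ LinearMap.mul' K U (Coalgebra.comul u) - (2 : K) ^ n • u ∈ envFilPred K L n)
    ?_ ?_ ?_ ?_ ?_ hu
  · rw [Bialgebra.comul_one, Algebra.TensorProduct.one_def, LinearMap.mul'_apply, pow_zero,
      one_smul, one_mul, sub_self]
    exact zero_mem _
  · intro n u v hu hv
    rw [map_add, map_add, smul_add, add_sub_add_comm]
    exact add_mem hu hv
  · intro n c u hu
    rw [map_smul, map_smul, smul_comm, ← smul_sub]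
    exact Submodule.smul_mem _ c hu
  · intro n u hu h
    change _ ∈ envFil K L n
    have := sub_mem (envFilPred_le n h) (Submodule.smul_mem _ ((2 : K) ^ n) hu)
    convert this using 1
    rw [pow_succ, mul_two, add_smul]
    abel
  · intro n X u hu h
    -- On v ⊗ w the difference is v X w - X v w, the negative of [X, v] w, and commutators with X
    -- keep the degree.
    have key (w : U ⊗[K] U) (hw : w ∈ envFilTensor K L n) :
        LinearMap.mul' K U ((j X ⊗ₜ 1 + 1 ⊗ₜ j X) * w) - (2 : K) • (j X * LinearMap.mul' K U w) ∈
          envFil K L n := by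
      induction hw using Submodule.span_induction with
      | zero => simp
      | add x y _ _ hx hy =>
        have := add_mem hx hy
        convert this using 1
        simp only [mul_add, map_add, smul_add]
        abel
      | smul c x _ hx =>
        have := Submodule.smul_mem _ c hx
        convert this using 1
        simp only [mul_smul_comm, map_smul, smul_sub, smul_comm (2 : K) c]
      | mem x hx =>
        obtain ⟨i, k, v, w, hik, hv, hw, rfl⟩ := hx
        have := neg_mem (envFil_mono hik (envFil_mul_mem (lie_mem_envFil X hv) hw))
        convert this using 1
        simp only [add_mul, Algebra.TensorProduct.tmul_mul_tmul, one_mul, map_add,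
          LinearMap.mul'_apply, two_smul, sub_mul, mul_assoc]
        abel
    have h2 := Submodule.smul_mem _ (2 : K) (ι_mul_mem_envFilPred X h)
    change _ ∈ envFil K L n
    have := add_mem (key _ (comul_mem_envFilTensor hu)) h2
    convert this using 1
    rw [Bialgebra.comul_mul, comul_ι, mul_sub, mul_smul_comm, smul_sub, smul_smul, pow_succ']
    abel

/-! ### The reduced comultiplication of U(L) -/

variable (K L) in
/-- The projection `u ↦ u - ε(u)` of `U(L)` onto the augmentation ideal. -/
def envAug : U →ₗ[K] U := LinearMap.id - Algebra.linearMap K U ∘ₗ Coalgebra.counit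

lemma envAug_apply (u : U) : envAug K L u = u - algebraMap K U (Coalgebra.counit u) := rfl

lemma envAug_one : envAug K L 1 = 0 := by
  rw [envAug_apply, Bialgebra.counit_one, map_one, sub_self]

lemma envAug_ι (X : L) : envAug K L (j X) = j X := by
  rw [envAug_apply, counit_ι, map_zero, sub_zero]

lemma envAug_eq_zero {u : U} (hu : u ∈ envFil K L 0) : envAug K L u = 0 := by
  rw [envFil_zero] at hu
  obtain ⟨c, rfl⟩ := Submodule.mem_one.1 hu
  rw [Algebra.algebraMap_eq_smul_one, map_smul, envAug_one, smul_zero]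

/-- By the counit laws, ∑ (u₁ - ε(u₁)) (u₂ - ε(u₂)) expands to ∑ u₁ u₂ - u - u + ε(u). The expansion
is linear in Δ(u), so it is first carried out on all of U ⊗ U. -/
lemma mul'_map_envAug_comul (u : U) :
    LinearMap.mul' K U (TensorProduct.map (envAug K L) (envAug K L) (Coalgebra.comul u)) =
      LinearMap.mul' K U (Coalgebra.comul u) - (2 : K) • u +
        algebraMap K U (Coalgebra.counit u) := by
  have h (w : U ⊗[K] U) :
      LinearMap.mul' K U (TensorProduct.map (envAug K L) (envAug K L) w) =
        LinearMap.mul' K U w - TensorProduct.lid K U (LinearMap.rTensor U Coalgebra.counit w) -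
          TensorProduct.rid K U (LinearMap.lTensor U Coalgebra.counit w) +
          algebraMap K U (Coalgebra.counit
            (TensorProduct.lid K U (LinearMap.rTensor U Coalgebra.counit w))) := by
    induction w using TensorProduct.induction_on with
    | zero => simp
    | add x y hx hy => simp only [map_add, hx, hy]; abel
    | tmul p q =>
      simp only [TensorProduct.map_tmul, LinearMap.mul'_apply, LinearMap.rTensor_tmul,
        LinearMap.lTensor_tmul, TensorProduct.lid_tmul, TensorProduct.rid_tmul, envAug_apply,
        map_smul, sub_mul, mul_sub, Algebra.algebraMap_eq_smul_one, smul_mul_assoc, one_mul,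
        mul_smul_comm, mul_one, smul_eq_mul]
      rw [smul_sub, smul_smul, mul_comm (Coalgebra.counit q : K)]
      abel
  rw [h, Coalgebra.rTensor_counit_comul, Coalgebra.lTensor_counit_comul, TensorProduct.lid_tmul,
    TensorProduct.rid_tmul, one_smul, two_smul]
  abel

lemma mul'_map_envAug_comul_sub_mem {n : ℕ} {u : U} (hu : u ∈ envFil K L (n + 1)) :
    LinearMap.mul' K U (TensorProduct.map (envAug K L) (envAug K L) (Coalgebra.comul u)) -
      ((2 : K) ^ (n + 1) - 2) • u ∈ envFil K L n := by
  have h1 : algebraMap K U (Coalgebra.counit u) ∈ envFil K L n := by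
    rw [Algebra.algebraMap_eq_smul_one]
    exact Submodule.smul_mem _ _ (one_mem_envFil n)
  have := add_mem (show _ ∈ envFil K L n from mul'_comul_sub_mem hu) h1
  convert this using 1
  rw [mul'_map_envAug_comul, sub_smul]
  abel

/-- The shift by two leaves out degree 1, where the scalar vanishes because the elements of L are
primitive. -/
lemma two_pow_sub_two_ne_zero [CharZero K] (n : ℕ) : (2 : K) ^ (n + 2) - 2 ≠ 0 := by
  have h : (2 : ℕ) ^ (n + 2) ≠ 2 := by
    have := Nat.one_le_two_pow (n := n)
    rw [pow_add]; omega
  rw [sub_ne_zero]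
  exact_mod_cast h

/-- In characteristic zero the elements of `U(L)` with trivial reduced comultiplication lie in
`K + L`. -/
lemma mem_envGen_of_mul'_map_envAug_comul [CharZero K] {u : U}
    (h : LinearMap.mul' K U (TensorProduct.map (envAug K L) (envAug K L) (Coalgebra.comul u)) = 0) :
    u ∈ envGen K L := by
  obtain ⟨n, hn⟩ := exists_mem_envFil u
  rw [← envFil_one]
  induction n with
  | zero => exact envFil_mono zero_le_one hn
  | succ n ih =>
    cases n with
    | zero => exact hn
    | succ n =>
      -- In degree at least 2 the scalar is invertible, so a vanishing reduced product lowers the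
      -- degree of u by one.
      refine ih ?_
      have := mul'_map_envAug_comul_sub_mem hn
      rw [h, zero_sub, neg_mem_iff] at this
      exact (Submodule.smul_mem_iff _ (two_pow_sub_two_ne_zero n)).1 this

end EnvelopingFiltration

end Bialgebroid
end

noncomputable section

namespace Bialgebroid

instance etaModule_isScalarTower (K : Type*) (A : Type*) (B : Type*) [Field K] [CommRing A]
    [Algebra K A] [Ring B] [Algebra K B] [LeftBialgebroid K A B] :
    IsScalarTower K (A ⊗[K] A) B :=
  ⟨fun k c ξ ↦ by rw [eta_smul, eta_smul, map_smul, smul_mul_assoc]⟩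

end Bialgebroid

namespace ConnesMoscovici

/-! ### Structure of the Connes-Moscovici bialgebroid as a module -/

variable {K : Type*} {A : Type*} {L : Type*} [Field K] [CommRing A] [Algebra K A]
    [LieRing L] [LieAlgebra K L] (ω : L →ₗ⁅K⁆ Derivation K A A)

local notation "U" => UniversalEnvelopingAlgebra K L
local notation "j" => UniversalEnvelopingAlgebra.ι K
local notation "H" => ConnesMoscovici ω
local notation "Ae" => A ⊗[K] A

lemma tmul_induction {P : H → Prop} (zero : P 0) (tmul : ∀ a u b, P (tmul ω a u b))
    (add : ∀ y z, P y → P z → P (y + z)) (z : H) : P z := by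
  suffices h : ∀ z : A ⊗[K] (U ⊗[K] A), P ((equiv ω).symm z) from h (equiv ω z)
  intro z
  induction z using TensorProduct.induction_on with
  | zero => exact zero
  | add x y hx hy => rw [map_add]; exact add _ _ hx hy
  | tmul a z =>
    induction z using TensorProduct.induction_on with
    | zero => rw [TensorProduct.tmul_zero]; exact zero
    | add x y hx hy => rw [TensorProduct.tmul_add, map_add]; exact add _ _ hx hy
    | tmul u b => exact tmul a u b

lemma tmul_smul_mid (c : K) (a b : A) (u : U) : tmul ω a (c • u) b = c • tmul ω a u b := by
  simp only [tmul, ← TensorProduct.smul_tmul', TensorProduct.tmul_smul, map_smul]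

lemma tmul_smul_left (c : K) (a b : A) (u : U) : tmul ω (c • a) u b = c • tmul ω a u b := by
  simp only [tmul, ← TensorProduct.smul_tmul', map_smul]

lemma tmul_smul_right (c : K) (a b : A) (u : U) : tmul ω a u (c • b) = c • tmul ω a u b := by
  simp only [tmul, TensorProduct.tmul_smul, map_smul]

lemma tmul_add_mid (a b : A) (u v : U) : tmul ω a (u + v) b = tmul ω a u b + tmul ω a v b := by
  simp only [tmul, TensorProduct.add_tmul, TensorProduct.tmul_add, map_add]

lemma tmul_zero_mid (a b : A) : tmul ω a (0 : U) b = 0 := by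
  simp [tmul]

lemma source_eq (a : A) : source K A H a = tmul ω a 1 1 := rfl

lemma target_eq (a : A) : target K A H a = tmul ω 1 1 a := rfl

lemma tmul_eq_smul (a b : A) (u : U) : tmul ω a u b = (a ⊗ₜ[K] b : Ae) • incl ω u :=
  tmul_eq ω a b u

lemma tmul_smul_tmul (a b c d : A) (u : U) :
    (a ⊗ₜ[K] b : Ae) • tmul ω c u d = tmul ω (a * c) u (b * d) :=
  left_mul_tmul ω a b c d u

variable {ω} in
/-- A `K`-linear map out of `A ⊙ U(L) ⊙ A` is `Aᵉ`-linear if it is so on pure tensors. -/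
lemma map_smul_of_tmul {M : Type*} [AddCommGroup M] [Module K M] [Module Ae M]
    (f : H →ₗ[K] M)
    (h : ∀ a b c d u, f (tmul ω (a * c) u (b * d)) = (a ⊗ₜ[K] b : Ae) • f (tmul ω c u d))
    (c : Ae) (z : H) : f (c • z) = c • f z := by
  induction c using TensorProduct.induction_on with
  | zero => rw [zero_smul, zero_smul, map_zero]
  | add x y hx hy => rw [add_smul, map_add, hx, hy, add_smul]
  | tmul a b =>
    induction z using tmul_induction with
    | zero => rw [smul_zero, map_zero, smul_zero]
    | add y z hy hz => rw [smul_add, map_add, hy, hz, map_add, smul_add]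
    | tmul c u d => rw [tmul_smul_tmul, h]

/-- The map `a ⊗ u ⊗ b ↦ a ⊗ q(u) ⊗ b`. -/
def mapMid (q : U →ₗ[K] U) : H →ₗ[Ae] H where
  toFun z := (equiv ω).symm (LinearMap.lTensor A (LinearMap.rTensor A q) (equiv ω z))
  map_add' y z := by simp only [map_add]
  map_smul' := map_smul_of_tmul ((equiv ω).symm.toLinearMap ∘ₗ
    LinearMap.lTensor A (LinearMap.rTensor A q) ∘ₗ (equiv ω).toLinearMap) fun a b c d u ↦
      (tmul_smul_tmul ω a b c d (q u)).symm

lemma mapMid_tmul (q : U →ₗ[K] U) (a b : A) (u : U) :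
    mapMid ω q (tmul ω a u b) = tmul ω a (q u) b := rfl

lemma mapMid_incl (q : U →ₗ[K] U) (u : U) : mapMid ω q (incl ω u) = incl ω (q u) := rfl

/-- The map `a ⊗ u ⊗ b ↦ ε(u) a ⊗ b`. -/
def etaRetract : H →ₗ[K] Ae :=
  LinearMap.lTensor A ((TensorProduct.lid K A).toLinearMap ∘ₗ
    LinearMap.rTensor A Coalgebra.counit) ∘ₗ (equiv ω).toLinearMap

lemma etaRetract_tmul (a b : A) (u : U) :
    etaRetract ω (tmul ω a u b) = a ⊗ₜ (Coalgebra.counit (R := K) u • b) := rfl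

lemma etaRetract_etaMap (c : Ae) : etaRetract ω (etaMap ω c) = c := by
  induction c using TensorProduct.induction_on with
  | zero => rw [map_zero, map_zero]
  | add x y hx hy => rw [map_add, map_add, hx, hy]
  | tmul a b => rw [etaMap_tmul, etaRetract_tmul, Bialgebra.counit_one, one_smul]

lemma etaMap_injective : Function.Injective (etaMap ω) :=
  Function.LeftInverse.injective (etaRetract_etaMap ω)

/-- `A ⊙ U(L) ⊙ A` is the `Aᵉ`-module `Aᵉ ⊗ U(L)`. -/
def moduleEquiv : H ≃ₗ[Ae] Ae ⊗[K] U where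
  __ := (equiv ω).trans ((TensorProduct.congr (LinearEquiv.refl K A)
    (TensorProduct.comm K U A)).trans (TensorProduct.assoc K A A U).symm)
  map_smul' := map_smul_of_tmul ((equiv ω).trans ((TensorProduct.congr (LinearEquiv.refl K A)
    (TensorProduct.comm K U A)).trans (TensorProduct.assoc K A A U).symm)).toLinearMap
      fun a b c d u ↦ by
        change ((a * c) ⊗ₜ (b * d)) ⊗ₜ u = (a ⊗ₜ[K] b : Ae) • ((c ⊗ₜ[K] d : Ae) ⊗ₜ[K] u)
        rw [TensorProduct.smul_tmul', smul_eq_mul, Algebra.TensorProduct.tmul_mul_tmul]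

instance : Module.Free Ae H := Module.Free.of_equiv (moduleEquiv ω).symm

/-- A K-linear coordinate function for the family, viewed as a map from U(L) to K · 1, extends
A^e-linearly by `mapMid`. Applied to a relation it leaves a single coefficient, as an element of
η(A^e), and η is injective. -/
lemma linearIndependent_incl {S : Type*} {v : S → U} (hv : LinearIndependent K v) :
    LinearIndependent Ae fun i ↦ incl ω (v i) := by
  obtain ⟨g, hg⟩ := LinearMap.exists_leftInverse_of_injective _ (LinearMap.ker_eq_bot.2 hv)
  rw [linearIndependent_iff]
  intro l hl
  ext k
  let q : U →ₗ[K] U := LinearMap.toSpanSingleton K U 1 ∘ₗ Finsupp.lapply k ∘ₗ g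
  have hq (i : S) : q (v i) = Finsupp.single i (1 : K) k • 1 := by
    have := LinearMap.congr_fun hg (Finsupp.single i 1)
    rw [LinearMap.comp_apply, Finsupp.linearCombination_single, one_smul,
      LinearMap.id_apply] at this
    simp only [q, LinearMap.comp_apply, this]
    rfl
  have h := congrArg (mapMid ω q) hl
  rw [map_zero, Finsupp.apply_linearCombination, Finsupp.linearCombination_apply,
    Finsupp.sum, Finset.sum_eq_single k] at h
  · rw [Function.comp_apply, mapMid_incl, hq, Finsupp.single_eq_same, one_smul, map_one, eta_smul,
      mul_one] at h
    exact (map_eq_zero_iff _ (etaMap_injective ω)).1 h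
  · intro i _ hik
    rw [Function.comp_apply, mapMid_incl, hq, Finsupp.single_eq_of_ne hik.symm, zero_smul,
      map_zero, smul_zero]
  · intro hk
    rw [Finsupp.notMem_support_iff.1 hk, zero_smul]

/-! ### The standard filtration -/

/-- The filtration of `A ⊙ U(L) ⊙ A` by the `A ⊗ Fₙ U(L) ⊗ A`. -/
def fil (n : ℕ) : Submodule Ae H := Submodule.span Ae (incl ω '' envFil K L n)

variable {ω}

lemma incl_mem_fil {n : ℕ} {u : U} (hu : u ∈ envFil K L n) : incl ω u ∈ fil ω n :=
  Submodule.subset_span ⟨u, hu, rfl⟩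

lemma tmul_mem_fil {n : ℕ} {u : U} (hu : u ∈ envFil K L n) (a b : A) : tmul ω a u b ∈ fil ω n := by
  rw [tmul_eq_smul]
  exact Submodule.smul_mem _ _ (incl_mem_fil hu)

lemma fil_mono : Monotone (fil ω) := fun _ _ h ↦
  Submodule.span_mono (Set.image_mono (envFil_mono h))

lemma fil_induction {n : ℕ} {P : H → Prop} (zero : P 0)
    (tmul : ∀ a u b, u ∈ envFil K L n → P (tmul ω a u b))
    (add : ∀ y z, P y → P z → P (y + z)) {z : H} (hz : z ∈ fil ω n) : P z := by
  -- Quantifying over a scalar absorbs the scalar step of the span induction, so that only pure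
  -- tensors over elements of Fₙ U(L) remain.
  suffices h : ∀ c : Ae, P (c • z) by simpa using h 1
  induction hz using Submodule.span_induction with
  | zero => intro c; rw [smul_zero]; exact zero
  | add x y _ _ hx hy => intro c; rw [smul_add]; exact add _ _ (hx c) (hy c)
  | smul d x _ hx => intro c; rw [smul_smul]; exact hx _
  | mem x hx =>
    obtain ⟨u, hu, rfl⟩ := hx
    intro c
    induction c using TensorProduct.induction_on with
    | zero => rw [zero_smul]; exact zero
    | add x y hx hy => rw [add_smul]; exact add _ _ hx hy
    | tmul a b => rw [← tmul_eq_smul]; exact tmul a u b hu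

lemma exists_mem_fil (z : H) : ∃ n, z ∈ fil ω n := by
  induction z using tmul_induction with
  | zero => exact ⟨0, zero_mem _⟩
  | add y z hy hz =>
    obtain ⟨m, hm⟩ := hy
    obtain ⟨n, hn⟩ := hz
    exact ⟨max m n, add_mem (fil_mono (le_max_left m n) hm) (fil_mono (le_max_right m n) hn)⟩
  | tmul a u b =>
    obtain ⟨n, hn⟩ := exists_mem_envFil u
    exact ⟨n, tmul_mem_fil hn a b⟩

lemma mapMid_mem_fil {q : U →ₗ[K] U} {n : ℕ} (hq : ∀ u, q u ∈ envFil K L n) (z : H) :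
    mapMid ω q z ∈ fil ω n := by
  induction z using tmul_induction with
  | zero => rw [map_zero]; exact zero_mem _
  | add y z hy hz => rw [map_add]; exact add_mem hy hz
  | tmul a u b => exact tmul_mem_fil (hq u) a b

lemma mapMid_eq_of_mem_fil {q q' : U →ₗ[K] U} {n : ℕ} (hq : ∀ u ∈ envFil K L n, q u = q' u) {z : H}
    (hz : z ∈ fil ω n) : mapMid ω q z = mapMid ω q' z := by
  refine fil_induction (P := fun z ↦ mapMid ω q z = mapMid ω q' z) ?_ ?_ ?_ hz
  · rw [map_zero, map_zero]
  · intro a u b hu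
    rw [mapMid_tmul, mapMid_tmul, hq u hu]
  · intro y z hy hz
    rw [map_add, map_add, hy, hz]

lemma mapMid_id (z : H) : mapMid ω LinearMap.id z = z := by
  induction z using tmul_induction with
  | zero => rw [map_zero]
  | add y z hy hz => rw [map_add, hy, hz]
  | tmul a u b => rfl

/-- Over a field Fₙ U(L) has a complement in U(L), and the resulting projection stays A^e-linear
when A is tensored on from both sides. -/
lemma exists_fil_projection (n : ℕ) :
    ∃ E : H →ₗ[Ae] H, (∀ z, E z ∈ fil ω n) ∧ ∀ z ∈ fil ω n, E z = z := by
  obtain ⟨q, hq⟩ := (envFil K L n).exists_isCompl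
  refine ⟨mapMid ω ((envFil K L n).subtype ∘ₗ Submodule.projectionOnto _ q hq),
    mapMid_mem_fil fun u ↦ ?_, fun z hz ↦ ?_⟩
  · rw [LinearMap.comp_apply]
    exact Subtype.prop _
  · refine (mapMid_eq_of_mem_fil (q' := LinearMap.id) (fun u hu ↦ ?_) hz).trans (mapMid_id z)
    rw [LinearMap.comp_apply, LinearMap.id_apply]
    exact congrArg Subtype.val (Submodule.projectionOnto_apply_left hq ⟨u, hu⟩)

/-! ### The primitive elements -/

lemma incl_ι_mem_prim (X : L) : incl ω (j X) ∈ Prim K A H := by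
  change (balRel (etaMap ω)).mkQ (comulRep ω (incl ω (j X))) = _
  rw [incl_apply, comulRep_tmul', map_one, map_one, ← Algebra.TensorProduct.one_def, one_mul,
    inclComul_ι]
  rfl

/-! ### Contraction of the inner A-factors by a functional -/

variable (ω)

/-- The map `(a ⊗ u ⊗ b) ⊗ (a' ⊗ v ⊗ b') ↦ f(b a') a ⊗ β(u ⊗ v) ⊗ b'`. -/
def contractRep (f : A →ₗ[K] K) (β : U ⊗[K] U →ₗ[K] U) : H ⊗[K] H →ₗ[K] H :=
  (equiv ω).symm.toLinearMap ∘ₗ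
    LinearMap.lTensor A (LinearMap.rTensor A β ∘ₗ (TensorProduct.assoc K U U A).symm.toLinearMap) ∘ₗ
    (TensorProduct.assoc K A U (U ⊗[K] A)).toLinearMap ∘ₗ
    LinearMap.lTensor (A ⊗[K] U) ((TensorProduct.lid K (U ⊗[K] A)).toLinearMap ∘ₗ
      LinearMap.rTensor (U ⊗[K] A) (f ∘ₗ LinearMap.mul' K A) ∘ₗ
      (TensorProduct.assoc K A A (U ⊗[K] A)).symm.toLinearMap) ∘ₗ
    (TensorProduct.assoc K (A ⊗[K] U) A (A ⊗[K] (U ⊗[K] A))).toLinearMap ∘ₗ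
    TensorProduct.map ((TensorProduct.assoc K A U A).symm.toLinearMap ∘ₗ (equiv ω).toLinearMap)
      (equiv ω).toLinearMap

lemma contractRep_tmul (f : A →ₗ[K] K) (β : U ⊗[K] U →ₗ[K] U) (a b a' b' : A) (u v : U) :
    contractRep ω f β (tmul ω a u b ⊗ₜ tmul ω a' v b') =
      f (b * a') • tmul ω a (β (u ⊗ₜ v)) b' := by
  rw [← tmul_smul_mid, ← map_smul, ← TensorProduct.tmul_smul]
  rfl

/-- The map `(a ⊗ u ⊗ b) ⊗ (a' ⊗ v ⊗ b') ↦ f(b a') a ⊗ β(u ⊗ v) ⊗ b'` on the tensor product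
over `A`. -/
def contract (f : A →ₗ[K] K) (β : U ⊗[K] U →ₗ[K] U) : BalTensor (etaMap ω) →ₗ[K] H :=
  (balRel (etaMap ω)).liftQ (contractRep ω f β) <| balRel_le _ fun c y z ↦ by
    induction y using tmul_induction with
    | zero => simp
    | add y y' hy hy' => rw [mul_add, TensorProduct.add_tmul, map_add, hy, hy',
        TensorProduct.add_tmul, map_add]
    | tmul a u b =>
      induction z using tmul_induction with
      | zero => simp
      | add z z' hz hz' => rw [mul_add, TensorProduct.tmul_add, map_add, hz, hz',
          TensorProduct.tmul_add, map_add]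
      | tmul a' v b' =>
        rw [tgt_apply, src_apply, left_mul_tmul, left_mul_tmul, contractRep_tmul,
          contractRep_tmul, one_mul, one_mul, mul_comm c, mul_assoc]

lemma contract_mkQ (f : A →ₗ[K] K) (β : U ⊗[K] U →ₗ[K] U) (w : H ⊗[K] H) :
    contract ω f β ((balRel (etaMap ω)).mkQ w) = contractRep ω f β w := rfl

lemma contractRep_map (f : A →ₗ[K] K) (hf : f 1 = 1) (β : U ⊗[K] U →ₗ[K] U) (a b : A)
    (w : U ⊗[K] U) : contractRep ω f β (TensorProduct.map (inclLeft ω a) (inclRight ω b) w) =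
      tmul ω a (β w) b := by
  induction w using TensorProduct.induction_on with
  | zero => rw [map_zero, map_zero, map_zero, tmul_zero_mid]
  | add x y hx hy => rw [map_add, map_add, hx, hy, map_add, tmul_add_mid]
  | tmul u v =>
    rw [TensorProduct.map_tmul, inclLeft_apply, inclRight_apply, contractRep_tmul, mul_one, hf,
      one_smul]

/-- The inner A-factors of Δ(a ⊗ u ⊗ b) are both 1 and f(1) = 1, so only β ∘ Δ on the middle factor
remains. -/
lemma contractRep_comulRep (f : A →ₗ[K] K) (hf : f 1 = 1) (β : U ⊗[K] U →ₗ[K] U) (a b : A)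
    (u : U) : contractRep ω f β (comulRep ω (tmul ω a u b)) =
      tmul ω a (β (Coalgebra.comul u)) b := by
  rw [comulRep_tmul_map, contractRep_map ω f hf]

/-- The line K · 1 is a direct summand of the vector space A. Contracting with such a functional
allows identities over A to be tested without any flatness. -/
lemma exists_functional (K A : Type*) [Field K] [CommRing A] [Nontrivial A] [Algebra K A] :
    ∃ f : A →ₗ[K] K, f 1 = 1 := by
  obtain ⟨f, hf⟩ := LinearMap.exists_leftInverse_of_injective (Algebra.linearMap K A)
    (LinearMap.ker_eq_bot.2 (algebraMap K A).injective)
  refine ⟨f, ?_⟩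
  simpa using LinearMap.congr_fun hf 1

/-- The map `a ⊗ u ⊗ b ↦ f(a) f(b) u`. -/
def toEnv (f : A →ₗ[K] K) : H →ₗ[K] U :=
  (TensorProduct.lid K U).toLinearMap ∘ₗ
    TensorProduct.map f ((TensorProduct.rid K U).toLinearMap ∘ₗ LinearMap.lTensor U f) ∘ₗ
    (equiv ω).toLinearMap

lemma toEnv_tmul (f : A →ₗ[K] K) (a b : A) (u : U) :
    toEnv ω f (tmul ω a u b) = f a • f b • u := rfl

lemma incl_injective [Nontrivial A] : Function.Injective (incl ω) := by
  obtain ⟨f, hf⟩ := exists_functional K A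
  refine Function.LeftInverse.injective (g := toEnv ω f) fun u ↦ ?_
  rw [incl_apply, toEnv_tmul, hf, one_smul, one_smul]

/-- The algebra A = 0 has no functional with f(1) = 1, so this case is treated apart throughout. -/
lemma subsingleton [Subsingleton A] : Subsingleton H :=
  subsingleton_of_zero_eq_one <| by
    rw [one_eq, Subsingleton.elim (1 : A) 0]
    simp [tmul]

variable {ω}

/-- Contracting Δ(z) = z ⊗ 1 + 1 ⊗ z with a left inverse β of the comultiplication of U(L) gives
back z. For β = id ⊗ ε this expresses z by terms a ⊗ u ⊗ 1 and 1 ⊗ 1 ⊗ b, for β = ε ⊗ id by terms a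
⊗ 1 ⊗ 1 and 1 ⊗ u ⊗ b. Substituting the first expression into the second leaves only the required
shapes. -/
lemma exists_eq_of_mem_prim_aux {f : A →ₗ[K] K} (hf : f 1 = 1) {z : H} (hz : z ∈ Prim K A H) :
    ∃ (x y : A) (u : U), z = tmul ω x 1 1 + incl ω u + tmul ω 1 1 y := by
  have hz' : (balRel (etaMap ω)).mkQ (comulRep ω z) = (balRel (etaMap ω)).mkQ (z ⊗ₜ 1 + 1 ⊗ₜ z) :=
    hz
  have h1 (β : U ⊗[K] U →ₗ[K] U) (hβ : ∀ u, β (Coalgebra.comul u) = u) :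
      contractRep ω f β (z ⊗ₜ 1) + contractRep ω f β (1 ⊗ₜ z) = z := by
    rw [← map_add, ← contract_mkQ, ← hz', contract_mkQ]
    refine hom_ext ω (f := contractRep ω f β ∘ₗ comulRep ω) (g := LinearMap.id)
      (fun a u b ↦ ?_) z
    rw [LinearMap.comp_apply, contractRep_comulRep ω f hf, hβ, LinearMap.id_apply]
  have hl := h1 ((TensorProduct.rid K U).toLinearMap ∘ₗ LinearMap.lTensor U Coalgebra.counit)
    fun u ↦ by simp
  have hr := h1 ((TensorProduct.lid K U).toLinearMap ∘ₗ LinearMap.rTensor U Coalgebra.counit)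
    fun u ↦ by simp
  replace hr := hr.symm
  conv_rhs at hr => rw [← hl]
  rw [hr]
  -- The composite of the two contractions has values of the required form on every z, primitive or
  -- not, so pure tensors suffice.
  clear h1 hl hr hz hz'
  induction z using tmul_induction with
  | zero =>
    refine ⟨0, 0, 0, ?_⟩
    simp [tmul]
  | add y z hy hz =>
    obtain ⟨x₁, y₁, u₁, h₁⟩ := hy
    obtain ⟨x₂, y₂, u₂, h₂⟩ := hz
    refine ⟨x₁ + x₂, y₁ + y₂, u₁ + u₂, ?_⟩
    have e1 : tmul ω (x₁ + x₂) 1 1 = tmul ω x₁ 1 1 + tmul ω x₂ 1 1 := map_add (src (etaMap ω)) _ _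
    have e2 : tmul ω 1 1 (y₁ + y₂) = tmul ω 1 1 y₁ + tmul ω 1 1 y₂ := map_add (tgt (etaMap ω)) _ _
    rw [e1, e2, map_add]
    rw [show tmul ω x₁ 1 1 + tmul ω x₂ 1 1 + (incl ω u₁ + incl ω u₂) +
      (tmul ω 1 1 y₁ + tmul ω 1 1 y₂) = (tmul ω x₁ 1 1 + incl ω u₁ + tmul ω 1 1 y₁) +
      (tmul ω x₂ 1 1 + incl ω u₂ + tmul ω 1 1 y₂) by abel, ← h₁, ← h₂]
    simp only [TensorProduct.add_tmul, TensorProduct.tmul_add, map_add]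
    abel
  | tmul a u b =>
    -- The multiple of 1 in the middle arises because the second contraction turns 1 ⊗ 1 ⊗ b into 1
    -- ⊗ 1 ⊗ b plus the scalar f(b).
    refine ⟨(f b * Coalgebra.counit u : K) • a, (f a * Coalgebra.counit u : K) • b,
      (f a * f b) • u + (f a * f b * Coalgebra.counit u : K) • 1, ?_⟩
    rw [one_eq, incl_apply]
    simp only [contractRep_tmul, tmul_smul_left, tmul_smul_right, tmul_smul_mid, tmul_add_mid,
      LinearMap.comp_apply, LinearMap.lTensor_tmul, LinearMap.rTensor_tmul, LinearEquiv.coe_coe,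
      TensorProduct.lid_tmul, TensorProduct.rid_tmul, Bialgebra.counit_one, one_smul, mul_one,
      one_mul, TensorProduct.add_tmul, TensorProduct.tmul_add, map_add, TensorProduct.tmul_smul,
      ← TensorProduct.smul_tmul', map_smul, hf, smul_smul]
    module

/-- In characteristic zero, the primitive elements of `A ⊙ U(L) ⊙ A` are the sums of an element
of `L` and an element of `⟨s - t⟩`. -/
lemma exists_eq_of_mem_prim [CharZero K] {z : H} (hz : z ∈ Prim K A H) :
    ∃ (X : L) (a : A), z = incl ω (j X) + (source K A H a - target K A H a) := by
  cases subsingleton_or_nontrivial A with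
  | inl h =>
    have := subsingleton ω
    exact ⟨0, 0, Subsingleton.elim _ _⟩
  | inr h =>
    obtain ⟨f, hf⟩ := exists_functional K A
    obtain ⟨x, y, u, rfl⟩ := exists_eq_of_mem_prim_aux hf hz
    -- Primitive elements have counit zero, which gives x + ε(u) + y = 0.
    have h0 := counit_prim K A ⟨_, hz⟩
    change counitMap ω _ = 0 at h0
    rw [map_add, map_add, incl_apply, counitMap_tmul, counitMap_tmul, counitMap_tmul,
      Bialgebra.counit_one, one_smul, one_smul, mul_one, one_mul, one_mul] at h0
    replace hz : (balRel (etaMap ω)).mkQ (comulRep ω _) =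
      (balRel (etaMap ω)).mkQ (_ ⊗ₜ 1 + 1 ⊗ₜ _) := hz
    -- The reduced multiplication kills z ⊗ 1 and 1 ⊗ z, so primitivity forces the reduced product
    -- of Δ(u) to vanish and u to lie in K + L.
    have hβ (v : U) : (LinearMap.mul' K U ∘ₗ TensorProduct.map (envAug K L) (envAug K L))
        (v ⊗ₜ[K] 1) = 0 := by simp [envAug_one]
    have hβ' (v : U) : (LinearMap.mul' K U ∘ₗ TensorProduct.map (envAug K L) (envAug K L))
        (1 ⊗ₜ[K] v) = 0 := by simp [envAug_one]
    have h1 := congrArg (contract ω f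
      (LinearMap.mul' K U ∘ₗ TensorProduct.map (envAug K L) (envAug K L))) hz
    rw [contract_mkQ, contract_mkQ, incl_apply] at h1
    simp only [map_add, contractRep_comulRep ω f hf, Bialgebra.comul_one, one_eq,
      Algebra.TensorProduct.one_def, hβ, hβ', tmul_zero_mid, TensorProduct.add_tmul,
      TensorProduct.tmul_add, contractRep_tmul, smul_zero, add_zero, zero_add] at h1
    rw [← incl_apply, map_eq_zero_iff _ (incl_injective ω)] at h1
    obtain ⟨c, X, rfl⟩ := mem_envGen.1 (mem_envGen_of_mul'_map_envAug_comul h1)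
    -- The constant c of u = c + X is moved into the source; the counit relation then says y = -(x +
    -- c).
    refine ⟨X, x + algebraMap K A c, ?_⟩
    rw [map_add, counit_ι, map_smul, Bialgebra.counit_one, add_zero, smul_eq_mul, mul_one,
      ← Algebra.algebraMap_eq_smul_one] at h0
    have hy : y = -(x + algebraMap K A c) := (neg_eq_of_add_eq_zero_right h0).symm
    change src (etaMap ω) x + _ + tgt (etaMap ω) y = _ +
      (src (etaMap ω) _ - tgt (etaMap ω) _)
    rw [hy, map_neg, map_add, map_add (src (etaMap ω)), map_add (tgt (etaMap ω)), AlgHom.commutes, AlgHom.commutes,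
      map_smul, map_one, Algebra.algebraMap_eq_smul_one]
    abel

end ConnesMoscovici
end

noncomputable section

namespace Bialgebroid

/-! ### Multiplication by primitive elements and the primitive filtration -/

section PrimFiltration

variable {K : Type*} {A : Type*} {B : Type*} [Field K] [CommRing A] [Algebra K A] [Ring B]
  [Algebra K B] [LeftBialgebroid K A B]

lemma mem_primFiltration {n : ℕ} {ξ : B} : ξ ∈ primFiltration K A B n ↔
    ξ ∈ (LinearMap.range (eta K A B).toLinearMap ⊔
      ⨆ k ∈ Set.Icc 1 n, primSpan K A B ^ k : Submodule K B) := Iff.rfl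

lemma eta_mem_primFiltration (c : A ⊗[K] A) (n : ℕ) : eta K A B c ∈ primFiltration K A B n :=
  mem_primFiltration.2 (Submodule.mem_sup_left ⟨c, rfl⟩)

lemma primSpan_pow_le {k n : ℕ} (h1 : 1 ≤ k) (hn : k ≤ n) :
    primSpan K A B ^ k ≤ (LinearMap.range (eta K A B).toLinearMap ⊔
      ⨆ k ∈ Set.Icc 1 n, primSpan K A B ^ k : Submodule K B) :=
  le_sup_of_le_right (le_iSup₂_of_le k ⟨h1, hn⟩ le_rfl)

lemma primFiltration_mono : Monotone (primFiltration K A B) := fun m n h ξ hξ ↦ by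
  have h' : (LinearMap.range (eta K A B).toLinearMap ⊔
      ⨆ k ∈ Set.Icc 1 m, primSpan K A B ^ k : Submodule K B) ≤
      LinearMap.range (eta K A B).toLinearMap ⊔ ⨆ k ∈ Set.Icc 1 n, primSpan K A B ^ k :=
    sup_le le_sup_left (iSup₂_le fun k hk ↦ primSpan_pow_le hk.1 (hk.2.trans h))
  exact mem_primFiltration.2 (h' (mem_primFiltration.1 hξ))

lemma one_le_range_eta : (1 : Submodule K B) ≤ LinearMap.range (eta K A B).toLinearMap := by
  rw [Submodule.one_le]
  exact ⟨1, map_one (eta K A B)⟩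

/-- As 1 lies in η(A^e), both Prim(B) and Prim(B) η(A^e) are contained in `primSpan`, so each
summand moves up by at most one degree. -/
lemma prim_mul_mem_primFiltration {X ξ : B} (hX : X ∈ Prim K A B) {n : ℕ}
    (hξ : ξ ∈ primFiltration K A B n) : X * ξ ∈ primFiltration K A B (n + 1) := by
  have hP : (Prim K A B).toSubmodule * LinearMap.range (eta K A B).toLinearMap ≤
      primSpan K A B := by
    rw [primSpan]
    gcongr
    exact le_mul_of_one_le_left' one_le_range_eta
  have hP' : (Prim K A B).toSubmodule ≤ primSpan K A B :=
    (le_mul_of_one_le_right' one_le_range_eta).trans hP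
  have h' : (Prim K A B).toSubmodule * (LinearMap.range (eta K A B).toLinearMap ⊔
      ⨆ k ∈ Set.Icc 1 n, primSpan K A B ^ k) ≤ (LinearMap.range (eta K A B).toLinearMap ⊔
      ⨆ k ∈ Set.Icc 1 (n + 1), primSpan K A B ^ k : Submodule K B) := by
    rw [Submodule.mul_sup, Submodule.mul_iSup]
    refine sup_le (hP.trans ?_) (iSup_le fun k ↦ ?_)
    · simpa only [pow_one] using
        primSpan_pow_le (K := K) (A := A) (B := B) le_rfl (Nat.succ_le_succ n.zero_le)
    · rw [Submodule.mul_iSup]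
      refine iSup_le fun hk ↦ le_trans ?_
        (primSpan_pow_le (Nat.succ_le_succ k.zero_le) (Nat.succ_le_succ hk.2))
      rw [pow_succ']
      gcongr
  exact mem_primFiltration.2
    (h' (Submodule.mul_mem_mul (show X ∈ (Prim K A B).toSubmodule from hX)
      (mem_primFiltration.1 hξ)))

end PrimFiltration

end Bialgebroid

namespace ConnesMoscovici

variable {K : Type*} {A : Type*} {L : Type*} [Field K] [CommRing A] [Algebra K A]
    [LieRing L] [LieAlgebra K L] {ω : L →ₗ⁅K⁆ Derivation K A A}

local notation "U" => UniversalEnvelopingAlgebra K L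
local notation "j" => UniversalEnvelopingAlgebra.ι K
local notation "H" => ConnesMoscovici ω
local notation "Ae" => A ⊗[K] A

lemma ι_mul_mem_fil (X : L) {n : ℕ} {z : H} (hz : z ∈ fil ω n) :
    incl ω (j X) * z ∈ fil ω (n + 1) := by
  refine fil_induction (P := fun z ↦ incl ω (j X) * z ∈ fil ω (n + 1)) ?_ ?_ ?_ hz
  · rw [mul_zero]; exact zero_mem _
  · intro a u b hu
    rw [incl_apply, ι_mul_tmul]
    have hu' := envFil_mono n.le_succ hu
    exact add_mem (add_mem (tmul_mem_fil hu' _ _) (tmul_mem_fil (ι_mul_mem_envFil X hu) _ _))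
      (tmul_mem_fil hu' _ _)
  · intro y z hy hz
    rw [mul_add]; exact add_mem hy hz

section Hom

variable {B : Type*} [Ring B] [Algebra K B] [LeftBialgebroid K A B]

/-! ### Homomorphisms out of the Connes-Moscovici bialgebroid -/

variable (ω) in
/-- The linear map `a ⊗ u ⊗ b ↦ η(a ⊗ b) κ(u)`. -/
def liftLinear (κ : L →ₗ⁅K⁆ B) : H →ₗ[K] B :=
  TensorProduct.lift ((LinearMap.mul K B).compl₁₂ (eta K A B).toLinearMap
    (UniversalEnvelopingAlgebra.lift K κ).toLinearMap) ∘ₗ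
      ((moduleEquiv ω).restrictScalars K).toLinearMap

lemma liftLinear_tmul (κ : L →ₗ⁅K⁆ B) (a b : A) (u : U) : liftLinear ω κ (tmul ω a u b) =
    eta K A B (a ⊗ₜ b) * UniversalEnvelopingAlgebra.lift K κ u := rfl

variable (ω) in
/-- The algebra map `a ⊗ u ⊗ b ↦ η(a ⊗ b) κ(u)`. -/
def liftHom (κ : L →ₗ⁅K⁆ B)
    (hs : ∀ X a, κ X * source K A B a = source K A B a * κ X + source K A B (ω X a))
    (ht : ∀ X a, κ X * target K A B a = target K A B a * κ X + target K A B (ω X a)) :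
    H →ₐ[K] B :=
  AlgHom.ofLinearMap (liftLinear ω κ)
    (by rw [one_eq, liftLinear_tmul, map_one, mul_one]; exact map_one (eta K A B))
    fun y z ↦ by
      -- The left factors that are multiplicative against every right factor form a subalgebra, so
      -- generators suffice.
      let S : Subalgebra K H :=
        { carrier := {y | ∀ z, liftLinear ω κ (y * z) = liftLinear ω κ y * liftLinear ω κ z}
          mul_mem' := fun {x y} hx hy z ↦ by rw [mul_assoc, hx, hy, hx, mul_assoc]
          add_mem' := fun {x y} hx hy z ↦ by rw [add_mul, map_add, hx, hy, map_add, add_mul]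
          algebraMap_mem' := fun c z ↦ by
            rw [Algebra.algebraMap_eq_smul_one, smul_mul_assoc, one_mul, map_smul, map_smul,
              smul_mul_assoc, one_eq, liftLinear_tmul, map_one, mul_one,
              ← Algebra.TensorProduct.one_def, map_one, one_mul] }
      have hη (a b : A) : tmul ω a 1 b ∈ S := by
        intro z
        induction z using tmul_induction with
        | zero => rw [mul_zero, map_zero, mul_zero]
        | add y z hy hz => rw [mul_add, map_add, map_add, hy, hz, mul_add]
        | tmul c u d =>
          rw [left_mul_tmul, liftLinear_tmul, liftLinear_tmul, liftLinear_tmul, map_one, mul_one,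
            ← mul_assoc, ← map_mul, Algebra.TensorProduct.tmul_mul_tmul]
      refine induction ω S (fun a ↦ hη a 1) (fun a ↦ hη 1 a) (fun X z ↦ ?_) y z
      induction z using tmul_induction with
      | zero => rw [mul_zero, map_zero, mul_zero]
      | add y z hy hz => rw [mul_add, map_add, map_add, hy, hz, mul_add]
      | tmul c u d =>
        -- Moving κ(X) past s(c) and t(d) produces the two anchor terms of the product formula.
        have e : κ X * (source K A B c * target K A B d) = source K A B (ω X c) * target K A B d +
            source K A B c * target K A B d * κ X + source K A B c * target K A B (ω X d) := by
          rw [← mul_assoc, hs, add_mul, mul_assoc _ (κ X), ht, mul_add, ← mul_assoc]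
          abel
        rw [incl_apply, ι_mul_tmul, map_add, map_add, liftLinear_tmul, liftLinear_tmul,
          liftLinear_tmul, liftLinear_tmul, liftLinear_tmul, ← Algebra.TensorProduct.one_def,
          map_one, one_mul, map_mul, UniversalEnvelopingAlgebra.lift_ι_apply, ← src_mul_tgt,
          ← src_mul_tgt, ← src_mul_tgt, ← mul_assoc (κ X), e, ← mul_assoc, ← add_mul, ← add_mul]

lemma liftHom_etaMap (κ : L →ₗ⁅K⁆ B) (hs ht) (c : Ae) :
    liftHom ω κ hs ht (etaMap ω c) = eta K A B c := by
  induction c using TensorProduct.induction_on with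
  | zero => rw [map_zero, map_zero, map_zero]
  | add x y hx hy => rw [map_add, map_add, map_add, hx, hy]
  | tmul a b =>
    change liftLinear ω κ (tmul ω a 1 b) = _
    rw [liftLinear_tmul, map_one, mul_one]

lemma liftHom_ι (κ : L →ₗ⁅K⁆ B) (hs ht) (X : L) :
    liftHom ω κ hs ht (incl ω (j X)) = κ X := by
  change liftLinear ω κ (tmul ω 1 (j X) 1) = _
  rw [liftLinear_tmul, ← Algebra.TensorProduct.one_def, map_one, one_mul,
    UniversalEnvelopingAlgebra.lift_ι_apply]

lemma map_src {ψ : H →ₐ[K] B}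
    (hψ : ∀ c : A ⊗[K] A, ψ (etaMap ω c) = eta K A B c) (a : A) :
    ψ (src (etaMap ω) a) = source K A B a := hψ _

lemma map_tgt {ψ : H →ₐ[K] B}
    (hψ : ∀ c : A ⊗[K] A, ψ (etaMap ω c) = eta K A B c) (a : A) :
    ψ (tgt (etaMap ω) a) = target K A B a := hψ _

lemma map_eta_smul {ψ : H →ₐ[K] B}
    (hψ : ∀ c : A ⊗[K] A, ψ (etaMap ω c) = eta K A B c) (c : Ae)
    (z : H) : ψ (c • z) = c • ψ z := by
  rw [eta_smul, eta_smul, map_mul]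
  exact congrArg (· * ψ z) (hψ c)

/-- An algebra map that is compatible with the unit maps, as an `Aᵉ`-linear map. -/
def homLinear (ψ : H →ₐ[K] B) (hψ : ∀ c : A ⊗[K] A, ψ (etaMap ω c) = eta K A B c) : H →ₗ[Ae] B where
  toFun := ψ
  map_add' := map_add ψ
  map_smul' := map_eta_smul hψ

/-- Compatibility with the counit does not pass to products by itself. With a factor s(a) on the
right it does, because ε(ξ ξ') = ε(ξ s(ε(ξ'))); the case a = 1 is the claim. -/
lemma counit_hom {ψ : H →ₐ[K] B}
    (hψ : ∀ c : A ⊗[K] A, ψ (etaMap ω c) = eta K A B c)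
    (hω : ∀ X a, counit K A B (ψ (incl ω (j X)) * source K A B a) = ω X a) (z : H) :
    counit K A B (ψ z) = counitMap ω z := by
  let S : Subalgebra K H :=
    { carrier := {y | ∀ a, counit K A B (ψ y * source K A B a) =
        counitMap ω (y * src (etaMap ω) a)}
      mul_mem' := fun {x y} hx hy a ↦ by
        rw [map_mul ψ, mul_assoc, mul_assoc, ← counitMap_mul_char ω _ (counitMap_src ω), ← hx, ← hy]
        exact (LeftBialgebroid.counit_mul_source _ _).symm
      add_mem' := fun {x y} hx hy a ↦ by
        rw [map_add, add_mul, map_add, hx, hy, add_mul, map_add]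
      algebraMap_mem' := fun c a ↦ by
        rw [AlgHom.commutes, Algebra.algebraMap_eq_smul_one, Algebra.algebraMap_eq_smul_one,
          smul_mul_assoc, smul_mul_assoc, one_mul, one_mul, map_smul, map_smul, counit_source,
          counitMap_src] }
  have h := induction ω S
    (fun c a ↦ by
      rw [map_src hψ, ← map_mul, ← map_mul, counit_source, counitMap_src])
    (fun c a ↦ by
      rw [map_tgt hψ, counit_target_mul, counit_source, tgt_apply, ← etaMap_tmul,
        counitMap_eta_mul, counitMap_src, one_mul, mul_comm])
    (fun X a ↦ by rw [hω, counitMap_ι_mul, counitMap_src]) z 1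
  simpa only [map_one, mul_one] using h

lemma map_balRel {ψ : H →ₐ[K] B}
    (hψ : ∀ c : A ⊗[K] A, ψ (etaMap ω c) = eta K A B c) {w : H ⊗[K] H}
    (hw : w ∈ balRel (etaMap ω)) :
    TensorProduct.map ψ.toLinearMap ψ.toLinearMap w ∈ balRel (eta K A B) := by
  have h : balRel (etaMap ω) ≤ LinearMap.ker ((balRel (eta K A B)).mkQ ∘ₗ
      TensorProduct.map ψ.toLinearMap ψ.toLinearMap) := balRel_le _ fun a m n ↦ by
    rw [LinearMap.comp_apply, LinearMap.comp_apply, TensorProduct.map_tmul, TensorProduct.map_tmul,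
      AlgHom.toLinearMap_apply, AlgHom.toLinearMap_apply, AlgHom.toLinearMap_apply,
      AlgHom.toLinearMap_apply, map_mul, map_mul, map_src hψ, map_tgt hψ, mk_balanced]
  exact (Submodule.Quotient.mk_eq_zero _).1 (h hw)

/-- Both comultiplications are multiplicative on representatives modulo the balancing relations,
which ψ ⊗ ψ preserves. Hence it suffices to compare them on s, t and L. -/
lemma comul_hom {ψ : H →ₐ[K] B}
    (hψ : ∀ c : A ⊗[K] A, ψ (etaMap ω c) = eta K A B c)
    (hκ : ∀ X, ψ (incl ω (j X)) ∈ Prim K A B) (z : H) :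
    comul K A B (ψ z) = (balRel (eta K A B)).mkQ
      (TensorProduct.map ψ.toLinearMap ψ.toLinearMap (comulRep ω z)) := by
  let g : H ⊗[K] H →ₐ[K] B ⊗[K] B := Algebra.TensorProduct.map ψ ψ
  have hg (w : H ⊗[K] H) : TensorProduct.map ψ.toLinearMap ψ.toLinearMap w = g w := rfl
  let S : Subalgebra K H :=
    { carrier := {y | comul K A B (ψ y) = (balRel (eta K A B)).mkQ (g (comulRep ω y))}
      mul_mem' := fun {x y} hx hy ↦ by
        rw [Set.mem_ofPred_eq] at hx hy ⊢
        rw [map_mul, LeftBialgebroid.comul_mul _ _ _ _ hx.symm hy.symm, ← map_mul]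
        refine ((Submodule.Quotient.eq _).2 ?_).symm
        rw [← map_sub, ← hg]
        exact map_balRel hψ (comulRep_mul ω x y)
      add_mem' := fun {x y} hx hy ↦ by
        rw [Set.mem_ofPred_eq] at hx hy ⊢
        rw [map_add, map_add, hx, hy, map_add, map_add, map_add]
      algebraMap_mem' := fun c ↦ by
        rw [Set.mem_ofPred_eq, AlgHom.commutes, Algebra.algebraMap_eq_smul_one,
          Algebra.algebraMap_eq_smul_one, map_smul, map_smul, comulRep_one, map_smul, map_one g,
          map_smul]
        exact congrArg (c • ·) LeftBialgebroid.comul_one }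
  have hη (a b : A) : etaMap ω (a ⊗ₜ b) ∈ S := by
    change comul K A B _ = (balRel (eta K A B)).mkQ (g _)
    rw [hψ, ← mul_one (etaMap ω (a ⊗ₜ b)), comulRep_eta_mul, comulRep_one, mul_one, ← hg,
      TensorProduct.map_tmul, AlgHom.toLinearMap_apply, AlgHom.toLinearMap_apply, map_src hψ,
      map_tgt hψ, ← mul_one (eta K A B (a ⊗ₜ b)), PreLeftBialgebroid.comul_eta_mul,
      show PreLeftBialgebroid.comul (1 : B) = _ from LeftBialgebroid.comul_one]
    simp [biact, balMap]
  refine induction ω S (fun a ↦ hη a 1) (fun a ↦ hη 1 a) (fun X ↦ ?_) z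
  change comul K A B _ = (balRel (eta K A B)).mkQ (g _)
  rw [incl_apply, comulRep_tmul', map_one, map_one, ← Algebra.TensorProduct.one_def, one_mul,
    inclComul_ι, map_add, ← hg, ← hg, TensorProduct.map_tmul, TensorProduct.map_tmul,
    AlgHom.toLinearMap_apply, AlgHom.toLinearMap_apply, map_one]
  exact hκ X

/-- The primitive filtration of `B` is the image of the standard filtration. -/
lemma primFiltration_eq_map {ψ : H →ₐ[K] B}
    (hψ : ∀ c : A ⊗[K] A, ψ (etaMap ω c) = eta K A B c)
    (hκ : ∀ X, ψ (incl ω (j X)) ∈ Prim K A B)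
    (hP : ∀ ξ ∈ Prim K A B, ∃ (X : L) (a : A),
      ξ = ψ (incl ω (j X)) + (source K A B a - target K A B a)) (n : ℕ) :
    primFiltration K A B n = (fil ω n).map (homLinear ψ hψ) := by
  apply le_antisymm
  -- `Q n` is stable under η(A^e) from the left and a primitive factor costs one degree, so k
  -- factors from `primSpan` end up in `Q k`.
  · let Q (n : ℕ) : Submodule K B := ((fil ω n).map (homLinear ψ hψ)).restrictScalars K
    have hQ : Monotone Q := fun _ _ h ↦ Submodule.map_mono (fil_mono h)
    have hRQ (n : ℕ) : LinearMap.range (eta K A B).toLinearMap * Q n ≤ Q n := by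
      rw [Submodule.mul_le]
      rintro _ ⟨c, rfl⟩ y hy
      exact Submodule.smul_mem ((fil ω n).map (homLinear ψ hψ)) c hy
    have hR (n : ℕ) : LinearMap.range (eta K A B).toLinearMap ≤ Q n := by
      rintro _ ⟨c, rfl⟩
      refine ⟨c • incl ω 1, Submodule.smul_mem _ _ (incl_mem_fil (one_mem_envFil n)), ?_⟩
      rw [map_smul, map_one, eta_smul]
      change _ * ψ 1 = _
      rw [map_one, mul_one]
      rfl
    have hPQ (n : ℕ) : (Prim K A B).toSubmodule * Q n ≤ Q (n + 1) := by
      rw [Submodule.mul_le]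
      rintro X hX _ ⟨z, hz, rfl⟩
      obtain ⟨X, a, rfl⟩ := hP X hX
      rw [add_mul]
      -- The part of a primitive element in ⟨s - t⟩ lies in η(A^e) and does not raise the degree.
      refine add_mem ⟨_, ι_mul_mem_fil X hz, map_mul ψ _ _⟩ (hQ n.le_succ ?_)
      exact hRQ n (Submodule.mul_mem_mul (sub_mem ⟨_, rfl⟩ ⟨_, rfl⟩) ⟨z, hz, rfl⟩)
    have hpow (k : ℕ) : primSpan K A B ^ k ≤ Q k := by
      induction k with
      | zero => rw [pow_zero]; exact one_le_range_eta.trans (hR 0)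
      | succ k ih =>
        rw [pow_succ', primSpan, mul_assoc, mul_assoc]
        calc _ ≤ LinearMap.range (eta K A B).toLinearMap * ((Prim K A B).toSubmodule *
              (LinearMap.range (eta K A B).toLinearMap * Q k)) := by gcongr; exact ih
          _ ≤ LinearMap.range (eta K A B).toLinearMap * ((Prim K A B).toSubmodule * Q k) := by
              gcongr; exact hRQ k
          _ ≤ LinearMap.range (eta K A B).toLinearMap * Q (k + 1) := by gcongr; exact hPQ k
          _ ≤ Q (k + 1) := hRQ _
    intro ξ hξ
    exact sup_le (hR n) (iSup₂_le fun k hk ↦ (hpow k).trans (hQ hk.2)) (mem_primFiltration.1 hξ)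
  · rw [fil, Submodule.map_span_le]
    rintro _ ⟨u, hu, rfl⟩
    change ψ (incl ω u) ∈ _
    refine envFil_induction (P := fun n u ↦ ψ (incl ω u) ∈ primFiltration K A B n)
      ?_ ?_ ?_ ?_ ?_ hu
    · rw [map_one, map_one, ← map_one (eta K A B)]
      exact eta_mem_primFiltration 1 0
    · intro n u v hu hv
      rw [map_add, map_add]; exact add_mem hu hv
    · intro n c u hu
      rw [map_smul, map_smul]; exact Submodule.smul_of_tower_mem _ c hu
    · exact fun n u _ hu ↦ primFiltration_mono n.le_succ hu
    · intro n X u _ hu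
      rw [map_mul, map_mul]
      exact prim_mul_mem_primFiltration (hκ X) hu

end Hom

end ConnesMoscovici
end

noncomputable section

/-! ### Filtrations with projective quotients -/

section FiltrationRetraction

variable {R M : Type*} [Ring R] [AddCommGroup M] [Module R M]

/-- Projectivity gives a splitting g of the quotient map π, and id - g π retracts P onto N. -/
lemma exists_retraction_of_projective_quotient {N P : Submodule R M} (h : N ≤ P)
    [Module.Projective R (P ⧸ N.submoduleOf P)] :
    ∃ r : P →ₗ[R] N, ∀ x : N, r (Submodule.inclusion h x) = x := by
  obtain ⟨g, hg⟩ := Module.projective_lifting_property (N.submoduleOf P).mkQ LinearMap.id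
    (Submodule.mkQ_surjective _)
  have hmem (x : P) : ((LinearMap.id - g ∘ₗ (N.submoduleOf P).mkQ : P →ₗ[R] P) x : M) ∈ N := by
    have : (LinearMap.id - g ∘ₗ (N.submoduleOf P).mkQ : P →ₗ[R] P) x ∈ N.submoduleOf P := by
      rw [← Submodule.Quotient.mk_eq_zero, ← Submodule.mkQ_apply, LinearMap.sub_apply, map_sub]
      exact sub_eq_zero.2 (LinearMap.congr_fun hg ((N.submoduleOf P).mkQ x)).symm
    exact this
  refine ⟨LinearMap.codRestrict N (P.subtype ∘ₗ (LinearMap.id - g ∘ₗ (N.submoduleOf P).mkQ))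
    hmem, fun x ↦ Subtype.ext ?_⟩
  have hx : (N.submoduleOf P).mkQ (Submodule.inclusion h x) = 0 :=
    (Submodule.Quotient.mk_eq_zero _).2 x.2
  change ((Submodule.inclusion h x - g ((N.submoduleOf P).mkQ (Submodule.inclusion h x)) : P) : M) =
    x
  rw [hx, map_zero, sub_zero]
  rfl

/-- The terms of an exhaustive filtration with projective quotients are direct summands. -/
lemma exists_retraction_of_projective_filtration {F : ℕ → Submodule R M} (hF : Monotone F)
    (hM : ∀ x, ∃ n, x ∈ F n)
    (hproj : ∀ m, Module.Projective R (F (m + 1) ⧸ (F m).submoduleOf (F (m + 1)))) (n : ℕ) :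
    ∃ r : M →ₗ[R] F n, ∀ x : F n, r x = x := by
  choose ρ hρ using fun m : ℕ ↦
    exists_retraction_of_projective_quotient (N := F m) (P := F (m + 1)) (hF m.le_succ)
  -- `g k` descends from F (n + k) to F n by one-step retractions. Each of these fixes the smaller
  -- term, so the maps agree where both are defined and glue to the whole module.
  let g : (k : ℕ) → F (n + k) →ₗ[R] F n :=
    fun k ↦ Nat.rec LinearMap.id (fun k gk ↦ gk ∘ₗ ρ (n + k)) k
  have hg (k i : ℕ) (x : M) (hx : x ∈ F (n + k)) (hx' : x ∈ F (n + (k + i))) :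
      g (k + i) ⟨x, hx'⟩ = g k ⟨x, hx⟩ := by
    induction i with
    | zero => rfl
    | succ i ih =>
      have hx'' : x ∈ F (n + (k + i)) := hF (by omega) hx
      rw [← ih hx'']
      exact congrArg (g (k + i)) (hρ (n + (k + i)) ⟨x, hx''⟩)
  have hg' {k l : ℕ} {x : M} (hx : x ∈ F (n + k)) (hx' : x ∈ F (n + l)) :
      g k ⟨x, hx⟩ = g l ⟨x, hx'⟩ := by
    rcases le_total k l with h | h
    · obtain ⟨i, rfl⟩ := Nat.exists_eq_add_of_le h
      exact (hg k i x hx hx').symm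
    · obtain ⟨i, rfl⟩ := Nat.exists_eq_add_of_le h
      exact hg l i x hx' hx
  choose d hd using hM
  have hd' (x : M) : x ∈ F (n + d x) := hF (Nat.le_add_left _ _) (hd x)
  refine ⟨{ toFun := fun x ↦ g (d x) ⟨x, hd' x⟩, map_add' := fun x y ↦ ?_,
            map_smul' := fun c x ↦ ?_ }, fun x ↦ hg' (hd' x) (l := 0) x.2⟩
  · have hx : x ∈ F (n + (d x + d y)) := hF (by omega) (hd' x)
    have hy : y ∈ F (n + (d x + d y)) := hF (by omega) (hd' y)
    rw [hg' (hd' x) hx, hg' (hd' y) hy, hg' (hd' (x + y)) (add_mem hx hy), ← map_add]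
    rfl
  · rw [hg' (hd' (c • x)) (Submodule.smul_mem _ c (hd' x))]
    exact map_smul (g (d x)) c ⟨x, hd' x⟩

end FiltrationRetraction

namespace ConnesMoscovici

variable {K : Type*} {A : Type*} {L : Type*} [Field K] [CommRing A] [Algebra K A]
    [LieRing L] [LieAlgebra K L] {ω : L →ₗ⁅K⁆ Derivation K A A}

local notation "U" => UniversalEnvelopingAlgebra K L
local notation "j" => UniversalEnvelopingAlgebra.ι K
local notation "H" => ConnesMoscovici ω
local notation "Ae" => A ⊗[K] A

/-! ### Injectivity of homomorphisms out of the Connes-Moscovici bialgebroid -/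

variable (K L) in
/-- The reduced multiplication `u ⊗ v ↦ (u - ε(u)) (v - ε(v))` of `U(L)`. -/
def augMul : U ⊗[K] U →ₗ[K] U :=
  LinearMap.mul' K U ∘ₗ TensorProduct.map (envAug K L) (envAug K L)

lemma augMul_tmul (u v : U) : augMul K L (u ⊗ₜ v) = envAug K L u * envAug K L v := rfl

lemma contractRep_augMul_tmul_right (f : A →ₗ[K] K) {v : U} (hv : v ∈ envFil K L 0) (a b : A)
    (y : H) : contractRep ω f (augMul K L) (y ⊗ₜ tmul ω a v b) = 0 := by
  induction y using tmul_induction with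
  | zero => rw [TensorProduct.zero_tmul, map_zero]
  | add y z hy hz => rw [TensorProduct.add_tmul, map_add, hy, hz, add_zero]
  | tmul c u d =>
    rw [contractRep_tmul, augMul_tmul, envAug_eq_zero hv, mul_zero, tmul_zero_mid, smul_zero]

lemma contractRep_augMul_tmul_left (f : A →ₗ[K] K) {v : U} (hv : v ∈ envFil K L 0) (a b : A)
    (y : H) : contractRep ω f (augMul K L) (tmul ω a v b ⊗ₜ y) = 0 := by
  induction y using tmul_induction with
  | zero => rw [TensorProduct.tmul_zero, map_zero]
  | add y z hy hz => rw [TensorProduct.tmul_add, map_add, hy, hz, add_zero]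
  | tmul c u d =>
    rw [contractRep_tmul, augMul_tmul, envAug_eq_zero hv, zero_mul, tmul_zero_mid, smul_zero]

/-- This is `mul'_map_envAug_comul_sub_mem` in the middle factor, with the outer factors carried
along. -/
lemma contractRep_augMul_comulRep_sub_mem {f : A →ₗ[K] K} (hf : f 1 = 1) {n : ℕ} {z : H}
    (hz : z ∈ fil ω (n + 1)) :
    contractRep ω f (augMul K L) (comulRep ω z) - ((2 : K) ^ (n + 1) - 2) • z ∈ fil ω n := by
  refine fil_induction (P := fun z ↦ contractRep ω f (augMul K L) (comulRep ω z) -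
    ((2 : K) ^ (n + 1) - 2) • z ∈ fil ω n) ?_ ?_ ?_ hz
  · rw [map_zero, map_zero, smul_zero, sub_zero]; exact zero_mem _
  · intro a u b hu
    have h := tmul_mem_fil (ω := ω) (mul'_map_envAug_comul_sub_mem hu) a b
    rw [sub_eq_add_neg, tmul_add_mid, ← neg_smul, tmul_smul_mid, neg_smul, ← sub_eq_add_neg] at h
    rw [contractRep_comulRep ω f hf]
    exact h
  · intro y z hy hz
    have := add_mem hy hz
    rw [← add_sub_add_comm, ← map_add, ← map_add, ← smul_add] at this
    exact this

/-- A map that fixes `Fₙ` does not change the reduced coproduct of an element of `Fₙ₊₁`. -/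
lemma contractRep_augMul_map (f : A →ₗ[K] K) {n : ℕ} {g : H →ₗ[K] H}
    (hg : ∀ z ∈ fil ω n, g z = z) {z : H} (hz : z ∈ fil ω (n + 1)) :
    contractRep ω f (augMul K L) (TensorProduct.map g g (comulRep ω z)) =
      contractRep ω f (augMul K L) (comulRep ω z) := by
  refine fil_induction (P := fun z ↦ contractRep ω f (augMul K L)
    (TensorProduct.map g g (comulRep ω z)) =
      contractRep ω f (augMul K L) (comulRep ω z)) ?_ ?_ ?_ hz
  · rw [map_zero, map_zero]
  · intro a u b hu
    rw [comulRep_tmul_map]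
    have h := comul_mem_envFilTensor hu
    generalize Coalgebra.comul (R := K) u = w at h
    induction h using Submodule.span_induction with
    | zero => simp only [map_zero]
    | add x y _ _ hx hy => simp only [map_add, hx, hy]
    | smul c x _ hx => simp only [map_smul, hx]
    | mem x hx =>
      obtain ⟨i, k, v, w, hik, hv, hw, rfl⟩ := hx
      rw [TensorProduct.map_tmul, TensorProduct.map_tmul, inclLeft_apply, inclRight_apply]
      -- A term with one factor of degree 0 is killed by the reduced multiplication, before and
      -- after `g`. Otherwise both degrees are at most n, where `g` is the identity.
      rcases Nat.eq_zero_or_pos i with rfl | hi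
      · rw [hg _ (tmul_mem_fil (envFil_mono (Nat.zero_le n) hv) a 1),
          contractRep_augMul_tmul_left f hv, contractRep_augMul_tmul_left f hv]
      rcases Nat.eq_zero_or_pos k with rfl | hk
      · rw [hg _ (tmul_mem_fil (envFil_mono (Nat.zero_le n) hw) 1 b),
          contractRep_augMul_tmul_right f hw, contractRep_augMul_tmul_right f hw]
      · rw [hg _ (tmul_mem_fil (envFil_mono (by omega) hv) a 1),
          hg _ (tmul_mem_fil (envFil_mono (by omega) hw) 1 b)]
  · intro y z hy hz
    simp only [map_add, hy, hz]

section Injective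

variable {B : Type*} [Ring B] [Algebra K B] [LeftBialgebroid K A B]

/-- The relations of the tensor product over A involve only left multiplications by s and t, so left
A^e-linearity is enough; r need not be multiplicative. -/
lemma map_balRel_of_linear (r : B →ₗ[Ae] H) {w : B ⊗[K] B} (hw : w ∈ balRel (eta K A B)) :
    TensorProduct.map (r.restrictScalars K) (r.restrictScalars K) w ∈ balRel (etaMap ω) := by
  have h : balRel (eta K A B) ≤ LinearMap.ker ((balRel (etaMap ω)).mkQ ∘ₗ
      TensorProduct.map (r.restrictScalars K) (r.restrictScalars K)) := balRel_le _ fun a m n ↦ by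
    have h1 : r (tgt (eta K A B) a * m) = tgt (etaMap ω) a * r m := map_smul r (1 ⊗ₜ a : Ae) m
    have h2 : r (src (eta K A B) a * n) = src (etaMap ω) a * r n := map_smul r (a ⊗ₜ 1 : Ae) n
    rw [LinearMap.comp_apply, LinearMap.comp_apply, TensorProduct.map_tmul, TensorProduct.map_tmul,
      LinearMap.restrictScalars_apply, LinearMap.restrictScalars_apply,
      LinearMap.restrictScalars_apply, LinearMap.restrictScalars_apply, h1, h2, mk_balanced]
  exact (Submodule.Quotient.mk_eq_zero _).1 (h hw)

/-- The kernel of a homomorphism of bialgebroids that is split injective on `Fₙ` meets `Fₙ₊₁` only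
in `Fₙ`. -/
lemma mem_fil_of_hom_eq_zero [CharZero K] {ψ : H →ₐ[K] B}
    (hψ : ∀ c : A ⊗[K] A, ψ (etaMap ω c) = eta K A B c)
    (hκ : ∀ X, ψ (incl ω (j X)) ∈ Prim K A B) {n : ℕ} (r : B →ₗ[Ae] H)
    (hr : ∀ z ∈ fil ω (n + 1), r (ψ z) = z) {z : H} (hz : z ∈ fil ω (n + 2)) (h0 : ψ z = 0) :
    z ∈ fil ω (n + 1) := by
  cases subsingleton_or_nontrivial A with
  | inl h =>
    have := subsingleton ω
    rw [Subsingleton.elim z 0]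
    exact zero_mem _
  | inr h =>
    obtain ⟨f, hf⟩ := exists_functional K A
    have h1 := comul_hom hψ hκ z
    rw [h0, map_zero] at h1
    have h2 := map_balRel_of_linear r ((Submodule.Quotient.mk_eq_zero _).1 h1.symm)
    have h3 : contractRep ω f (augMul K L) (TensorProduct.map (r.restrictScalars K)
        (r.restrictScalars K) (TensorProduct.map ψ.toLinearMap ψ.toLinearMap (comulRep ω z))) =
          0 := by
      rw [← contract_mkQ, Submodule.mkQ_apply, (Submodule.Quotient.mk_eq_zero _).2 h2, map_zero]
    -- Since r ∘ ψ fixes the elements of degree at most n + 1, the reduced contraction of Δ(z)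
    -- itself is zero. It is also (2^(n+2) - 2) z modulo lower degree.
    rw [← LinearMap.comp_apply (TensorProduct.map _ _), ← TensorProduct.map_comp,
      contractRep_augMul_map f hr hz] at h3
    have h4 := contractRep_augMul_comulRep_sub_mem hf hz
    rw [h3, zero_sub, neg_mem_iff] at h4
    exact (Submodule.smul_mem_iff ((fil ω (n + 1)).restrictScalars K)
      (two_pow_sub_two_ne_zero n)).1 h4

lemma map_mem_span_range_basis {S V M : Type*} [AddCommGroup V] [Module K V] [AddCommGroup M]
    [Module K M] [Module Ae M] [IsScalarTower K Ae M] (b : Module.Basis S K V) (g : V →ₗ[K] M)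
    (x : V) : g x ∈ Submodule.span Ae (Set.range fun i ↦ g (b i)) := by
  have hx := b.mem_span x
  induction hx using Submodule.span_induction with
  | zero => rw [map_zero]; exact zero_mem _
  | add x y _ _ hx hy => rw [map_add]; exact add_mem hx hy
  | smul c x _ hx => rw [map_smul]; exact Submodule.smul_of_tower_mem _ c hx
  | mem x hx =>
    obtain ⟨i, rfl⟩ := hx
    exact Submodule.subset_span ⟨i, rfl⟩

lemma fil_one_le {S : Type*} (b : Module.Basis S K L) :
    fil ω 1 ≤ Submodule.span Ae {1} ⊔ Submodule.span Ae (Set.range fun i ↦ incl ω (j (b i))) := by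
  rw [fil, Submodule.span_le]
  rintro _ ⟨u, hu, rfl⟩
  rw [envFil_one] at hu
  obtain ⟨c, X, rfl⟩ := mem_envGen.1 hu
  rw [map_add, map_smul, map_one]
  refine add_mem (Submodule.mem_sup_left (Submodule.smul_of_tower_mem _ c
    (Submodule.subset_span rfl))) (Submodule.mem_sup_right ?_)
  exact map_mem_span_range_basis b ((incl ω).toLinearMap ∘ₗ (j : L →ₗ⁅K⁆ U).toLinearMap) X

end Injective

end ConnesMoscovici

namespace Bialgebroid

/-! ### The counit on A^e-spans and the kernel of A ⊗ A → A -/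

section Counit

variable {K : Type*} {A : Type*} {B : Type*} [Field K] [CommRing A] [Algebra K A] [Ring B]
  [Algebra K B] [LeftBialgebroid K A B]

lemma counit_smul (c : A ⊗[K] A) (ξ : B) :
    counit K A B (c • ξ) = LinearMap.mul' K A c * counit K A B ξ := by
  induction c using TensorProduct.induction_on with
  | zero => rw [zero_smul, map_zero, map_zero, zero_mul]
  | add x y hx hy => rw [add_smul, map_add, map_add, hx, hy, add_mul]
  | tmul a b =>
    rw [eta_smul, LinearMap.mul'_apply, mul_right_comm]
    exact PreLeftBialgebroid.counit_eta_mul a b ξ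

lemma counit_span_eq_zero {T : Set B} (hT : ∀ ξ ∈ T, counit K A B ξ = 0) {ξ : B}
    (hξ : ξ ∈ Submodule.span (A ⊗[K] A) T) : counit K A B ξ = 0 := by
  induction hξ using Submodule.span_induction with
  | zero => rw [map_zero]
  | add x y _ _ hx hy => rw [map_add, hx, hy, add_zero]
  | smul c x _ hx => rw [counit_smul, hx, mul_zero]
  | mem x hx => exact hT x hx

-- The kernel of the multiplication of A is the ideal generated by the elements 1 ⊗ a - a ⊗ 1, and η
-- maps these into ⟨s - t⟩.
variable (B) in
lemma eta_mem_span_of_mul'_eq_zero {c : A ⊗[K] A} (hc : LinearMap.mul' K A c = 0) :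
    eta K A B c ∈ Submodule.span (A ⊗[K] A)
      {ξ : B | ∃ a : A, ξ = source K A B a - target K A B a} := by
  have hc' : c ∈ KaehlerDifferential.ideal K A := hc
  rw [← KaehlerDifferential.span_range_eq_ideal] at hc'
  rw [← mul_one (eta K A B c), ← eta_smul]
  refine Submodule.span_induction (p := fun c _ ↦ c • (1 : B) ∈ Submodule.span (A ⊗[K] A)
      {ξ : B | ∃ a : A, ξ = source K A B a - target K A B a}) ?_ ?_ ?_ ?_ hc'
  · rintro _ ⟨a, rfl⟩
    refine Submodule.subset_span ⟨-a, ?_⟩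
    change (1 ⊗ₜ a - a ⊗ₜ 1 : A ⊗[K] A) • (1 : B) = _
    rw [eta_smul, mul_one, map_sub, map_neg, map_neg, neg_sub_neg]
    rfl
  · rw [zero_smul]; exact zero_mem _
  · intro x y _ _ hx hy
    rw [add_smul]; exact add_mem hx hy
  · intro d x _ hx
    rw [smul_eq_mul, mul_smul]; exact Submodule.smul_mem _ d hx

end Counit

end Bialgebroid

namespace ConnesMoscovici

variable {K : Type*} {A : Type*} {L : Type*} [Field K] [CommRing A] [Algebra K A]
    [LieRing L] [LieAlgebra K L] {ω : L →ₗ⁅K⁆ Derivation K A A}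

local notation "U" => UniversalEnvelopingAlgebra K L
local notation "j" => UniversalEnvelopingAlgebra.ι K
local notation "H" => ConnesMoscovici ω
local notation "Ae" => A ⊗[K] A

/-! ### Injectivity in degree at most one and in all degrees -/

section Injective

variable {B : Type*} [Ring B] [Algebra K B] [LeftBialgebroid K A B]

/-- The image of an element of degree at most one is η(c) plus a combination of the images of basis
elements of L. The counit kills the combination, so c multiplies to 0 and η(c) lies in A^e ⟨s - t⟩.
If the image is zero, η(c) also lies in the span of the image of L, so it vanishes by disjointness;
injectivity of η and linear independence then give the claim. -/
lemma eq_zero_of_mem_fil_one {ψ : H →ₐ[K] B}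
    (hψ : ∀ c : A ⊗[K] A, ψ (etaMap ω c) = eta K A B c)
    (hκ : ∀ X, ψ (incl ω (j X)) ∈ Prim K A B)
    (hη : Function.Injective (eta K A B)) {S : Type*} (b : Module.Basis S K L)
    (hb : LinearIndependent Ae fun i ↦ ψ (incl ω (j (b i))))
    (hdisj : Submodule.span Ae {ξ : B | ∃ a : A, ξ = source K A B a - target K A B a} ⊓
      Submodule.span Ae (Set.range fun X ↦ ψ (incl ω (j X))) = ⊥)
    {z : H} (hz : z ∈ fil ω 1) (h0 : ψ z = 0) : z = 0 := by
  obtain ⟨y, hy, w, hw, rfl⟩ := Submodule.mem_sup.1 (fil_one_le b hz)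
  obtain ⟨c, rfl⟩ := Submodule.mem_span_singleton.1 hy
  obtain ⟨l, rfl⟩ := (Finsupp.mem_span_range_iff_exists_finsupp).1 hw
  have hl : ψ (l.sum fun i a ↦ a • incl ω (j (b i))) =
      Finsupp.linearCombination Ae (fun i ↦ ψ (incl ω (j (b i)))) l := by
    rw [Finsupp.linearCombination_apply]
    exact map_finsuppSum (homLinear ψ hψ) l _ |>.trans
      (Finsupp.sum_congr fun i _ ↦ map_smul (homLinear ψ hψ) _ _)
  have hl' : Finsupp.linearCombination Ae (fun i ↦ ψ (incl ω (j (b i)))) l ∈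
      Submodule.span Ae (Set.range fun X ↦ ψ (incl ω (j X))) := by
    refine Submodule.span_mono ?_ (Finsupp.mem_span_range_iff_exists_finsupp.2 ⟨l, rfl⟩)
    rintro _ ⟨i, rfl⟩
    exact ⟨b i, rfl⟩
  have hc : ψ (c • (1 : H)) = eta K A B c := by
    rw [map_eta_smul hψ, map_one, eta_smul, mul_one]
  rw [map_add, hl, hc] at h0
  have hε : counit K A B (Finsupp.linearCombination Ae (fun i ↦ ψ (incl ω (j (b i)))) l) = 0 :=
    counit_span_eq_zero (by rintro _ ⟨X, rfl⟩; exact counit_prim K A ⟨_, hκ X⟩) hl'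
  have hc0 : eta K A B c = 0 := by
    have hm : LinearMap.mul' K A c = 0 := by
      have := congrArg (counit K A B) h0
      rwa [map_add, hε, add_zero, map_zero, ← mul_one (eta K A B c), ← eta_smul, counit_smul,
        show counit K A B 1 = 1 from LeftBialgebroid.counit_one, mul_one] at this
    have hmem : eta K A B c ∈ Submodule.span Ae (Set.range fun X ↦ ψ (incl ω (j X))) := by
      rw [eq_neg_of_add_eq_zero_left h0]
      exact neg_mem hl'
    exact (Submodule.mem_bot Ae).1 (hdisj ▸ ⟨eta_mem_span_of_mul'_eq_zero B hm, hmem⟩)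
  rw [hc0, zero_add] at h0
  rw [(map_eq_zero_iff _ hη).1 hc0, linearIndependent_iff.1 hb l h0, zero_smul, zero_add,
    Finsupp.sum_zero_index]

/-- A homomorphism of bialgebroids from `A ⊙ U(L) ⊙ A` to a graded projective one is injective if
it is injective on the part of degree at most one. -/
lemma hom_injective [CharZero K] {ψ : H →ₐ[K] B}
    (hψ : ∀ c : A ⊗[K] A, ψ (etaMap ω c) = eta K A B c)
    (hκ : ∀ X, ψ (incl ω (j X)) ∈ Prim K A B)
    (hP : ∀ ξ ∈ Prim K A B, ∃ (X : L) (a : A),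
      ξ = ψ (incl ω (j X)) + (source K A B a - target K A B a))
    (hgr : IsGradedProjective K A B) (hgen : IsPrimitivelyGenerated K A B)
    (h1 : ∀ z ∈ fil ω 1, ψ z = 0 → z = 0) : Function.Injective ψ := by
  -- The induction starts in degree 1, because the scalar 2^1 - 2 is zero and reaching degree 1 from
  -- degree 0 is impossible by this method.
  have key (n : ℕ) : ∀ z ∈ fil ω (n + 1), ψ z = 0 → z = 0 := by
    induction n with
    | zero => exact h1
    | succ n ih =>
      intro z hz h0
      -- Graded projectivity makes the term of degree n + 1 a direct summand of B. The shift m + 1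
      -- matches `primFiltrationPred`.
      obtain ⟨r, hr⟩ := exists_retraction_of_projective_filtration
        primFiltration_mono hgen (fun m ↦ hgr (m + 1)) (n + 1)
      let g : fil ω (n + 1) →ₗ[Ae] primFiltration K A B (n + 1) :=
        LinearMap.codRestrict _ (homLinear ψ hψ ∘ₗ (fil ω (n + 1)).subtype) fun x ↦ by
          rw [primFiltration_eq_map hψ hκ hP]
          exact ⟨x, x.2, rfl⟩
      have hg : Function.Injective g := by
        rw [injective_iff_map_eq_zero]
        exact fun x hx ↦ Subtype.ext (ih x x.2 (congrArg Subtype.val hx))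
      have hg' : Function.Surjective g := by
        rintro ⟨ξ, hξ⟩
        have hξ' := hξ
        rw [primFiltration_eq_map hψ hκ hP] at hξ'
        obtain ⟨y, hy, hyξ⟩ := hξ'
        exact ⟨⟨y, hy⟩, Subtype.ext hyξ⟩
      -- By induction ψ identifies the two terms of degree n + 1. The inverse identification after
      -- the retraction is a left inverse of ψ on this term, defined on all of B.
      let e := LinearEquiv.ofBijective g ⟨hg, hg'⟩
      refine ih z (mem_fil_of_hom_eq_zero hψ hκ
        ((fil ω (n + 1)).subtype ∘ₗ e.symm.toLinearMap ∘ₗ r) (fun y hy ↦ ?_) hz h0) h0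
      have h2 : r (ψ y) = e ⟨y, hy⟩ := hr (e ⟨y, hy⟩)
      rw [LinearMap.comp_apply, LinearMap.comp_apply, h2]
      exact congrArg Subtype.val (e.symm_apply_apply ⟨y, hy⟩)
  rw [injective_iff_map_eq_zero]
  intro z hz
  obtain ⟨n, hn⟩ := exists_mem_fil z
  exact key n z (fil_mono n.le_succ hn) hz

/-- A bijective homomorphism from `A ⊙ U(L) ⊙ A` gives an isomorphism of bialgebroids. -/
def isoOfBijective (ψ : H →ₐ[K] B)
    (hψ : ∀ c : A ⊗[K] A, ψ (etaMap ω c) = eta K A B c)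
    (hκ : ∀ X, ψ (incl ω (j X)) ∈ Prim K A B)
    (hω : ∀ X a, counit K A B (ψ (incl ω (j X)) * source K A B a) = ω X a)
    (hbij : Function.Bijective ψ) : LeftBialgebroid.Iso K A B H where
  __ := (AlgEquiv.ofBijective ψ hbij).symm
  map_source a := (AlgEquiv.ofBijective ψ hbij).symm_apply_eq.2 (map_src hψ a).symm
  map_target a := (AlgEquiv.ofBijective ψ hbij).symm_apply_eq.2 (map_tgt hψ a).symm
  map_counit ξ := by
    obtain ⟨z, rfl⟩ := hbij.2 ξ
    change counitMap ω ((AlgEquiv.ofBijective ψ hbij).symm (AlgEquiv.ofBijective ψ hbij z)) = _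
    rw [AlgEquiv.symm_apply_apply, counit_hom hψ hω]
  map_comul ξ := by
    obtain ⟨z, rfl⟩ := hbij.2 ξ
    change _ = (balRel (etaMap ω)).mkQ
      (comulRep ω ((AlgEquiv.ofBijective ψ hbij).symm (AlgEquiv.ofBijective ψ hbij z)))
    rw [AlgEquiv.symm_apply_apply, comul_hom hψ hκ]
    change (balRel (etaMap ω)).mkQ (TensorProduct.map
      (AlgEquiv.ofBijective ψ hbij).symm.toLinearMap
      (AlgEquiv.ofBijective ψ hbij).symm.toLinearMap
      (TensorProduct.map ψ.toLinearMap ψ.toLinearMap (comulRep ω z))) = _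
    have h : (AlgEquiv.ofBijective ψ hbij).symm.toLinearMap ∘ₗ ψ.toLinearMap = LinearMap.id :=
      LinearMap.ext (AlgEquiv.ofBijective ψ hbij).symm_apply_apply
    rw [← LinearMap.comp_apply (TensorProduct.map _ _), ← TensorProduct.map_comp, h,
      TensorProduct.map_id, LinearMap.id_apply]

end Injective

end ConnesMoscovici
end

noncomputable section

namespace Bialgebroid

/-! ### From a semi-direct decomposition to an isomorphism -/

section Decomposition

variable {K : Type*} {A : Type*} {B : Type*} [Field K] [CommRing A] [Algebra K A] [Ring B]
  [Algebra K B] [LeftBialgebroid K A B]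

namespace SemidirectDecomposition

variable (σ : SemidirectDecomposition K A B)

/-- The embedding `ι : P̄ → B` as a morphism of Lie algebras. -/
def ιHom : PrimBar K A B →ₗ⁅K⁆ B :=
  (Prim K A B).incl.comp (σ.equiv.toLieHom.comp (LieAlgebra.SemiDirectSum.inr σ.δ))

/-- The embedding `ι : P̄ → B` takes values in `Prim(B)`. -/
lemma ι_mem (X : PrimBar K A B) : σ.ι X ∈ Prim K A B := Subtype.prop _

lemma counit_ι_mul_source (X : PrimBar K A B) (a : A) :
    counit K A B (σ.ι X * source K A B a) = anchorBar K A B X a := by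
  have h := σ.anchor_equiv (LieAlgebra.SemiDirectSum.inr σ.δ X)
  have h0 : anchor K A (((LieAlgebra.SemiDirectSum.inr σ.δ X).left : sSubT K A B) : Prim K A B) =
      0 := anchor_sSubT K A B _ (Subtype.prop _)
  rw [h0, add_zero] at h
  exact congrArg (fun D : Derivation K A A ↦ D a) h

/-- Primitivity of ι(X) determines its commutator with s(a) as s(ε(ι(X) s(a))), and compatibility
with the anchors identifies the inner term. -/
lemma ι_mul_source (X : PrimBar K A B) (a : A) : σ.ιHom X * source K A B a =
    source K A B a * σ.ιHom X + source K A B (anchorBar K A B X a) := by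
  rw [← σ.counit_ι_mul_source]
  exact prim_mul_source K A ⟨_, σ.ι_mem X⟩ a

lemma ι_mul_target (X : PrimBar K A B) (a : A) : σ.ιHom X * target K A B a =
    target K A B a * σ.ιHom X + target K A B (anchorBar K A B X a) := by
  rw [← σ.counit_ι_mul_source]
  exact prim_mul_target K A ⟨_, σ.ι_mem X⟩ a

/-- The homomorphism `A ⊙ U(P̄) ⊙ A → B` extending `ι`. -/
def hom : ConnesMoscovici (anchorBar K A B) →ₐ[K] B :=
  ConnesMoscovici.liftHom (anchorBar K A B) σ.ιHom σ.ι_mul_source σ.ι_mul_target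

lemma hom_etaMap (c : A ⊗[K] A) :
    σ.hom (ConnesMoscovici.etaMap (anchorBar K A B) c) = eta K A B c :=
  ConnesMoscovici.liftHom_etaMap _ _ _ c

lemma hom_ι (X : PrimBar K A B) :
    σ.hom (ConnesMoscovici.incl (anchorBar K A B) (UniversalEnvelopingAlgebra.ι K X)) = σ.ι X :=
  ConnesMoscovici.liftHom_ι _ _ _ X

lemma exists_eq_of_mem_prim (ξ : B) (hξ : ξ ∈ Prim K A B) : ∃ (X : PrimBar K A B) (a : A),
    ξ = σ.ι X + (source K A B a - target K A B a) := by
  obtain ⟨z, hz⟩ := σ.equiv.surjective ⟨ξ, hξ⟩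
  obtain ⟨a, ha⟩ := z.left.2
  refine ⟨z.right, a, ?_⟩
  have h : z = LieAlgebra.SemiDirectSum.inr σ.δ z.right +
      LieAlgebra.SemiDirectSum.inl σ.δ z.left := by
    ext <;> simp
  rw [h, map_add] at hz
  have h2 := congrArg Subtype.val ((congrArg (σ.equiv (LieAlgebra.SemiDirectSum.inr σ.δ z.right) + ·)
    (σ.equiv_inl z.left)).symm.trans hz)
  rw [← ha]
  exact h2.symm

lemma eq_zero_of_ι_eq_zero {X : PrimBar K A B} (h : σ.ι X = 0) : X = 0 := by
  have h' : σ.equiv (LieAlgebra.SemiDirectSum.inr σ.δ X) = 0 := Subtype.ext h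
  rw [← σ.mk_equiv_inr X, h']
  rfl

/-- The conditions on `B` under which a semi-direct decomposition gives an isomorphism with
`A ⊙ U(P̄) ⊙ A`. -/
lemma nonempty_iso [CharZero K] (hgr : IsGradedProjective K A B)
    (hgen : IsPrimitivelyGenerated K A B) (hη : Function.Injective (eta K A B)) {S : Type*}
    (b : Module.Basis S K (PrimBar K A B))
    (hb : LinearIndependent (A ⊗[K] A) fun i ↦ σ.ι (b i))
    (hdisj : Submodule.span (A ⊗[K] A) {ξ : B | ∃ a : A, ξ = source K A B a - target K A B a} ⊓
      Submodule.span (A ⊗[K] A) (Set.range σ.ι) = ⊥) :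
    Nonempty (LeftBialgebroid.Iso K A B (ConnesMoscovici (anchorBar K A B))) := by
  have hκ (X : PrimBar K A B) : σ.hom (ConnesMoscovici.incl (anchorBar K A B)
      (UniversalEnvelopingAlgebra.ι K X)) ∈ Prim K A B := by
    rw [σ.hom_ι]; exact σ.ι_mem X
  have hP (ξ : B) (hξ : ξ ∈ Prim K A B) : ∃ (X : PrimBar K A B) (a : A),
      ξ = σ.hom (ConnesMoscovici.incl (anchorBar K A B) (UniversalEnvelopingAlgebra.ι K X)) +
        (source K A B a - target K A B a) := by
    simpa only [σ.hom_ι] using σ.exists_eq_of_mem_prim ξ hξ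
  refine ⟨ConnesMoscovici.isoOfBijective σ.hom σ.hom_etaMap hκ (fun X a ↦ ?_) ⟨?_, fun ξ ↦ ?_⟩⟩
  · rw [σ.hom_ι, σ.counit_ι_mul_source]
  · refine ConnesMoscovici.hom_injective σ.hom_etaMap hκ hP hgr hgen fun z hz h0 ↦ ?_
    refine ConnesMoscovici.eq_zero_of_mem_fil_one σ.hom_etaMap hκ hη b ?_ ?_ hz h0
    · simpa only [σ.hom_ι] using hb
    · simpa only [σ.hom_ι] using hdisj
  -- Every element lies in a term of the primitive filtration, and that term is an image of `fil`.
  · obtain ⟨n, hn⟩ := hgen ξ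
    rw [ConnesMoscovici.primFiltration_eq_map σ.hom_etaMap hκ hP] at hn
    obtain ⟨z, -, hz⟩ := hn
    exact ⟨z, hz⟩

end SemidirectDecomposition

/-! ### The semi-direct decomposition defined by a section -/

lemma mk_eq_zero_iff {ξ : Prim K A B} :
    (LieSubmodule.Quotient.mk ξ : PrimBar K A B) = 0 ↔ ξ ∈ sSubT K A B :=
  Submodule.Quotient.mk_eq_zero (sSubT K A B).toSubmodule

variable (κ : PrimBar K A B →ₗ⁅K⁆ Prim K A B)

/-- The action of `P̄` on `⟨s - t⟩` by derivations through a section. -/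
def sectionAct : PrimBar K A B →ₗ⁅K⁆ LieDerivation K (sSubT K A B) (sSubT K A B) where
  toFun X :=
    { toLinearMap := LieModule.toEnd K (Prim K A B) (sSubT K A B) (κ X)
      leibniz' := fun Y Z ↦ Subtype.ext <| by
        change ⁅κ X, ⁅(Y : Prim K A B), (Z : Prim K A B)⁆⁆ =
          ⁅(Y : Prim K A B), ⁅κ X, (Z : Prim K A B)⁆⁆ -
            ⁅(Z : Prim K A B), ⁅κ X, (Y : Prim K A B)⁆⁆
        rw [leibniz_lie, ← lie_skew ⁅κ X, (Y : Prim K A B)⁆, add_comm, sub_eq_add_neg] }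
  map_add' X Y := by
    ext Z : 1
    change ⁅κ (X + Y), Z⁆ = ⁅κ X, Z⁆ + ⁅κ Y, Z⁆
    rw [map_add, add_lie]
  map_smul' c X := by
    ext Z : 1
    change ⁅κ (c • X), Z⁆ = c • ⁅κ X, Z⁆
    rw [map_smul, smul_lie]
  map_lie' {X Y} := by
    ext Z : 1
    rw [LieDerivation.commutator_apply]
    change ⁅κ ⁅X, Y⁆, Z⁆ = ⁅κ X, ⁅κ Y, Z⁆⁆ - ⁅κ Y, ⁅κ X, Z⁆⁆
    rw [LieHom.map_lie, lie_lie]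

lemma coe_sectionAct (X : PrimBar K A B) (Y : sSubT K A B) :
    (sectionAct κ X Y : Prim K A B) = ⁅κ X, (Y : Prim K A B)⁆ := rfl

/-- The semi-direct decomposition defined by a section `P̄ → Prim(B)` of Lie algebras. -/
def SemidirectDecomposition.ofSection
    (hκ : ∀ X, (LieSubmodule.Quotient.mk (κ X) : PrimBar K A B) = X) :
    SemidirectDecomposition K A B where
  δ := sectionAct κ
  anchor_δ X Y := by
    -- Both sides vanish, since ω is zero on the ideal ⟨s - t⟩.
    rw [anchor_sSubT K A B _ Y.2, anchor_sSubT K A B _ (sectionAct κ X Y).2, lie_zero]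
  equiv :=
    { toFun := fun z ↦ (z.left : Prim K A B) + κ z.right
      map_add' := fun y z ↦ by
        change ((y.left + z.left : sSubT K A B) : Prim K A B) + κ (y.right + z.right) = _
        rw [map_add, LieSubmodule.coe_add]
        abel
      map_smul' := fun c z ↦ by
        change ((c • z.left : sSubT K A B) : Prim K A B) + κ (c • z.right) = _
        rw [map_smul, LieSubmodule.coe_smul, RingHom.id_apply, smul_add]
      map_lie' := fun {y z} ↦ by
        change ((⁅y.left, z.left⁆ + sectionAct κ y.right z.left - sectionAct κ z.right y.left :
          sSubT K A B) : Prim K A B) + κ ⁅y.right, z.right⁆ =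
            ⁅(y.left : Prim K A B) + κ y.right, (z.left : Prim K A B) + κ z.right⁆
        rw [LieSubmodule.coe_sub, LieSubmodule.coe_add, coe_sectionAct, coe_sectionAct,
          LieHom.map_lie, add_lie, lie_add, lie_add, ← lie_skew (y.left : Prim K A B) (κ z.right)]
        change ⁅(y.left : Prim K A B), (z.left : Prim K A B)⁆ + _ - _ + _ = _
        abel
      invFun := fun ξ ↦ ⟨⟨ξ - κ (LieSubmodule.Quotient.mk ξ), mk_eq_zero_iff.1 (by
        change (LieSubmodule.Quotient.mk ξ : PrimBar K A B) - LieSubmodule.Quotient.mk (κ _) = 0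
        rw [hκ, sub_self])⟩, LieSubmodule.Quotient.mk ξ⟩
      left_inv := fun z ↦ by
        have h : (LieSubmodule.Quotient.mk ((z.left : Prim K A B) + κ z.right) : PrimBar K A B) =
            z.right := by
          change (LieSubmodule.Quotient.mk (z.left : Prim K A B) : PrimBar K A B) +
            LieSubmodule.Quotient.mk (κ z.right) = z.right
          rw [hκ, mk_eq_zero_iff.2 z.left.2, zero_add]
        refine LieAlgebra.SemiDirectSum.ext (Subtype.ext ?_) h
        change (z.left : Prim K A B) + κ z.right - κ _ = z.left
        rw [h, add_sub_cancel_right]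
      right_inv := fun ξ ↦ sub_add_cancel ξ _ }
  anchor_equiv z := by
    change anchor K A ((z.left : Prim K A B) + κ z.right) = _
    rw [map_add, add_comm]
    congr 1
    -- Written on the class of κ(X), the induced anchor is ω(κ(X)) by definition.
    nth_rw 2 [← hκ z.right]
    rfl
  equiv_inl Y := by
    change (Y : Prim K A B) + κ 0 = Y
    rw [map_zero, add_zero]
  mk_equiv_inr X := by
    change LieSubmodule.Quotient.mk ((0 : Prim K A B) + κ X) = X
    rw [zero_add, hκ]

lemma SemidirectDecomposition.ofSection_ι
    (hκ : ∀ X, (LieSubmodule.Quotient.mk (κ X) : PrimBar K A B) = X) (X : PrimBar K A B) :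
    (SemidirectDecomposition.ofSection κ hκ).ι X = κ X := by
  change (((0 : Prim K A B) + κ X : Prim K A B) : B) = κ X
  rw [zero_add]

end Decomposition

end Bialgebroid
end

/-! ### Projectivity of successive quotients of direct summands -/

noncomputable section

/-- The map id - E' carries P / N into M, and E followed by the quotient map is a left inverse of
it, since E fixes x - E' x for x in P. So P / N is a retract of M. -/
lemma projective_quotient_of_projections {R M : Type*} [Ring R] [AddCommGroup M] [Module R M]
    [Module.Projective R M] {N P : Submodule R M} (h : N ≤ P) (E E' : M →ₗ[R] M)
    (hE : ∀ x, E x ∈ P) (hE' : ∀ x ∈ P, E x = x) (hN : ∀ x, E' x ∈ N) (hN' : ∀ x ∈ N, E' x = x) :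
    Module.Projective R (P ⧸ N.submoduleOf P) := by
  let i : (P ⧸ N.submoduleOf P) →ₗ[R] M :=
    (N.submoduleOf P).liftQ ((LinearMap.id - E') ∘ₗ P.subtype) fun x hx ↦
      LinearMap.mem_ker.2 (sub_eq_zero.2 (hN' x hx).symm)
  let s : M →ₗ[R] P ⧸ N.submoduleOf P := (N.submoduleOf P).mkQ ∘ₗ LinearMap.codRestrict P E hE
  refine Module.Projective.of_split i s (Submodule.linearMap_qext _ (LinearMap.ext fun x ↦ ?_))
  refine (Submodule.Quotient.eq _).2 ?_
  change E ((x : M) - E' x) - x ∈ N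
  rw [hE' _ (sub_mem x.2 (h (hN x))), sub_sub_cancel_left]
  exact neg_mem (hN x)

namespace ConnesMoscovici

/-! ### From an isomorphism to a semi-direct decomposition -/

section Iso

variable {K : Type*} {A : Type*} {L : Type*} [Field K] [CommRing A] [Algebra K A]
    [LieRing L] [LieAlgebra K L] {ω : L →ₗ⁅K⁆ Derivation K A A}
    {B : Type*} [Ring B] [Algebra K B] [LeftBialgebroid K A B]

local notation "U" => UniversalEnvelopingAlgebra K L
local notation "j" => UniversalEnvelopingAlgebra.ι K
local notation "H" => ConnesMoscovici ω
local notation "Ae" => A ⊗[K] A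

lemma source_sub_target_commute (a b : A) :
    (source K A B a - target K A B a) * (source K A B b - target K A B b) =
      (source K A B b - target K A B b) * (source K A B a - target K A B a) := by
  have h (c d : A ⊗[K] A) : eta K A B c * eta K A B d = eta K A B d * eta K A B c := by
    rw [← map_mul, mul_comm, map_mul]
  have hs (a : A) : source K A B a - target K A B a = eta K A B (a ⊗ₜ 1 - 1 ⊗ₜ a) :=
    (map_sub (eta K A B) _ _).symm
  rw [hs, hs, h]

lemma incl_ι_mul_sub (X : L) (a : A) :
    incl ω (j X) * (source K A H a - target K A H a) =
      (source K A H a - target K A H a) * incl ω (j X) +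
        (source K A H (ω X a) - target K A H (ω X a)) := by
  have h1 : incl ω (j X) * source K A H a = _ := incl_mul_src ω X a
  have h2 : incl ω (j X) * target K A H a = _ := incl_mul_tgt ω X a
  rw [mul_sub, h1, h2, sub_mul]
  change _ = _ + (src (etaMap ω) (ω X a) - tgt (etaMap ω) (ω X a))
  change _ = src (etaMap ω) a * _ - tgt (etaMap ω) a * _ + _
  abel

lemma toEnv_incl_add {f : A →ₗ[K] K} (hf : f 1 = 1) (u : U) (a : A) :
    toEnv ω f (incl ω u + (source K A H a - target K A H a)) = u := by
  rw [source_eq, target_eq, incl_apply, map_add, map_sub, toEnv_tmul, toEnv_tmul, toEnv_tmul, hf]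
  simp

/-- `toEnv` need not be multiplicative, but on primitive elements it reads off the component in
U(L). The bracket of X + s(a) - t(a) and Y + s(b) - t(b) is [X, Y] + s(c) - t(c) with c = ω(X)(b) -
ω(Y)(a). -/
lemma toEnv_lie [CharZero K] {f : A →ₗ[K] K} (hf : f 1 = 1) {y z : H} (hy : y ∈ Prim K A H)
    (hz : z ∈ Prim K A H) : toEnv ω f ⁅y, z⁆ = ⁅toEnv ω f y, toEnv ω f z⁆ := by
  obtain ⟨X, a, rfl⟩ := exists_eq_of_mem_prim hy
  obtain ⟨Y, b, rfl⟩ := exists_eq_of_mem_prim hz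
  have h : ⁅incl ω (j X) + (source K A H a - target K A H a),
      incl ω (j Y) + (source K A H b - target K A H b)⁆ =
      incl ω ⁅j X, j Y⁆ + (source K A H (ω X b - ω Y a) - target K A H (ω X b - ω Y a)) := by
    rw [Ring.lie_def, Ring.lie_def, mul_add, add_mul, add_mul, mul_add, add_mul, add_mul,
      incl_ι_mul_sub, incl_ι_mul_sub, source_sub_target_commute b a, map_sub (incl ω), map_mul,
      map_mul, map_sub (source K A H), map_sub (target K A H)]
    abel
  rw [h, toEnv_incl_add hf, toEnv_incl_add hf, toEnv_incl_add hf]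

/-! ### Transport of structure along an isomorphism -/

variable (e : LeftBialgebroid.Iso K A B (ConnesMoscovici ω))

/-- The inverse of an isomorphism of bialgebroids as an algebra map. -/
def isoInv : H →ₐ[K] B := e.toAlgEquiv.symm

lemma isoInv_iso (ξ : B) : isoInv e (e.toAlgEquiv ξ) = ξ := e.toAlgEquiv.symm_apply_apply ξ

lemma iso_isoInv (z : H) : e.toAlgEquiv (isoInv e z) = z := e.toAlgEquiv.apply_symm_apply z

lemma isoInv_bijective : Function.Bijective (isoInv e) := e.toAlgEquiv.symm.bijective

lemma isoInv_source (a : A) : isoInv e (source K A H a) = source K A B a :=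
  e.toAlgEquiv.symm_apply_eq.2 (e.map_source a).symm

lemma isoInv_target (a : A) : isoInv e (target K A H a) = target K A B a :=
  e.toAlgEquiv.symm_apply_eq.2 (e.map_target a).symm

lemma isoInv_etaMap (c : Ae) : isoInv e (etaMap ω c) = eta K A B c := by
  induction c using TensorProduct.induction_on with
  | zero => rw [map_zero, map_zero, map_zero]
  | add x y hx hy => rw [map_add, map_add, map_add, hx, hy]
  | tmul a b =>
    rw [← src_mul_tgt, ← src_mul_tgt, map_mul]
    exact congrArg₂ (· * ·) (isoInv_source e a) (isoInv_target e b)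

/-- The map `e ⊗ e`. -/
def isoTensor : B ⊗[K] B →ₗ[K] H ⊗[K] H :=
  TensorProduct.map e.toAlgEquiv.toLinearMap e.toAlgEquiv.toLinearMap

lemma isoTensor_tmul (x y : B) :
    isoTensor e (x ⊗ₜ y) = e.toAlgEquiv x ⊗ₜ e.toAlgEquiv y := rfl

lemma map_isoTensor (w : B ⊗[K] B) :
    TensorProduct.map (isoInv e).toLinearMap (isoInv e).toLinearMap (isoTensor e w) = w := by
  have h : (isoInv e).toLinearMap ∘ₗ e.toAlgEquiv.toLinearMap = LinearMap.id :=
    LinearMap.ext (isoInv_iso e)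
  rw [isoTensor, ← LinearMap.comp_apply (TensorProduct.map _ _), ← TensorProduct.map_comp, h,
    TensorProduct.map_id, LinearMap.id_apply]

lemma comul_iso {ξ : B} {w : B ⊗[K] B} (h : comul K A B ξ = (balRel (eta K A B)).mkQ w) :
    comul K A H (e.toAlgEquiv ξ) = (balRel (etaMap ω)).mkQ (isoTensor e w) := by
  refine (e.map_comul ξ).symm.trans ?_
  rw [h]
  rfl

/-- Compatibility with Δ is given for e only. For the direction from `H` to B, a representative of
Δ(ξ) is pushed to `H`, compared there modulo the balancing relations, and the difference is pulled
back by the inverse. -/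
lemma iso_mem_prim_iff (ξ : B) : e.toAlgEquiv ξ ∈ Prim K A H ↔ ξ ∈ Prim K A B := by
  have h1 : isoTensor e (ξ ⊗ₜ 1 + 1 ⊗ₜ ξ) =
      e.toAlgEquiv ξ ⊗ₜ 1 + 1 ⊗ₜ e.toAlgEquiv ξ := by
    rw [map_add, isoTensor_tmul, isoTensor_tmul, map_one]
  constructor
  · intro h
    obtain ⟨w, hw⟩ := Submodule.mkQ_surjective _ (comul K A B ξ)
    have h2 : (balRel (etaMap ω)).mkQ (e.toAlgEquiv ξ ⊗ₜ 1 + 1 ⊗ₜ e.toAlgEquiv ξ) =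
      (balRel (etaMap ω)).mkQ (isoTensor e w) := (show _ = _ from h).symm.trans (comul_iso e hw.symm)
    rw [← h1] at h2
    have h3 := map_balRel (isoInv_etaMap e) ((Submodule.Quotient.eq _).1 h2)
    rw [map_sub, map_isoTensor, map_isoTensor] at h3
    exact hw.symm.trans ((Submodule.Quotient.eq _).2 h3).symm
  · intro h
    exact (comul_iso e h).trans (congrArg _ h1)

lemma isoInv_ι_mem_prim (X : L) : isoInv e (incl ω (j X)) ∈ Prim K A B := by
  rw [← iso_mem_prim_iff e, iso_isoInv]
  exact incl_ι_mem_prim X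

lemma exists_eq_isoInv_of_mem_prim [CharZero K] (ξ : B) (hξ : ξ ∈ Prim K A B) : ∃ (X : L) (a : A),
    ξ = isoInv e (incl ω (j X)) + (source K A B a - target K A B a) := by
  obtain ⟨X, a, h⟩ := exists_eq_of_mem_prim ((iso_mem_prim_iff e ξ).2 hξ)
  refine ⟨X, a, ?_⟩
  rw [← isoInv_iso e ξ, h, map_add, map_sub, isoInv_source, isoInv_target]

lemma primFiltration_eq_map_isoInv [CharZero K] (n : ℕ) :
    primFiltration K A B n = (fil ω n).map (homLinear (isoInv e) (isoInv_etaMap e)) :=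
  primFiltration_eq_map (isoInv_etaMap e) (isoInv_ι_mem_prim e) (exists_eq_isoInv_of_mem_prim e) n

/-- The inverse of an isomorphism of bialgebroids as an `Aᵉ`-linear equivalence. -/
def isoInvLinear : H ≃ₗ[Ae] B :=
  LinearEquiv.ofBijective (homLinear (isoInv e) (isoInv_etaMap e)) (isoInv_bijective e)

lemma isoInvLinear_apply (z : H) : isoInvLinear e z = isoInv e z := rfl

lemma isPrimitivelyGenerated_of_iso [CharZero K]
    (e : LeftBialgebroid.Iso K A B (ConnesMoscovici ω)) :
    IsPrimitivelyGenerated K A B := fun ξ ↦ by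
  obtain ⟨n, hn⟩ := exists_mem_fil (e.toAlgEquiv ξ)
  refine ⟨n, ?_⟩
  rw [primFiltration_eq_map_isoInv e]
  exact ⟨_, hn, isoInv_iso e ξ⟩

lemma exists_primFiltration_projection [CharZero K]
    (e : LeftBialgebroid.Iso K A B (ConnesMoscovici ω)) (n : ℕ) : ∃ E : B →ₗ[Ae] B,
    (∀ ξ, E ξ ∈ primFiltration K A B n) ∧ ∀ ξ ∈ primFiltration K A B n, E ξ = ξ := by
  obtain ⟨E, h1, h2⟩ := exists_fil_projection (ω := ω) n
  refine ⟨(isoInvLinear e).toLinearMap ∘ₗ E ∘ₗ (isoInvLinear e).symm.toLinearMap, fun ξ ↦ ?_,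
    fun ξ hξ ↦ ?_⟩
  · rw [primFiltration_eq_map_isoInv e]
    exact ⟨_, h1 _, rfl⟩
  · rw [primFiltration_eq_map_isoInv e] at hξ
    obtain ⟨z, hz, rfl⟩ := hξ
    change isoInvLinear e (E ((isoInvLinear e).symm (isoInvLinear e z))) = isoInvLinear e z
    rw [LinearEquiv.symm_apply_apply, h2 z hz]

lemma isGradedProjective_of_iso [CharZero K]
    (e : LeftBialgebroid.Iso K A B (ConnesMoscovici ω)) :
    IsGradedProjective K A B := fun n ↦ by
  have : Module.Projective Ae B := Module.Projective.of_equiv (isoInvLinear e)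
  obtain ⟨E, h1, h2⟩ := exists_primFiltration_projection e n
  cases n with
  | zero =>
    -- In degree 0 the smaller term is zero, with zero projection.
    exact projective_quotient_of_projections bot_le E 0 h1 h2 (fun x ↦ zero_mem _)
      (fun x hx ↦ ((Submodule.mem_bot Ae).1 hx).symm)
  | succ n =>
    obtain ⟨E', h1', h2'⟩ := exists_primFiltration_projection e n
    exact projective_quotient_of_projections (primFiltration_mono n.le_succ) E E' h1 h2 h1' h2'

/-- The map 1 ⊗ (id - ε) ⊗ 1 kills A^e ⟨s - t⟩ and fixes A^e L, so an element of both is zero. -/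
lemma span_sub_inf_span_isoInv_ι :
    Submodule.span Ae {ξ : B | ∃ a : A, ξ = source K A B a - target K A B a} ⊓
      Submodule.span Ae (Set.range fun X ↦ isoInv e (incl ω (j X))) = ⊥ := by
  let p : B →ₗ[Ae] H := mapMid ω (envAug K L) ∘ₗ (isoInvLinear e).symm.toLinearMap
  have h1 : Submodule.span Ae {ξ : B | ∃ a : A, ξ = source K A B a - target K A B a} ≤
      LinearMap.ker p := by
    rw [Submodule.span_le]
    rintro _ ⟨a, rfl⟩
    rw [← isoInv_source e, ← isoInv_target e, ← map_sub, ← isoInvLinear_apply]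
    change mapMid ω (envAug K L) ((isoInvLinear e).symm (isoInvLinear e _)) = 0
    rw [LinearEquiv.symm_apply_apply, map_sub, source_eq, target_eq, mapMid_tmul, mapMid_tmul,
      envAug_one, tmul_zero_mid, tmul_zero_mid, sub_zero]
  have h2 : Submodule.span Ae (Set.range fun X ↦ isoInv e (incl ω (j X))) ≤
      LinearMap.eqLocus p (isoInvLinear e).symm.toLinearMap := by
    rw [Submodule.span_le]
    rintro _ ⟨X, rfl⟩
    change mapMid ω (envAug K L) ((isoInvLinear e).symm (isoInvLinear e (incl ω (j X)))) =
      (isoInvLinear e).symm (isoInvLinear e (incl ω (j X)))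
    rw [LinearEquiv.symm_apply_apply, mapMid_incl, envAug_ι]
  rw [Submodule.eq_bot_iff]
  rintro ξ ⟨hξ1, hξ2⟩
  have h3 : p ξ = (isoInvLinear e).symm ξ := h2 hξ2
  have h4 : p ξ = 0 := h1 hξ1
  rw [h4] at h3
  exact (LinearEquiv.map_eq_zero_iff _).1 h3.symm

lemma linearIndependent_isoInv {S : Type*} {v : S → U} (hv : LinearIndependent K v) :
    LinearIndependent Ae fun i ↦ isoInv e (incl ω (v i)) :=
  (linearIndependent_incl ω hv).map' (isoInvLinear e).toLinearMap (isoInvLinear e).ker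

lemma eta_injective_of_iso (e : LeftBialgebroid.Iso K A B (ConnesMoscovici ω)) :
    Function.Injective (eta K A B) := fun c d h ↦ by
  rw [← isoInv_etaMap e, ← isoInv_etaMap e] at h
  exact etaMap_injective ω ((isoInv_bijective e).1 h)

lemma eq_sub_of_toEnv_eq_zero [CharZero K] {f : A →ₗ[K] K} (hf : f 1 = 1) {ξ : B}
    (hξ : ξ ∈ Prim K A B) (h : toEnv ω f (e.toAlgEquiv ξ) = 0) :
    ∃ a : A, ξ = source K A B a - target K A B a := by
  obtain ⟨X, a, h'⟩ := exists_eq_of_mem_prim ((iso_mem_prim_iff e ξ).2 hξ)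
  rw [h', toEnv_incl_add hf] at h
  refine ⟨a, ?_⟩
  rw [← isoInv_iso e ξ, h', h, map_zero, zero_add, map_sub, isoInv_source, isoInv_target]

/-- The morphism `L → Prim(B)` defined by an isomorphism `B ≅ A ⊙ U(L) ⊙ A`. -/
def isoPrim : L →ₗ⁅K⁆ Prim K A B where
  toFun X := ⟨isoInv e (incl ω (j X)), isoInv_ι_mem_prim e X⟩
  map_add' X Y := Subtype.ext <| by
    change isoInv e (incl ω (j (X + Y))) = isoInv e (incl ω (j X)) + isoInv e (incl ω (j Y))
    rw [map_add, map_add, map_add]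
  map_smul' c X := Subtype.ext <| by
    change isoInv e (incl ω (j (c • X))) = c • isoInv e (incl ω (j X))
    rw [map_smul, map_smul, map_smul]
  map_lie' {X Y} := Subtype.ext <| by
    change isoInv e (incl ω (j ⁅X, Y⁆)) = ⁅isoInv e (incl ω (j X)), isoInv e (incl ω (j Y))⁆
    rw [LieHom.map_lie, Ring.lie_def, Ring.lie_def, map_sub, map_sub, map_mul, map_mul, map_mul,
      map_mul]

/-- The morphism `L → Prim(B) / ⟨s - t⟩` defined by an isomorphism `B ≅ A ⊙ U(L) ⊙ A`. -/
def isoPrimBar : L →ₗ⁅K⁆ PrimBar K A B where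
  toLinearMap := (LieSubmodule.Quotient.mk' (sSubT K A B)).toLinearMap ∘ₗ (isoPrim e).toLinearMap
  map_lie' {X Y} := congrArg LieSubmodule.Quotient.mk (LieHom.map_lie (isoPrim e) X Y)

/-- Modulo ⟨s - t⟩ every primitive element comes from L; characteristic zero enters through this. -/
lemma isoPrimBar_surjective [CharZero K] : Function.Surjective (isoPrimBar e) := fun Y ↦ by
  obtain ⟨ξ, rfl⟩ := LieSubmodule.Quotient.surjective_mk' _ Y
  obtain ⟨X, a, h⟩ := exists_eq_isoInv_of_mem_prim e ξ ξ.2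
  have h' : ξ - isoPrim e X ∈ (sSubT K A B).toSubmodule := ⟨a, by
    change (ξ : B) - isoInv e (incl ω (j X)) = _
    rw [h, add_sub_cancel_left]⟩
  exact ⟨X, ((Submodule.Quotient.eq _).2 h').symm⟩

/-- The morphism `Prim(B) / ⟨s - t⟩ → U(L)` defined by an isomorphism `B ≅ A ⊙ U(L) ⊙ A`. -/
def primBarToEnv [CharZero K] {f : A →ₗ[K] K} (hf : f 1 = 1) : PrimBar K A B →ₗ⁅K⁆ U where
  toLinearMap := (sSubT K A B).toSubmodule.liftQ
    (toEnv ω f ∘ₗ e.toAlgEquiv.toLinearMap ∘ₗ (Prim K A B).toSubmodule.subtype) fun ξ hξ ↦ by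
      obtain ⟨a, ha⟩ := hξ
      have h : e.toAlgEquiv ξ =
          incl ω 0 + (source K A H a - target K A H a) := by
        rw [ha, map_zero, zero_add, map_sub]
        exact congrArg₂ (· - ·) (e.map_source a) (e.map_target a)
      exact LinearMap.mem_ker.2 ((congrArg (toEnv ω f) h).trans (toEnv_incl_add hf 0 a))
  map_lie' {X Y} := by
    obtain ⟨X, rfl⟩ := LieSubmodule.Quotient.surjective_mk' _ X
    obtain ⟨Y, rfl⟩ := LieSubmodule.Quotient.surjective_mk' _ Y
    change toEnv ω f (e.toAlgEquiv ⁅(X : B), (Y : B)⁆) =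
      ⁅toEnv ω f (e.toAlgEquiv X), toEnv ω f (e.toAlgEquiv Y)⁆
    rw [← toEnv_lie hf ((iso_mem_prim_iff e X).2 X.2) ((iso_mem_prim_iff e Y).2 Y.2),
      Ring.lie_def, Ring.lie_def, map_sub, map_mul, map_mul]

lemma primBarToEnv_injective [CharZero K] {f : A →ₗ[K] K} (hf : f 1 = 1) :
    Function.Injective (primBarToEnv e hf) := by
  rw [injective_iff_map_eq_zero]
  intro X hX
  obtain ⟨ξ, rfl⟩ := LieSubmodule.Quotient.surjective_mk' _ X
  exact mk_eq_zero_iff.2 (eq_sub_of_toEnv_eq_zero e hf ξ.2 hX)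

end Iso

/-! ### The case L = P̄: the section obtained from an isomorphism -/

section PrimBarIso

variable {K : Type*} {A : Type*} {B : Type*} [Field K] [CommRing A] [Algebra K A]
  [Ring B] [Algebra K B] [LeftBialgebroid K A B]
  (e : LeftBialgebroid.Iso K A B (ConnesMoscovici (anchorBar K A B)))

local notation "L" => PrimBar K A B
local notation "j" => UniversalEnvelopingAlgebra.ι K
local notation "ω" => anchorBar K A B

lemma primBar_subsingleton [Subsingleton A]
    (e : LeftBialgebroid.Iso K A B (ConnesMoscovici (anchorBar K A B))) :
    Subsingleton (PrimBar K A B) := by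
  have h1 := subsingleton ω
  have h2 : Subsingleton B := e.toAlgEquiv.injective.subsingleton
  exact (LieSubmodule.Quotient.surjective_mk' (sSubT K A B)).subsingleton

variable [CharZero K]

/-- If `B ≅ A ⊙ U(P̄) ⊙ A`, then `P̄` embeds into its enveloping algebra. -/
lemma ι_injective_of_iso
    (e : LeftBialgebroid.Iso K A B (ConnesMoscovici (anchorBar K A B))) :
    Function.Injective (j : L → UniversalEnvelopingAlgebra K L) := by
  cases subsingleton_or_nontrivial A with
  | inl h =>
    have := primBar_subsingleton e
    exact Function.injective_of_subsingleton _
  | inr h =>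
    obtain ⟨f, hf⟩ := exists_functional K A
    intro X Y hXY
    -- The embedding `primBarToEnv` of P̄ into an associative algebra factors through U(P̄) by the
    -- universal property.
    apply primBarToEnv_injective e hf
    have := congrArg (UniversalEnvelopingAlgebra.lift K (primBarToEnv e hf)) hXY
    rwa [UniversalEnvelopingAlgebra.lift_ι_apply, UniversalEnvelopingAlgebra.lift_ι_apply] at this

/-- If the class of e⁻¹(1 ⊗ X ⊗ 1) is zero, then 1 ⊗ X ⊗ 1 = s(a) - t(a), and comparing components
in U(P̄) leaves X = 0 there. -/
lemma isoPrimBar_injective : Function.Injective (isoPrimBar e) := by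
  cases subsingleton_or_nontrivial A with
  | inl h =>
    have := primBar_subsingleton e
    exact Function.injective_of_subsingleton _
  | inr h =>
    obtain ⟨f, hf⟩ := exists_functional K A
    rw [injective_iff_map_eq_zero]
    intro X hX
    apply ι_injective_of_iso e
    obtain ⟨a, ha⟩ := mk_eq_zero_iff.1 hX
    have h1 := congrArg e.toAlgEquiv ha
    change e.toAlgEquiv (isoInv e (incl ω (j X))) = _ at h1
    rw [iso_isoInv, map_sub] at h1
    have h2 : incl ω (j X) = incl ω 0 + (source K A (ConnesMoscovici ω) a -
        target K A (ConnesMoscovici ω) a) := by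
      rw [h1, map_zero, zero_add]
      exact congrArg₂ (· - ·) (e.map_source a) (e.map_target a)
    have h3 := congrArg (toEnv ω f) h2
    rw [toEnv_incl_add hf, incl_apply, toEnv_tmul, hf, one_smul, one_smul] at h3
    rw [h3, map_zero]

/-- The section `P̄ → Prim(B)` defined by an isomorphism `B ≅ A ⊙ U(P̄) ⊙ A`. -/
def isoSection : L →ₗ⁅K⁆ Prim K A B :=
  (isoPrim e).comp (LieEquiv.ofBijective (isoPrimBar e)
    ⟨isoPrimBar_injective e, isoPrimBar_surjective e⟩).symm.toLieHom

/-- The endomorphism `isoPrimBar` of P̄ need not be the identity, so the section undoes it before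
applying e⁻¹. -/
lemma exists_isoSection_eq (X : L) : ∃ Y : L,
    isoPrimBar e Y = X ∧ (isoSection e X : B) = isoInv e (incl ω (j Y)) :=
  ⟨(LieEquiv.ofBijective (isoPrimBar e)
    ⟨isoPrimBar_injective e, isoPrimBar_surjective e⟩).symm X,
    LieEquiv.apply_symm_apply (LieEquiv.ofBijective (isoPrimBar e)
    ⟨isoPrimBar_injective e, isoPrimBar_surjective e⟩) X, rfl⟩

lemma mk_isoSection (X : L) : (LieSubmodule.Quotient.mk (isoSection e X) : L) = X :=
  LieEquiv.apply_symm_apply (LieEquiv.ofBijective (isoPrimBar e)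
    ⟨isoPrimBar_injective e, isoPrimBar_surjective e⟩) X

/-- The semi-direct decomposition defined by an isomorphism `B ≅ A ⊙ U(P̄) ⊙ A`. -/
def isoDecomposition : SemidirectDecomposition K A B :=
  SemidirectDecomposition.ofSection (isoSection e) (mk_isoSection e)

lemma isoDecomposition_ι (X : L) : (isoDecomposition e).ι X = isoSection e X :=
  SemidirectDecomposition.ofSection_ι _ _ X

lemma range_isoDecomposition_ι : Set.range (isoDecomposition e).ι ⊆
    Set.range fun X ↦ isoInv e (incl ω (j X)) := by
  rintro _ ⟨X, rfl⟩
  obtain ⟨Y, -, hY⟩ := exists_isoSection_eq e X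
  exact ⟨Y, by rw [isoDecomposition_ι, hY]⟩

/-- The correction τ and P̄ → U(P̄) are injective, so a basis stays K-independent in U(P̄) and
becomes A^e-independent in `H`. -/
lemma linearIndependent_isoDecomposition_ι {S : Type*} (b : Module.Basis S K L) :
    LinearIndependent (A ⊗[K] A) fun i ↦ (isoDecomposition e).ι (b i) := by
  let τ : L →ₗ[K] L := ((LieEquiv.ofBijective (isoPrimBar e)
    ⟨isoPrimBar_injective e, isoPrimBar_surjective e⟩).symm.toLieHom : L →ₗ⁅K⁆ L).toLinearMap
  have hτ : Function.Injective τ := (LieEquiv.ofBijective (isoPrimBar e)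
    ⟨isoPrimBar_injective e, isoPrimBar_surjective e⟩).symm.injective
  have h1 : LinearIndependent K fun i ↦ (j : L →ₗ⁅K⁆ UniversalEnvelopingAlgebra K L) (τ (b i)) :=
    b.linearIndependent.map' ((j : L →ₗ⁅K⁆ UniversalEnvelopingAlgebra K L).toLinearMap ∘ₗ τ)
      (LinearMap.ker_eq_bot.2 ((ι_injective_of_iso e).comp hτ))
  have h2 : (fun i ↦ (isoDecomposition e).ι (b i)) = fun i ↦ isoInv e (incl ω (j (τ (b i)))) :=
    funext fun i ↦ isoDecomposition_ι e (b i)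
  rw [h2]
  exact linearIndependent_isoInv e h1

end PrimBarIso

end ConnesMoscovici
end

/-! ### The equivalence -/

theorem mainTheorem10 {K : Type u} {A : Type v} {B : Type w} [Field K] [CharZero K]
    [CommRing A] [Algebra K A] [Ring B] [Algebra K B] [LeftBialgebroid K A B] :
    Nonempty (LeftBialgebroid.Iso K A B (ConnesMoscovici (anchorBar K A B))) ↔
      ∃ σ : SemidirectDecomposition K A B,
        (IsGradedProjective K A B ∧ IsPrimitivelyGenerated K A B) ∧
        ((Submodule.span (A ⊗[K] A) (Set.range σ.ι) = ⊥ ∧ Function.Injective (eta K A B)) ∨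
          (Submodule.span (A ⊗[K] A) (Set.range σ.ι) ≠ ⊥ ∧
            ∃ (S : Type w) (b : Module.Basis S K (PrimBar K A B))
              (β : Module.Basis S (A ⊗[K] A) (Submodule.span (A ⊗[K] A) (Set.range σ.ι))),
              ∀ i, (β i : B) = σ.ι (b i))) ∧
        Submodule.span (A ⊗[K] A) {ξ : B | ∃ a : A, ξ = source K A B a - target K A B a} ⊓
          Submodule.span (A ⊗[K] A) (Set.range σ.ι) = ⊥ := by
  constructor
  · rintro ⟨e⟩
    refine ⟨ConnesMoscovici.isoDecomposition e,
      ⟨ConnesMoscovici.isGradedProjective_of_iso e,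
        ConnesMoscovici.isPrimitivelyGenerated_of_iso e⟩, ?_, ?_⟩
    · by_cases h : Submodule.span (A ⊗[K] A)
        (Set.range (ConnesMoscovici.isoDecomposition e).ι) = ⊥
      · exact Or.inl ⟨h, ConnesMoscovici.eta_injective_of_iso e⟩
      · let b := Module.Basis.ofVectorSpace K (PrimBar K A B)
        have hspan : Submodule.span (A ⊗[K] A)
            (Set.range fun i ↦ (ConnesMoscovici.isoDecomposition e).ι (b i)) =
            Submodule.span (A ⊗[K] A) (Set.range (ConnesMoscovici.isoDecomposition e).ι) := by
          refine le_antisymm (Submodule.span_mono ?_) (Submodule.span_le.2 ?_)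
          · rintro _ ⟨i, rfl⟩
            exact ⟨b i, rfl⟩
          · rintro _ ⟨X, rfl⟩
            exact ConnesMoscovici.map_mem_span_range_basis b
              (ConnesMoscovici.isoDecomposition e).ιHom.toLinearMap X
        refine Or.inr ⟨h, _, b, (Module.Basis.span
          (ConnesMoscovici.linearIndependent_isoDecomposition_ι e b)).map
            (LinearEquiv.ofEq _ _ hspan), fun i ↦ ?_⟩
        rw [Module.Basis.map_apply, LinearEquiv.coe_ofEq_apply, Module.Basis.span_apply]
    · exact le_bot_iff.1 ((inf_le_inf_left _ (Submodule.span_mono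
        (ConnesMoscovici.range_isoDecomposition_ι e))).trans
          (ConnesMoscovici.span_sub_inf_span_isoInv_ι e).le)
  · rintro ⟨σ, ⟨hgr, hgen⟩, h | h, hdisj⟩
    · obtain ⟨h0, hη⟩ := h
      -- As ι is injective, a zero span forces P̄ = 0, and the empty family is a basis.
      have : Subsingleton (PrimBar K A B) := subsingleton_of_forall_eq 0 fun X ↦
        σ.eq_zero_of_ι_eq_zero
          ((Submodule.mem_bot (A ⊗[K] A)).1 (h0 ▸ Submodule.subset_span ⟨X, rfl⟩))
      exact σ.nonempty_iso hgr hgen hη (Module.Basis.empty (ι := PEmpty.{1}) _)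
        linearIndependent_empty_type hdisj
    · obtain ⟨h0, S, b, β, hβ⟩ := h
      -- A nonzero free module has a basis vector, whose annihilator is zero, whereas any c with
      -- η(c) = 0 annihilates all of B.
      have hη : Function.Injective (eta K A B) := by
        cases isEmpty_or_nonempty S with
        | inl hS =>
          have := β.repr.injective.subsingleton
          exact absurd ((Submodule.subsingleton_iff_eq_bot).1 this) h0
        | inr hS =>
          obtain ⟨i⟩ := hS
          rw [injective_iff_map_eq_zero]
          intro c hc
          have h1 : c • β i = 0 := Subtype.ext <| by
            rw [Submodule.coe_smul, eta_smul, hc, zero_mul, Submodule.coe_zero]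
          have h2 := congrArg (fun x ↦ β.repr x i) h1
          simpa using h2
      refine σ.nonempty_iso hgr hgen hη b ?_ hdisj
      have h1 := β.linearIndependent.map' (Submodule.subtype _) (Submodule.ker_subtype _)
      rw [← funext hβ]
      exact h1
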